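/- Fix an integer $n\ge 2$. A *primed number* is a symbol $i$ or $i'$ with $i\in\mathbb{P}=\{1,2,3,\dots\}$, ordered $1'<1<2'<2<\cdots$; a *primed word* is a finite sequence of primed numbers. **Decomposition insertion.** A *hook word* is a word of positive integers $u_1\ge u_2\ge\dots\ge u_m<u_{m+1}<\dots<u_k$ with $1\le m\le k$; its decreasing part is $u_1\cdots u_m$, its increasing part is $u_{m+1}\cdots u_k$, and its middle element is $u_m$. A primed number $x$ is inserted into a shifted tableau (each of whose rows is a hook word with possibly a prime on its middle element) as follows. Put $a_1=x$. On step $i$, insert $a_i$ into row $i$: let $a$ be $a_i$ without its prime, and remove any prime from the middle element $m_i$ of row $i$. If adding $a$ to the end of the row gives a hook word, do so; otherwise $a$ replaces the leftmost entry $b\ge a$ of the increasing part, and then $b$ replaces the leftmost entry $c<b$ of the decreasing part. If row $i$ was empty or the position of the middle element has changed, the new middle element is primed exactly when $a_i$ was, and the bumped entry $c$ (if any) is primed exactly when $m_i$ was; otherwise the middle element is primed exactly when $m_i$ was, and $c$ is primed exactly when $a_i$ was. If a box was added, stop; otherwise $a_{i+1}$ is the (possibly primed) entry $c$. Let $P_{\mathsf{dec}}(w)$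 be the tableau obtained by inserting the letters of $w$, read from right to left, into the empty tableau. **The congruence.** Let $\overset{\mathrm{dec}}{\sim}$ be the smallest congruence (equivalence relation compatible with concatenation) on primed words such that, for all $a,b,c,d\in\mathbb{P}$, $$\begin{aligned} a^\bullet b&\sim a^\bullet b' &&(a\le b), & b\,a^\bullet&\sim b'a^\bullet &&(a<b),\\ a^\bullet b\,d\,c^\circ&\sim a^\bullet d\,b^\circ c &&(a\le b\le c<d), & a^\bullet c\,d\,b^\circ&\sim a^\bullet c\,b^\circ d &&(a\le b<c\le d),\\ d\,a^\bullet c\,b^\circ&\sim a^\bullet d\,c\,b^\circ &&(a\le b<c<d), & b\,a^\bullet d\,c^\circ&\sim b^\circ d\,a^\bullet c &&(a<b\le c<d),\\ c\,b^\bullet d\,a^\circ&\sim c^\bullet d\,b\,a^\circ &&(a<b<c\le d), & d\,b^\bullet c\,a^\circ&\sim b^\bullet d\,c\,a^\circ &&(a<b\le c<d),\\ b^\bullet c\,d\,a^\circ&\sim b^\bullet c\,a^\circ d &&(a<b\le c\le d), & c\,a^\bullet d\,b^\circ&\sim c^\circ d\,a^\bullet b &&(a\le b<c\le d), \end{aligned}$$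 where in each relation all superscripts $\bullet$ stand for the same choice (prime or no prime), and likewise all superscripts $\circ$. **Crystals.** Let $\mathbb{B}_n^+$ be the set $\{1'<1<\dots<n'<n\}$ with $\mathsf{wt}(i)=\mathsf{wt}(i')=\mathbf{e}_i\in\mathbb{Z}^n$ and with operators $f_i$ for $i\in\{\overline 1,0,1,\dots,n-1\}$ given by $f_i: i\mapsto i+1,\ i'\mapsto (i+1)'$ for $i\in[n-1]$, $f_{\overline 1}:1\mapsto 2,\ 1'\mapsto 2'$, $f_0: 1\mapsto 1'$, and $0$ elsewhere, and $e_i$ the partial inverse of $f_i$. For $q^+_n$-crystals $\mathcal{B},\mathcal{C}$ with string lengths $\varepsilon_i(b)=\sup\{k:e_i^k(b)\ne0\}$ and $\varphi_i(b)=\sup\{k:f_i^k(b)\neq0\}$, the tensor product $\mathcal{B}\otimes\mathcal{C}$ has $\mathsf{wt}(b\otimes c)=\mathsf{wt}(b)+\mathsf{wt}(c)$ and, with $b\otimes 0=0\otimes c=0$ and all operators sending $0$ to $0$: - for $i\in[n-1]$, $e_i(b\otimes c)$ is $b\otimes e_i(c)$ if $\varepsilon_i(b)\le\varphi_i(c)$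 and $e_i(b)\otimes c$ otherwise; $f_i(b\otimes c)$ is $b\otimes f_i(c)$ if $\varepsilon_i(b)<\varphi_i(c)$ and $f_i(b)\otimes c$ otherwise; - for $g\in\{e,f\}$, $g_0(b\otimes c)$ is $b\otimes g_0(c)$ if $e_0(b)=f_0(b)=0$, and $g_0(b)\otimes c$ otherwise; - $e_{\overline1}(b\otimes c)$ is $b\otimes e_{\overline1}(c)$ if $e_{\overline1}(b)=f_{\overline1}(b)=0$; else $f_0e_{\overline1}(b)\otimes e_0(c)$ if $f_0e_{\overline1}(b)\ne0\ne e_0(c)$ and $e_0(b)=f_0(b)=0$; else $e_0e_{\overline1}(b)\otimes f_0(c)$ if $e_0e_{\overline1}(b)\ne0\neq f_0(c)$ and $e_0(b)=f_0(b)=0$; else $e_{\overline1}(b)\otimes c$; - $f_{\overline1}(b\otimes c)$ is $b\otimes f_{\overline1}(c)$ if $e_{\overline1}(b)=f_{\overline1}(b)=0$; else $f_{\overline1}e_0(b)\otimes f_0(c)$ if this is nonzero and $e_0f_{\overline1}e_0(b)=f_0f_{\overline1}e_0(b)=0$; else $f_{\overline1}f_0(b)\otimes e_0(c)$ if this is nonzero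 and $e_0f_{\overline1}f_0(b)=f_0f_{\overline1}f_0(b)=0$; else $f_{\overline1}(b)\otimes c$. The tensor product is associative; $(\mathbb{B}_n^+)^{\otimes 0}$ is the one-element crystal of weight $0$ on which all operators are $0$. A primed word $w_1\cdots w_m$ with letters at most $n$ is identified with $w_1\otimes\cdots\otimes w_m\in(\mathbb{B}_n^+)^{\otimes m}$. The full subcrystals of a crystal are the connected components of the graph with edges $x\to y$ whenever $f_i(x)=y$ for some $i\in\{\overline 1,0,1,\dots,n-1\}$, with the restricted weight map and operators. An isomorphism of crystals is a weight-preserving bijection that commutes with all $e_i$ and $f_i$. **Theorem.** Let $v$ and $w$ be primed words with all letters at most $n$, and let $\mathcal{B}$ and $\mathcal{C}$ be the full subcrystals of $(\mathbb{B}^+_n)^{\otimes\ell(v)}$ and $(\mathbb{B}^+_n)^{\otimes\ell(w)}$ that contain $v$ and $w$, respectively. The following are equivalent: (a) $P_{\mathsf{dec}}(v)=P_{\mathsf{dec}}(w)$; (b) $v\overset{\mathrm{dec}}{\sim}w$; (c) there is a $q^+_n$-crystal isomorphism $\mathcal{B}\to\mathcal{C}$ sending $v\mapsto w$. -/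

import Mathlib

namespace QueerPlus

/-! ### Primed words -/

/-- A primed number: `⟨i, false⟩` is the positive integer `i` and `⟨i, true⟩` is the symbol `i'`. -/
structure PNum where
  num : ℕ+
  primed : Bool
deriving DecidableEq

/-! ### Hook words and decomposition insertion -/

/-- Hook words: `w₁ ≥ w₂ ≥ ⋯ ≥ w_m < w_{m+1} < ⋯ < w_k` for some `m ∈ {1, …, k}`. -/
def IsHookWord (u : List ℕ+) : Prop :=
  ∃ m ∈ Finset.Icc 1 u.length,
    (u.take m).Pairwise (· ≥ ·) ∧ (u.drop (m - 1)).Pairwise (· < ·)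

instance (u : List ℕ+) : Decidable (IsHookWord u) := by
  unfold IsHookWord; infer_instance

/-- The longest weakly decreasing prefix; for a hook word this is its decreasing part
`w₁ ⋯ w_m`, whose last letter is the middle element. -/
def decPart : List ℕ+ → List ℕ+
  | [] => []
  | [x] => [x]
  | x :: y :: l => if y ≤ x then x :: decPart (y :: l) else [x]

/-- The rest of the word; for a hook word this is its increasing part `w_{m+1} ⋯ w_k`. -/
def incPart (u : List ℕ+) : List ℕ+ := u.drop (decPart u).length

/-- The (zero-based) position of the middle element of a nonempty hook word. -/
def midIdx (u : List ℕ+) : ℕ := (decPart u).length - 1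

/-- Replace the leftmost entry satisfying `p` by `a`; return the replaced entry and the new list. -/
def replaceFirst (p : ℕ+ → Prop) [DecidablePred p] (a : ℕ+) : List ℕ+ → Option (ℕ+ × List ℕ+)
  | [] => none
  | x :: l => if p x then some (x, a :: l) else (replaceFirst p a l).map fun y => (y.1, x :: y.2)

/-- Insertion of an unprimed number `a` into an unprimed row `u`: the new row, and the number `c`
which is bumped, or `none` if a box was added to the end of the row. The two branches returning
`(u, none)` do not occur when `u` is empty or a hook word. -/
def unprimedRowInsert (u : List ℕ+) (a : ℕ+) : List ℕ+ × Option ℕ+ :=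
  if IsHookWord (u ++ [a]) then (u ++ [a], none)
  else
    match replaceFirst (fun b => a ≤ b) a (incPart u) with
    | none => (u, none)
    | some (b, I) =>
      match replaceFirst (fun c => c < b) b (decPart u) with
      | none => (u, none)
      | some (c, D) => (D ++ I, some c)

/-- Turn an unprimed row into a primed row by putting a prime (if `p = true`) on position `k`
and on no other position. -/
def primeAt (u : List ℕ+) (k : ℕ) (p : Bool) : List PNum :=
  u.mapIdx fun j x => ⟨x, if j = k then p else false⟩

/-- Is the middle element of the row `r` primed? -/
def midPrimed (r : List PNum) : Bool :=
  match r[midIdx (r.map PNum.num)]? with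
  | none => false
  | some m => m.primed

/-- One step of decomposition insertion: insert `x` into the row `r`. Returns the new row and the
number to be inserted in the next row (`none` if the algorithm halts at this row). -/
def rowInsert (r : List PNum) (x : PNum) : List PNum × Option PNum :=
  let u := r.map PNum.num
  let v := (unprimedRowInsert u x.num).1
  let c := (unprimedRowInsert u x.num).2
  if u = [] ∨ midIdx v ≠ midIdx u then
    (primeAt v (midIdx v) x.primed, c.map fun c => ⟨c, midPrimed r⟩)
  else
    (primeAt v (midIdx v) (midPrimed r), c.map fun c => ⟨c, x.primed⟩)

/-- A shifted tableau is recorded by the list of its (nonempty) rows, starting with row 1, each row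
read from left to right; the `i`-th row starts on the main diagonal. -/
abbrev Tableau := List (List PNum)

/-- Decomposition insertion of `x` into a tableau. -/
def decInsert : PNum → Tableau → Tableau
  | x, [] => [(rowInsert [] x).1]
  | x, r :: T =>
    match rowInsert r x with
    | (r', none) => r' :: T
    | (r', some y) => r' :: decInsert y T

/-- The decomposition insertion tableau: the letters of `w` are inserted, from right to left,
into the empty tableau. -/
def Pdec (w : List PNum) : Tableau := w.foldr decInsert []

/-! ### The congruence -/

/-- The ten generating relations. Here `p` is the common prime `•`, `q` the common prime `∘`, and
letters without annotation are unprimed. -/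
inductive DecRel : List PNum → List PNum → Prop
  | r1 (a b : ℕ+) (p : Bool) : a ≤ b →
      DecRel [⟨a, p⟩, ⟨b, false⟩] [⟨a, p⟩, ⟨b, true⟩]
  | r2 (a b : ℕ+) (p : Bool) : a < b →
      DecRel [⟨b, false⟩, ⟨a, p⟩] [⟨b, true⟩, ⟨a, p⟩]
  | r3 (a b c d : ℕ+) (p q : Bool) : a ≤ b → b ≤ c → c < d →
      DecRel [⟨a, p⟩, ⟨b, false⟩, ⟨d, false⟩, ⟨c, q⟩] [⟨a, p⟩, ⟨d, false⟩, ⟨b, q⟩, ⟨c, false⟩]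
  | r4 (a b c d : ℕ+) (p q : Bool) : a ≤ b → b < c → c ≤ d →
      DecRel [⟨a, p⟩, ⟨c, false⟩, ⟨d, false⟩, ⟨b, q⟩] [⟨a, p⟩, ⟨c, false⟩, ⟨b, q⟩, ⟨d, false⟩]
  | r5 (a b c d : ℕ+) (p q : Bool) : a ≤ b → b < c → c < d →
      DecRel [⟨d, false⟩, ⟨a, p⟩, ⟨c, false⟩, ⟨b, q⟩] [⟨a, p⟩, ⟨d, false⟩, ⟨c, false⟩, ⟨b, q⟩]
  | r6 (a b c d : ℕ+) (p q : Bool) : a < b → b ≤ c → c < d →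
      DecRel [⟨b, false⟩, ⟨a, p⟩, ⟨d, false⟩, ⟨c, q⟩] [⟨b, q⟩, ⟨d, false⟩, ⟨a, p⟩, ⟨c, false⟩]
  | r7 (a b c d : ℕ+) (p q : Bool) : a < b → b < c → c ≤ d →
      DecRel [⟨c, false⟩, ⟨b, p⟩, ⟨d, false⟩, ⟨a, q⟩] [⟨c, p⟩, ⟨d, false⟩, ⟨b, false⟩, ⟨a, q⟩]
  | r8 (a b c d : ℕ+) (p q : Bool) : a < b → b ≤ c → c < d →
      DecRel [⟨d, false⟩, ⟨b, p⟩, ⟨c, false⟩, ⟨a, q⟩] [⟨b, p⟩, ⟨d, false⟩, ⟨c, false⟩, ⟨a, q⟩]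
  | r9 (a b c d : ℕ+) (p q : Bool) : a < b → b ≤ c → c ≤ d →
      DecRel [⟨b, p⟩, ⟨c, false⟩, ⟨d, false⟩, ⟨a, q⟩] [⟨b, p⟩, ⟨c, false⟩, ⟨a, q⟩, ⟨d, false⟩]
  | r10 (a b c d : ℕ+) (p q : Bool) : a ≤ b → b < c → c ≤ d →
      DecRel [⟨c, false⟩, ⟨a, p⟩, ⟨d, false⟩, ⟨b, q⟩] [⟨c, q⟩, ⟨d, false⟩, ⟨a, p⟩, ⟨b, false⟩]

/-- The smallest congruence on all primed words which contains the ten relations. -/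
def decCon : Con (FreeMonoid PNum) :=
  conGen fun x y => DecRel x.toList y.toList

/-! ### Crystals -/

/-- The index set `{1̄, 0, 1, …, n-1}`; the zero-based `pos i` stands for the index `i + 1`. -/
inductive Idx (n : ℕ) : Type
  | bar : Idx n
  | zero : Idx n
  | pos (i : Fin (n - 1)) : Idx n

/-- The data of a `𝔮⁺ₙ`-crystal: a set with a weight map to `ℤⁿ`, raising operators `e` and lowering
operators `f`, where `none` is the auxiliary element `0`. Coordinate `k : Fin n` of the weight is
coordinate `k + 1` in one-based numbering. This is only used for the explicit crystals
constructed below. -/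
structure Crystal (n : ℕ) where
  Carrier : Type
  wt : Carrier → Fin n → ℤ
  e : Idx n → Carrier → Option Carrier
  f : Idx n → Carrier → Option Carrier

/-- Iterates of an operator, with `g(0) = 0`. -/
def iter {B : Type} (g : B → Option B) : ℕ → B → Option B
  | 0, b => some b
  | k + 1, b => (iter g k b).bind g

/-- String length: `sup {k ≥ 0 : g^k(b) ≠ 0}`. -/
noncomputable def stringLength {B : Type} (g : B → Option B) (b : B) : ℕ∞ :=
  ⨆ (k : ℕ) (_ : iter g k b ≠ none), (k : ℕ∞)

/-- `b ⊗ c`, which is `0` if `b = 0` or `c = 0`. -/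
def tens {B C : Type} (b : Option B) (c : Option C) : Option (B × C) :=
  b.bind fun b => c.map fun c => (b, c)

open Classical in
/-- The tensor product of `𝔮⁺ₙ`-crystals (anti-Kashiwara convention). -/
noncomputable def tensor {n : ℕ} (B C : Crystal n) : Crystal n where
  Carrier := B.Carrier × C.Carrier
  wt x := B.wt x.1 + C.wt x.2
  e
    | .pos i, (b, c) =>
      if stringLength (B.e (.pos i)) b ≤ stringLength (C.f (.pos i)) c then
        tens (some b) (C.e (.pos i) c)
      else tens (B.e (.pos i) b) (some c)
    | .zero, (b, c) =>
      if B.e .zero b = none ∧ B.f .zero b = none then tens (some b) (C.e .zero c)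
      else tens (B.e .zero b) (some c)
    | .bar, (b, c) =>
      if B.e .bar b = none ∧ B.f .bar b = none then tens (some b) (C.e .bar c)
      else if (B.e .bar b).bind (B.f .zero) ≠ none ∧ C.e .zero c ≠ none ∧
          B.e .zero b = none ∧ B.f .zero b = none then
        tens ((B.e .bar b).bind (B.f .zero)) (C.e .zero c)
      else if (B.e .bar b).bind (B.e .zero) ≠ none ∧ C.f .zero c ≠ none ∧
          B.e .zero b = none ∧ B.f .zero b = none then
        tens ((B.e .bar b).bind (B.e .zero)) (C.f .zero c)
      else tens (B.e .bar b) (some c)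
  f
    | .pos i, (b, c) =>
      if stringLength (B.e (.pos i)) b < stringLength (C.f (.pos i)) c then
        tens (some b) (C.f (.pos i) c)
      else tens (B.f (.pos i) b) (some c)
    | .zero, (b, c) =>
      if B.e .zero b = none ∧ B.f .zero b = none then tens (some b) (C.f .zero c)
      else tens (B.f .zero b) (some c)
    | .bar, (b, c) =>
      if B.e .bar b = none ∧ B.f .bar b = none then tens (some b) (C.f .bar c)
      else if (B.e .zero b).bind (B.f .bar) ≠ none ∧ C.f .zero c ≠ none ∧
          ((B.e .zero b).bind (B.f .bar)).bind (B.e .zero) = none ∧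
          ((B.e .zero b).bind (B.f .bar)).bind (B.f .zero) = none then
        tens ((B.e .zero b).bind (B.f .bar)) (C.f .zero c)
      else if (B.f .zero b).bind (B.f .bar) ≠ none ∧ C.e .zero c ≠ none ∧
          ((B.f .zero b).bind (B.f .bar)).bind (B.e .zero) = none ∧
          ((B.f .zero b).bind (B.f .bar)).bind (B.f .zero) = none then
        tens ((B.f .zero b).bind (B.f .bar)) (C.e .zero c)
      else tens (B.f .bar b) (some c)

/-- The unit for the tensor product: one element of weight `0`, all operators being zero. -/
def unitCrystal (n : ℕ) : Crystal n where
  Carrier := Unit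
  wt _ := 0
  e _ _ := none
  f _ _ := none

/-- Tensor powers `B ⊗ (B ⊗ (⋯ ⊗ (B ⊗ unit)))`. -/
noncomputable def tensorPow {n : ℕ} (B : Crystal n) : ℕ → Crystal n
  | 0 => unitCrystal n
  | m + 1 => tensor B (tensorPow B m)

/-- Regard a primed number as an element of `{1' < 1 < ⋯ < n' < n}`. -/
def toLetter (n : ℕ) (x : PNum) : Option {x : PNum // (x.num : ℕ) ≤ n} :=
  if h : (x.num : ℕ) ≤ n then some ⟨x, h⟩ else none

/-- The standard `𝔮⁺ₙ`-crystal on `{1', 1, …, n', n}` (for `n ≥ 2`): the operator `f_i` maps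
`i ↦ i+1` and `i' ↦ (i+1)'`, the operator `f_{1̄}` maps `1 ↦ 2` and `1' ↦ 2'`, the operator `f_0`
maps `1 ↦ 1'`, and the operators `e` go backwards. -/
def stdCrystal (n : ℕ) : Crystal n where
  Carrier := {x : PNum // (x.num : ℕ) ≤ n}
  wt x k := if (x.1.num : ℕ) = (k : ℕ) + 1 then 1 else 0
  e
    | .bar, x => if x.1.num = 2 then toLetter n ⟨1, x.1.primed⟩ else none
    | .zero, x => if x.1 = ⟨1, true⟩ then toLetter n ⟨1, false⟩ else none
    | .pos i, x =>
      if (x.1.num : ℕ) = (i : ℕ) + 2 then toLetter n ⟨i.1.succPNat, x.1.primed⟩ else none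
  f
    | .bar, x => if x.1.num = 1 then toLetter n ⟨2, x.1.primed⟩ else none
    | .zero, x => if x.1 = ⟨1, false⟩ then toLetter n ⟨1, true⟩ else none
    | .pos i, x =>
      if (x.1.num : ℕ) = (i : ℕ) + 1 then toLetter n ⟨x.1.num + 1, x.1.primed⟩ else none

/-- The element `w₁ ⊗ w₂ ⊗ ⋯ ⊗ w_m` of the tensor power attached to a primed word. -/
noncomputable def wordTensor (n : ℕ) : (w : List PNum) → (∀ x ∈ w, (x.num : ℕ) ≤ n) →
    (tensorPow (stdCrystal n) w.length).Carrier
  | [], _ => ()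
  | x :: w, h => (⟨x, h x List.mem_cons_self⟩,
      wordTensor n w fun y hy => h y (List.mem_cons_of_mem x hy))

/-- The connected component of `b` in the crystal graph, which has an edge `x → y` whenever
`f_i(x) = y` for some index `i`. -/
def component {n : ℕ} (B : Crystal n) (b : B.Carrier) : Set B.Carrier :=
  {c | Relation.EqvGen (fun x y => ∃ i, B.f i x = some y) b c}

open Classical in
/-- The full subcrystal containing `b`: the connected component of `b`, with the restrictions of the
weight map and of the crystal operators. (Operators never leave the component in a crystal; the
test for membership only serves to give the restricted operators their type.) -/
noncomputable def fullSubcrystal {n : ℕ} (B : Crystal n) (b : B.Carrier) : Crystal n where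
  Carrier := component B b
  wt x := B.wt x.1
  e i x := (B.e i x.1).bind fun y => if h : y ∈ component B b then some ⟨y, h⟩ else none
  f i x := (B.f i x.1).bind fun y => if h : y ∈ component B b then some ⟨y, h⟩ else none

/-- `b` as an element of the full subcrystal containing it. -/
def base {n : ℕ} (B : Crystal n) (b : B.Carrier) : (fullSubcrystal B b).Carrier :=
  ⟨b, Relation.EqvGen.refl b⟩

/-- Crystal isomorphisms: weight-preserving bijections commuting with all crystal operators, with
the convention `φ(0) = 0`. -/
structure IsCrystalIso {n : ℕ} (B C : Crystal n) (φ : B.Carrier → C.Carrier) : Prop where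
  bijective : Function.Bijective φ
  wt_eq : ∀ b, C.wt (φ b) = B.wt b
  map_e : ∀ i b, C.e i (φ b) = (B.e i b).map φ
  map_f : ∀ i b, C.f i (φ b) = (B.f i b).map φ

end QueerPlus

/-! The whole argument takes place on words. An element of a tensor power of the standard crystal is
a word. On words the operators of positive index follow the bracketing rule (`wF`, `wE`), those of
index zero re-prime the leftmost letter 1 (`setp`), and those of barred index exchange a first
letter 1 or 2 while passing its prime on to the next 1 (`wFb`, `wEb`). A crystal isomorphism then
becomes an `IsBisim` relation between words: it respects weights, primes of the leftmost 1, and all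
operators.

From (a) to (b): every row insertion is a chain of generating relations (`RowIns.dec`). Hence a word
is congruent to the reading word of its tableau (`Pdec_spec`).

The core is a rigidity statement, `IsBisim.eq`: two bisimilar reading words of decomposition
tableaux are equal. In such a tableau each row is a hook word, and no hook subword of the word read
from that row onwards is longer. The length of a longest hook subword is invariant under the
congruence (`Dec.hb`) and does not grow under crystal operators, so the reading words of a given
shape are closed under all operators. One may therefore move both words simultaneously to an element
whose weight is lexicographically maximal, the largest letter being compared first. By `LexMax.free`
such a word begins with the largest letter, and the word after that first letter is annihilated by
all lowering operators of positive index. For a tableau this forces the first row to be constant.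
Its length is read off the weight, and the prime of its first letter is read off after that letter
has been raised to 1. Remove the row and induct on the largest letter.

The congruence is itself a bisimulation (`Dec.posCompat`, `Dec.barCompat`), so rigidity gives (b)
implies (a). It also shows that the shape of `Pdec w` is constant on a component, and that so is the
difference of the parities of primes in `w` and in its tableau. These two invariants restore what an
insertion step forgets, namely the row in which the box was added and possibly one prime. Hence a
component contains no two words with the same tableau (`Conn.eq_of_Pdec_eq`).

From (b) to (c): bisimilarity gives every element of one component a congruent partner in the other,
and by the preceding statement the partner is unique; this matching is the isomorphism. From (c) to
(a): the graph of an isomorphism is a bisimulation. Composed with the congruence on both sides it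
relates the reading words of the two tableaux, and rigidity applies. -/

namespace QueerPlus

/-! ### Operators on words -/

/-- Lowering string length of a letter. -/
def phiL (i : ℕ+) (x : PNum) : ℕ := if x.num = i then 1 else 0

/-- Raising string length of a letter. -/
def epsL (i : ℕ+) (x : PNum) : ℕ := if x.num = i + 1 then 1 else 0

/-- Lowering string length of a word. -/
def phi (i : ℕ+) : List PNum → ℕ
  | [] => 0
  | x :: w => phiL i x + (phi i w - epsL i x)

/-- Raising string length of a word. -/
def eps (i : ℕ+) : List PNum → ℕ
  | [] => 0
  | x :: w => eps i w + (epsL i x - phi i w)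

/-- The lowering operator `f_i` on words. -/
def wF (i : ℕ+) : List PNum → Option (List PNum)
  | [] => none
  | x :: w =>
    if epsL i x < phi i w then (wF i w).map (x :: ·)
    else if x.num = i then some (⟨i + 1, x.primed⟩ :: w) else none

/-- The raising operator `e_i` on words. -/
def wE (i : ℕ+) : List PNum → Option (List PNum)
  | [] => none
  | x :: w =>
    if epsL i x ≤ phi i w then (wE i w).map (x :: ·)
    else if x.num = i + 1 then some (⟨i, x.primed⟩ :: w) else none

/-- The prime on the leftmost letter `1` or `1'`. -/
def p0 : List PNum → Option Bool
  | [] => none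
  | x :: w => if x.num = 1 then some x.primed else p0 w

/-- Set the prime of the leftmost letter `1` or `1'`. -/
def setp (b : Bool) : List PNum → List PNum
  | [] => []
  | x :: w => if x.num = 1 then ⟨1, b⟩ :: w else x :: setp b w

/-- The lowering operator `f_{1̄}` on words. -/
def wFb : List PNum → Option (List PNum)
  | [] => none
  | x :: w =>
    if x.num = 1 then some (⟨2, (p0 w).getD x.primed⟩ :: setp x.primed w)
    else if x.num = 2 then none else (wFb w).map (x :: ·)

/-- The raising operator `e_{1̄}` on words. -/
def wEb : List PNum → Option (List PNum)
  | [] => none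
  | x :: w =>
    if x.num = 2 then some (⟨1, (p0 w).getD x.primed⟩ :: setp x.primed w)
    else if x.num = 1 then none else (wEb w).map (x :: ·)

/-- The number of letters with a given absolute value. -/
def cn (k : ℕ+) (w : List PNum) : ℕ := (w.map PNum.num).count k

theorem PNat.succ_ne (i : ℕ+) : i + 1 ≠ i := by
  intro h; have := congrArg PNat.val h; simp at this

@[simp] theorem phi_nil (i : ℕ+) : phi i [] = 0 := rfl
@[simp] theorem eps_nil (i : ℕ+) : eps i [] = 0 := rfl
@[simp] theorem wF_nil (i : ℕ+) : wF i [] = none := rfl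
@[simp] theorem wE_nil (i : ℕ+) : wE i [] = none := rfl
theorem phi_cons (i : ℕ+) (x : PNum) (w : List PNum) :
    phi i (x :: w) = phiL i x + (phi i w - epsL i x) := rfl
theorem eps_cons (i : ℕ+) (x : PNum) (w : List PNum) :
    eps i (x :: w) = eps i w + (epsL i x - phi i w) := rfl

/-- The tensor product rule may be applied at any cut of the word, not only after the first letter.
Truncated subtraction counts what survives cancellation. -/
theorem phi_append (i : ℕ+) (u v : List PNum) :
    phi i (u ++ v) = phi i u + (phi i v - eps i u) := by
  induction u with
  | nil => simp
  | cons x u ih => simp only [List.cons_append, phi_cons, eps_cons, ih]; omega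

theorem eps_append (i : ℕ+) (u v : List PNum) :
    eps i (u ++ v) = eps i v + (eps i u - phi i v) := by
  induction u with
  | nil => simp
  | cons x u ih => simp only [List.cons_append, eps_cons, ih, phi_append]; omega

theorem cn_cons (k : ℕ+) (x : PNum) (w : List PNum) :
    cn k (x :: w) = cn k w + if x.num = k then 1 else 0 := by
  simp [cn, List.count_cons]

@[simp] theorem cn_nil (k : ℕ+) : cn k [] = 0 := rfl

@[simp] theorem cn_append (k : ℕ+) (u v : List PNum) : cn k (u ++ v) = cn k u + cn k v := by
  simp [cn]

theorem phi_add_cn (i : ℕ+) (w : List PNum) :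
    phi i w + cn (i + 1) w = eps i w + cn i w := by
  induction w with
  | nil => simp
  | cons x w ih =>
    simp only [phi_cons, eps_cons, cn_cons, phiL, epsL]
    by_cases h1 : x.num = i
    · have : ¬ i = i + 1 := fun h => PNat.succ_ne i h.symm
      simp [h1, this]; omega
    · by_cases h2 : x.num = i + 1
      · simp [h2, PNat.succ_ne]; omega
      · simp [h1, h2]; omega

@[simp] theorem phiL_self (i : ℕ+) (p : Bool) : phiL i ⟨i, p⟩ = 1 := by simp [phiL]
@[simp] theorem epsL_self (i : ℕ+) (p : Bool) : epsL i ⟨i, p⟩ = 0 := by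
  simp [epsL, (PNat.succ_ne i).symm]
@[simp] theorem phiL_succ (i : ℕ+) (p : Bool) : phiL i ⟨i + 1, p⟩ = 0 := by
  simp [phiL, PNat.succ_ne]
@[simp] theorem epsL_succ (i : ℕ+) (p : Bool) : epsL i ⟨i + 1, p⟩ = 1 := by simp [epsL]

theorem letter_cases (i : ℕ+) (x : PNum) : (∃ p, x = ⟨i, p⟩) ∨ (∃ p, x = ⟨i + 1, p⟩) ∨
    (x.num ≠ i ∧ x.num ≠ i + 1 ∧ phiL i x = 0 ∧ epsL i x = 0) := by
  obtain ⟨a, p⟩ := x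
  by_cases h1 : a = i
  · exact .inl ⟨p, by rw [h1]⟩
  · by_cases h2 : a = i + 1
    · exact .inr (.inl ⟨p, by rw [h2]⟩)
    · exact .inr (.inr (by simp [phiL, epsL, h1, h2]))

/-- Bracket each `i + 1` with an `i` to its right. The unbracketed letters read `i … i (i+1) …
(i+1)`, and the operator acts on the last unbracketed `i`. The conditions on `A` and `B` say exactly
that this is the boundary. They do not mention the changed letter, which is why raising and lowering
are mutually inverse. -/
theorem wF_eq_some (i : ℕ+) (w w' : List PNum) : wF i w = some w' ↔
    ∃ A B p, w = A ++ ⟨i, p⟩ :: B ∧ w' = A ++ ⟨i + 1, p⟩ :: B ∧ eps i A = 0 ∧ phi i B = 0 := by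
  induction w generalizing w' with
  | nil => simp
  | cons x w ih =>
    obtain ⟨a, p⟩ := x
    simp only [wF]
    split_ifs with h1 h2
    · simp only [Option.map_eq_some_iff, ih]
      constructor
      · rintro ⟨_, ⟨A, B, p, rfl, rfl, hA, hB⟩, rfl⟩
        refine ⟨_ :: A, B, p, rfl, rfl, ?_, hB⟩
        rw [eps_cons]
        rw [phi_append, phi_cons, hB, hA] at h1
        simp at h1
        omega
      · rintro ⟨A, B, q, h, rfl, hA, hB⟩
        cases A with
        | nil =>
          simp at h
          obtain ⟨_, rfl⟩ := h
          omega
        | cons y A =>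
          simp at h
          obtain ⟨rfl, rfl⟩ := h
          refine ⟨_, ⟨A, B, q, rfl, rfl, ?_, hB⟩, rfl⟩
          rw [eps_cons] at hA; omega
    · replace h2 : a = i := h2
      subst h2
      constructor
      · intro h
        refine ⟨[], w, p, rfl, ?_, rfl, ?_⟩
        · simpa using h.symm
        · simpa using h1
      · rintro ⟨A, B, q, h, rfl, hA, hB⟩
        cases A with
        | nil => simp at h; obtain ⟨rfl, rfl⟩ := h; simp
        | cons y A =>
          simp at h
          obtain ⟨rfl, rfl⟩ := h
          exfalso; apply h1
          rw [eps_cons] at hA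
          rw [phi_append, phi_cons, hB]
          simp [show eps a A = 0 by omega]
    · simp only [false_iff]
      rintro ⟨A, B, q, h, rfl, hA, hB⟩
      cases A with
      | nil => simp at h; exact h2 h.1.1
      | cons y A =>
        simp at h
        obtain ⟨rfl, rfl⟩ := h
        apply h1
        rw [eps_cons] at hA
        rw [phi_append, phi_cons, hB]
        simp
        omega

theorem wE_eq_some (i : ℕ+) (w w' : List PNum) : wE i w = some w' ↔
    ∃ A B p, w = A ++ ⟨i + 1, p⟩ :: B ∧ w' = A ++ ⟨i, p⟩ :: B ∧ eps i A = 0 ∧ phi i B = 0 := by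
  induction w generalizing w' with
  | nil => simp
  | cons x w ih =>
    obtain ⟨a, p⟩ := x
    simp only [wE]
    split_ifs with h1 h2
    · simp only [Option.map_eq_some_iff, ih]
      constructor
      · rintro ⟨_, ⟨A, B, p, rfl, rfl, hA, hB⟩, rfl⟩
        refine ⟨_ :: A, B, p, rfl, rfl, ?_, hB⟩
        rw [eps_cons]
        rw [phi_append, phi_cons, hB, hA] at h1
        simp at h1
        omega
      · rintro ⟨A, B, q, h, rfl, hA, hB⟩
        cases A with
        | nil =>
          simp at h
          obtain ⟨⟨rfl, rfl⟩, rfl⟩ := h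
          simp at h1
          omega
        | cons y A =>
          simp at h
          obtain ⟨rfl, rfl⟩ := h
          refine ⟨_, ⟨A, B, q, rfl, rfl, ?_, hB⟩, rfl⟩
          rw [eps_cons] at hA; omega
    · replace h2 : a = i + 1 := h2
      subst h2
      rw [epsL_succ] at h1
      constructor
      · intro h
        refine ⟨[], w, p, rfl, ?_, rfl, by omega⟩
        simpa using h.symm
      · rintro ⟨A, B, q, h, rfl, hA, hB⟩
        cases A with
        | nil => simp at h; obtain ⟨rfl, rfl⟩ := h; simp
        | cons y A =>
          simp at h
          obtain ⟨rfl, rfl⟩ := h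
          rw [eps_cons, epsL_succ] at hA
          rw [phi_append, phi_cons, hB] at h1
          simp at h1
          omega
    · simp only [false_iff]
      rintro ⟨A, B, q, h, rfl, hA, hB⟩
      cases A with
      | nil => simp at h; exact h2 h.1.1
      | cons y A =>
        simp at h
        obtain ⟨rfl, rfl⟩ := h
        rw [eps_cons] at hA
        have : epsL i ⟨a, p⟩ = 0 := by simp [epsL]; exact h2
        omega

theorem wE_iff_wF (i : ℕ+) (w w' : List PNum) : wE i w = some w' ↔ wF i w' = some w := by
  rw [wE_eq_some, wF_eq_some]
  constructor <;> rintro ⟨A, B, p, h1, h2, h3⟩ <;> exact ⟨A, B, p, h2, h1, h3⟩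

theorem wF_eq_none (i : ℕ+) (w : List PNum) : wF i w = none ↔ phi i w = 0 := by
  induction w with
  | nil => simp
  | cons x w ih =>
    simp only [wF, phi_cons]
    rcases letter_cases i x with ⟨p, rfl⟩ | ⟨p, rfl⟩ | ⟨h1, h2, h3, h4⟩
    all_goals split_ifs
    all_goals simp_all
    all_goals omega

theorem wF_append (i : ℕ+) (u v : List PNum) : wF i (u ++ v) =
    if eps i u < phi i v then (wF i v).map (u ++ ·) else (wF i u).map (· ++ v) := by
  induction u with
  | nil => by_cases h : phi i v = 0 <;> simp [h, (wF_eq_none i v).2, Nat.pos_iff_ne_zero]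
  | cons x u ih =>
    simp only [List.cons_append, wF, phi_append, eps_cons, ih]
    by_cases h1 : epsL i x < phi i u <;> by_cases h2 : eps i u < phi i v <;>
      simp only [h1, h2, if_true, if_false] <;> split_ifs <;>
      first | omega | rfl | simp [Function.comp_def]

theorem wE_append (i : ℕ+) (u v : List PNum) : wE i (u ++ v) =
    if eps i u ≤ phi i v then (wE i v).map (u ++ ·) else (wE i u).map (· ++ v) := by
  induction u with
  | nil => simp
  | cons x u ih =>
    simp only [List.cons_append, wE, phi_append, eps_cons, ih]
    by_cases h1 : epsL i x ≤ phi i u <;> by_cases h2 : eps i u ≤ phi i v <;>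
      simp only [h1, h2, if_true, if_false] <;> split_ifs <;>
      first | omega | rfl | simp [Function.comp_def]

theorem wF_phi {i : ℕ+} {w w' : List PNum} (h : wF i w = some w') :
    phi i w = phi i w' + 1 ∧ eps i w' = eps i w + 1 := by
  obtain ⟨A, B, p, rfl, rfl, hA, hB⟩ := (wF_eq_some _ _ _).1 h
  simp [phi_append, eps_append, phi_cons, eps_cons, hA, hB]

/-! ### Primes of the letters `1` -/

theorem p0_append (u v : List PNum) : p0 (u ++ v) = (p0 u).or (p0 v) := by
  induction u with
  | nil => simp [p0]
  | cons x u ih => simp only [List.cons_append, p0]; split_ifs <;> simp [ih]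

theorem setp_append (b : Bool) (u v : List PNum) :
    setp b (u ++ v) = if p0 u = none then u ++ setp b v else setp b u ++ v := by
  induction u with
  | nil => simp [p0]
  | cons x u ih => simp only [List.cons_append, p0, setp]; split_ifs <;> simp_all

theorem p0_setp (b : Bool) (w : List PNum) : p0 (setp b w) = (p0 w).map fun _ => b := by
  induction w with
  | nil => rfl
  | cons x w ih => simp only [p0, setp]; split_ifs <;> simp_all [p0]

theorem setp_setp (b c : Bool) (w : List PNum) : setp b (setp c w) = setp b w := by
  induction w with
  | nil => rfl
  | cons x w ih => simp only [setp]; split_ifs <;> simp_all [setp]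

theorem setp_of_p0 {b : Bool} {w : List PNum} (h : ∀ c, p0 w = some c → b = c) :
    setp b w = w := by
  induction w with
  | nil => rfl
  | cons x w ih =>
    simp only [p0, setp] at *
    obtain ⟨a, p⟩ := x
    split_ifs at * <;> simp_all

@[simp] theorem map_num_setp (b : Bool) (w : List PNum) :
    (setp b w).map PNum.num = w.map PNum.num := by
  induction w with
  | nil => rfl
  | cons x w ih => simp only [setp]; split_ifs <;> simp_all

@[simp] theorem setp_length (b : Bool) (w : List PNum) : (setp b w).length = w.length := by
  rw [← List.length_map (f := PNum.num), map_num_setp, List.length_map]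

/-- The operator acts on the first letter with value 1 or 2. Its prime is exchanged with that of the
next 1, so the prime of the leftmost 1 survives; the default `p` covers the case that no further 1
exists and the prime stays in place. -/
theorem wFb_eq_some (w w' : List PNum) : wFb w = some w' ↔
    ∃ A B p, (∀ x ∈ A, x.num ≠ 1 ∧ x.num ≠ 2) ∧ w = A ++ ⟨1, p⟩ :: B ∧
      w' = A ++ ⟨2, (p0 B).getD p⟩ :: setp p B := by
  induction w generalizing w' with
  | nil => simp [wFb]
  | cons x w ih =>
    obtain ⟨a, p⟩ := x
    simp only [wFb]
    split_ifs with h1 h2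
    · subst h1
      constructor
      · intro h; exact ⟨[], w, p, by simp, rfl, by simpa using h.symm⟩
      · rintro ⟨A, B, q, hA, h, rfl⟩
        cases A with
        | nil => simp at h; simp [h]
        | cons y A => simp at h; exact absurd (by simp [← h.1]) (hA y (by simp)).1
    · subst h2
      simp only [false_iff]
      rintro ⟨A, B, q, hA, h, rfl⟩
      cases A with
      | nil => simp at h
      | cons y A => simp at h; exact absurd (by simp [← h.1]) (hA y (by simp)).2
    · simp only [Option.map_eq_some_iff, ih]
      constructor
      · rintro ⟨_, ⟨A, B, q, hA, rfl, rfl⟩, rfl⟩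
        exact ⟨_ :: A, B, q, by simpa using ⟨⟨h1, h2⟩, hA⟩, rfl, rfl⟩
      · rintro ⟨A, B, q, hA, h, rfl⟩
        cases A with
        | nil => simp at h; exact absurd h.1.1 h1
        | cons y A =>
          simp at h; obtain ⟨rfl, rfl⟩ := h
          exact ⟨_, ⟨A, B, q, fun x hx => hA x (by simp [hx]), rfl, rfl⟩, rfl⟩

theorem wEb_eq_some (w w' : List PNum) : wEb w = some w' ↔
    ∃ A B p, (∀ x ∈ A, x.num ≠ 1 ∧ x.num ≠ 2) ∧ w = A ++ ⟨2, p⟩ :: B ∧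
      w' = A ++ ⟨1, (p0 B).getD p⟩ :: setp p B := by
  induction w generalizing w' with
  | nil => simp [wEb]
  | cons x w ih =>
    obtain ⟨a, p⟩ := x
    simp only [wEb]
    split_ifs with h1 h2
    · subst h1
      constructor
      · intro h; exact ⟨[], w, p, by simp, rfl, by simpa using h.symm⟩
      · rintro ⟨A, B, q, hA, h, rfl⟩
        cases A with
        | nil => simp at h; simp [h]
        | cons y A => simp at h; exact absurd (by simp [← h.1]) (hA y (by simp)).2
    · subst h2
      simp only [false_iff]
      rintro ⟨A, B, q, hA, h, rfl⟩
      cases A with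
      | nil => simp at h
      | cons y A => simp at h; exact absurd (by simp [← h.1]) (hA y (by simp)).1
    · simp only [Option.map_eq_some_iff, ih]
      constructor
      · rintro ⟨_, ⟨A, B, q, hA, rfl, rfl⟩, rfl⟩
        exact ⟨_ :: A, B, q, by simpa using ⟨⟨h2, h1⟩, hA⟩, rfl, rfl⟩
      · rintro ⟨A, B, q, hA, h, rfl⟩
        cases A with
        | nil => simp at h; exact absurd h.1.1 h1
        | cons y A =>
          simp at h; obtain ⟨rfl, rfl⟩ := h
          exact ⟨_, ⟨A, B, q, fun x hx => hA x (by simp [hx]), rfl, rfl⟩, rfl⟩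

/-- Exchanging the prime twice is the identity; hence the barred operators are inverse to one
another. -/
theorem bar_swap (p : Bool) (B : List PNum) :
    (p0 (setp p B)).getD ((p0 B).getD p) = p ∧ setp ((p0 B).getD p) (setp p B) = B := by
  rw [p0_setp, setp_setp]
  constructor
  · cases p0 B <;> simp
  · exact setp_of_p0 fun c hc => by simp [hc]

theorem wEb_iff_wFb (w w' : List PNum) : wEb w = some w' ↔ wFb w' = some w := by
  rw [wEb_eq_some, wFb_eq_some]
  constructor <;> rintro ⟨A, B, p, hA, rfl, rfl⟩ <;>
    refine ⟨A, setp p B, (p0 B).getD p, hA, rfl, ?_⟩ <;>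
    rw [(bar_swap p B).1, (bar_swap p B).2]

/-! ### The congruence on words -/

/-- The congruence `decCon` as a relation on words. -/
def Dec (v w : List PNum) : Prop := decCon (FreeMonoid.ofList v) (FreeMonoid.ofList w)

theorem Dec.refl (v : List PNum) : Dec v v := decCon.refl _
theorem Dec.symm {v w : List PNum} (h : Dec v w) : Dec w v := decCon.symm h
theorem Dec.trans {u v w : List PNum} (h : Dec u v) (h' : Dec v w) : Dec u w := decCon.trans h h'
theorem Dec.append {u u' v v' : List PNum} (h : Dec u u') (h' : Dec v v') :
    Dec (u ++ v) (u' ++ v') := decCon.mul h h'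
theorem Dec.cons {v w : List PNum} (x : PNum) (h : Dec v w) : Dec (x :: v) (x :: w) :=
  Dec.append (Dec.refl [x]) h
theorem Dec.append_left {v w : List PNum} (u : List PNum) (h : Dec v w) : Dec (u ++ v) (u ++ w) :=
  Dec.append (Dec.refl u) h
theorem Dec.append_right {v w : List PNum} (u : List PNum) (h : Dec v w) : Dec (v ++ u) (w ++ u) :=
  Dec.append h (Dec.refl u)
theorem DecRel.dec {v w : List PNum} (h : DecRel v w) : Dec v w := ConGen.Rel.of _ _ h

theorem Dec.ind {Q : List PNum → List PNum → Prop} (hrel : ∀ u v, DecRel u v → Q u v)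
    (hrefl : ∀ u, Q u u) (hsymm : ∀ u v, Q u v → Q v u)
    (htrans : ∀ u v w, Q u v → Q v w → Q u w)
    (happ : ∀ u u' v v', Q u u' → Q v v' → Q (u ++ v) (u' ++ v'))
    {v w : List PNum} (h : Dec v w) : Q v w := by
  have key : ∀ x y : FreeMonoid PNum,
      ConGen.Rel (fun x y => DecRel x.toList y.toList) x y → Q x.toList y.toList := by
    intro x y h
    induction h with
    | of x y h => exact hrel _ _ h
    | refl x => exact hrefl _
    | symm _ ih => exact hsymm _ _ ih
    | trans _ _ ih1 ih2 => exact htrans _ _ _ ih1 ih2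
    | mul _ _ ih1 ih2 => exact happ _ _ _ _ ih1 ih2
  exact key _ _ h

/-- Equality or a generating relation. -/
def DecEq (u v : List PNum) : Prop := u = v ∨ DecRel u v

theorem DecEq.dec {u v : List PNum} (h : DecEq u v) : Dec u v := by
  rcases h with rfl | h
  · exact Dec.refl _
  · exact h.dec

theorem DecRel.cn {u v : List PNum} (h : DecRel u v) (k : ℕ+) : cn k u = cn k v := by
  cases h <;> simp only [cn_cons, cn_nil] <;> omega

/-- In every relation `a` is the least letter, so a 1 can occur only if `a = 1`. Its leftmost
occurrence carries the same free superscript on both sides, and re-priming it gives another instance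
of the same relation. -/
theorem DecRel.p0 {u v : List PNum} (h : DecRel u v) :
    p0 u = p0 v ∧ ∀ s, DecEq (setp s u) (setp s v) := by
  have key : ∀ {a b : ℕ+}, a < b → b ≠ 1 := fun h h' => by subst h'; exact not_lt_one h
  have key' : ∀ {a b : ℕ+}, a ≤ b → a ≠ 1 → b ≠ 1 := fun h h' h'' => by
    subst h''; exact h' (le_one_iff_eq_one.1 h)
  cases h with
  | r1 a b p h1 =>
    by_cases ha : a = 1
    · subst ha
      exact ⟨by simp [QueerPlus.p0], fun s => .inr (by simp [setp]; exact .r1 1 b s h1)⟩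
    · have hb := key' h1 ha
      exact ⟨by simp [QueerPlus.p0, ha, hb], fun s => .inr (by simp [setp, ha, hb]; exact .r1 _ _ _ h1)⟩
  | r2 a b p h1 =>
    have hb := key h1
    by_cases ha : a = 1
    · subst ha
      exact ⟨by simp [QueerPlus.p0, hb], fun s => .inr (by simp [setp, hb]; exact .r2 1 b s h1)⟩
    · exact ⟨by simp [QueerPlus.p0, ha, hb], fun s => .inr (by simp [setp, ha, hb]; exact .r2 _ _ _ h1)⟩
  | r3 a b c d p q h1 h2 h3 =>
    have hd := key h3
    by_cases ha : a = 1
    · subst ha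
      exact ⟨by simp [QueerPlus.p0], fun s => .inr (by simp [setp]; exact .r3 1 b c d s q h1 h2 h3)⟩
    · have hb := key' h1 ha
      have hc := key' h2 hb
      exact ⟨by simp [QueerPlus.p0, *], fun s => .inr (by simp [setp, *]; exact .r3 _ _ _ _ _ _ h1 h2 h3)⟩
  | r4 a b c d p q h1 h2 h3 =>
    have hc := key h2
    have hd := key' h3 hc
    by_cases ha : a = 1
    · subst ha
      exact ⟨by simp [QueerPlus.p0], fun s => .inr (by simp [setp]; exact .r4 1 b c d s q h1 h2 h3)⟩
    · have hb := key' h1 ha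
      exact ⟨by simp [QueerPlus.p0, *], fun s => .inr (by simp [setp, *]; exact .r4 _ _ _ _ _ _ h1 h2 h3)⟩
  | r5 a b c d p q h1 h2 h3 =>
    have hc := key h2
    have hd := key h3
    by_cases ha : a = 1
    · subst ha
      exact ⟨by simp [QueerPlus.p0, *],
        fun s => .inr (by simp [setp, *]; exact .r5 1 b c d s q h1 h2 h3)⟩
    · have hb := key' h1 ha
      exact ⟨by simp [QueerPlus.p0, *], fun s => .inr (by simp [setp, *]; exact .r5 _ _ _ _ _ _ h1 h2 h3)⟩
  | r6 a b c d p q h1 h2 h3 =>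
    have hb := key h1
    have hc := key' h2 hb
    have hd := key h3
    by_cases ha : a = 1
    · subst ha
      exact ⟨by simp [QueerPlus.p0, *],
        fun s => .inr (by simp [setp, *]; exact .r6 1 b c d s q h1 h2 h3)⟩
    · exact ⟨by simp [QueerPlus.p0, *], fun s => .inr (by simp [setp, *]; exact .r6 _ _ _ _ _ _ h1 h2 h3)⟩
  | r7 a b c d p q h1 h2 h3 =>
    have hb := key h1
    have hc := key h2
    have hd := key' h3 hc
    by_cases ha : a = 1
    · subst ha
      exact ⟨by simp [QueerPlus.p0, *],
        fun s => .inr (by simp [setp, *]; exact .r7 1 b c d p s h1 h2 h3)⟩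
    · exact ⟨by simp [QueerPlus.p0, *], fun s => .inr (by simp [setp, *]; exact .r7 _ _ _ _ _ _ h1 h2 h3)⟩
  | r8 a b c d p q h1 h2 h3 =>
    have hb := key h1
    have hc := key' h2 hb
    have hd := key h3
    by_cases ha : a = 1
    · subst ha
      exact ⟨by simp [QueerPlus.p0, *],
        fun s => .inr (by simp [setp, *]; exact .r8 1 b c d p s h1 h2 h3)⟩
    · exact ⟨by simp [QueerPlus.p0, *], fun s => .inr (by simp [setp, *]; exact .r8 _ _ _ _ _ _ h1 h2 h3)⟩
  | r9 a b c d p q h1 h2 h3 =>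
    have hb := key h1
    have hc := key' h2 hb
    have hd := key' h3 hc
    by_cases ha : a = 1
    · subst ha
      exact ⟨by simp [QueerPlus.p0, *],
        fun s => .inr (by simp [setp, *]; exact .r9 1 b c d p s h1 h2 h3)⟩
    · exact ⟨by simp [QueerPlus.p0, *], fun s => .inr (by simp [setp, *]; exact .r9 _ _ _ _ _ _ h1 h2 h3)⟩
  | r10 a b c d p q h1 h2 h3 =>
    have hc := key h2
    have hd := key' h3 hc
    by_cases ha : a = 1
    · subst ha
      exact ⟨by simp [QueerPlus.p0, *],
        fun s => .inr (by simp [setp, *]; exact .r10 1 b c d s q h1 h2 h3)⟩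
    · have hb := key' h1 ha
      exact ⟨by simp [QueerPlus.p0, *], fun s => .inr (by simp [setp, *]; exact .r10 _ _ _ _ _ _ h1 h2 h3)⟩

theorem Dec.cn {v w : List PNum} (h : Dec v w) (k : ℕ+) : cn k v = cn k w :=
  Dec.ind (Q := fun v w => QueerPlus.cn k v = QueerPlus.cn k w) (fun _ _ h => h.cn k)
    (fun _ => rfl) (fun _ _ h => h.symm) (fun _ _ _ h h' => h.trans h')
    (fun _ _ _ _ h h' => by rw [cn_append, cn_append, h, h']) h

theorem Dec.p0 {v w : List PNum} (h : Dec v w) : p0 v = p0 w :=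
  Dec.ind (Q := fun v w => QueerPlus.p0 v = QueerPlus.p0 w) (fun _ _ h => h.p0.1)
    (fun _ => rfl) (fun _ _ h => h.symm) (fun _ _ _ h h' => h.trans h')
    (fun _ _ _ _ h h' => by rw [p0_append, p0_append, h, h']) h

theorem Dec.setp {v w : List PNum} (h : Dec v w) (s : Bool) : Dec (setp s v) (setp s w) := by
  refine (Dec.ind (Q := fun v w => Dec v w ∧ QueerPlus.p0 v = QueerPlus.p0 w ∧
    Dec (QueerPlus.setp s v) (QueerPlus.setp s w))
    (fun _ _ h => ⟨h.dec, h.p0.1, (h.p0.2 s).dec⟩) (fun _ => ⟨.refl _, rfl, .refl _⟩)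
    (fun _ _ h => ⟨h.1.symm, h.2.1.symm, h.2.2.symm⟩)
    (fun _ _ _ h h' => ⟨h.1.trans h'.1, h.2.1.trans h'.2.1, h.2.2.trans h'.2.2⟩) ?_ h).2.2
  rintro u u' v v' ⟨h1, h2, h3⟩ ⟨h4, h5, h6⟩
  refine ⟨h1.append h4, by rw [p0_append, p0_append, h2, h5], ?_⟩
  rw [setp_append, setp_append, h2]
  split_ifs
  · exact h1.append h6
  · exact h3.append h4

/-! ### The congruence and the operators of positive index -/

/-- Compatibility of two words with the operators of index `i`. -/
def PosCompat (R : List PNum → List PNum → Prop) (i : ℕ+) (u v : List PNum) : Prop :=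
  phi i u = phi i v ∧ eps i u = eps i v ∧ Option.Rel R (wF i u) (wF i v) ∧
    Option.Rel R (wE i u) (wE i v)

-- The cases record which letters equal `i` or `i + 1`. Changing a letter by one may turn a strict
-- inequality into an equality or conversely, and the image pair then belongs to a neighbouring
-- relation; the alternatives after `first` list the neighbours that occur.
set_option maxHeartbeats 2000000 in
theorem DecRel.posCompat {u v : List PNum} (h : DecRel u v) (i : ℕ+) :
    PosCompat DecEq i u v := by
  have hi : i ≠ i + 1 := (PNat.succ_ne i).symm
  have hS : ∀ x, i + 1 ≤ x ↔ i < x := fun x => PNat.add_one_le_iff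
  have hT : ∀ x, x < i + 1 ↔ x ≤ i := fun x => PNat.lt_add_one_iff
  unfold PosCompat
  cases h with
  | r1 a b p h1 =>
    have hSb := hS b
    all_goals rcases eq_or_ne a i with ha | ha <;> rcases eq_or_ne a (i + 1) with ha' | ha' <;>
      try (exfalso; grind)
    all_goals rcases eq_or_ne b i with hb | hb <;> rcases eq_or_ne b (i + 1) with hb' | hb' <;>
      try (exfalso; grind)
    all_goals simp [phi, eps, wF, wE, phiL, epsL, PNat.succ_ne, *]
    all_goals try refine ⟨?_, ?_⟩
    all_goals right
    all_goals first
      | exact .r1 _ _ _ (by grind)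
  | r2 a b p h1 =>
    have hSb := hS b
    all_goals rcases eq_or_ne a i with ha | ha <;> rcases eq_or_ne a (i + 1) with ha' | ha' <;>
      try (exfalso; grind)
    all_goals rcases eq_or_ne b i with hb | hb <;> rcases eq_or_ne b (i + 1) with hb' | hb' <;>
      try (exfalso; grind)
    all_goals simp [phi, eps, wF, wE, phiL, epsL, PNat.succ_ne, *]
    all_goals right
    all_goals first
      | exact .r2 _ _ _ (by grind)
  | r3 a b c d p q h1 h2 h3 =>
    have hSb := hS b
    have hSc := hS c
    have hSd := hS d
    all_goals rcases eq_or_ne a i with ha | ha <;> rcases eq_or_ne a (i + 1) with ha' | ha' <;>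
      try (exfalso; grind)
    all_goals rcases eq_or_ne b i with hb | hb <;> rcases eq_or_ne b (i + 1) with hb' | hb' <;>
      try (exfalso; grind)
    all_goals rcases eq_or_ne c i with hc | hc <;> rcases eq_or_ne c (i + 1) with hc' | hc' <;>
      try (exfalso; grind)
    all_goals rcases eq_or_ne d i with hd | hd <;> rcases eq_or_ne d (i + 1) with hd' | hd' <;>
      try (exfalso; grind)
    all_goals simp [phi, eps, wF, wE, phiL, epsL, PNat.succ_ne, *]
    all_goals try refine ⟨?_, ?_⟩
    all_goals right
    all_goals first
      | exact .r3 _ _ _ _ _ _ (by grind) (by grind) (by grind)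
      | exact .r4 _ _ _ _ _ _ (by grind) (by grind) (by grind)
  | r4 a b c d p q h1 h2 h3 =>
    have hSb := hS b
    have hSc := hS c
    have hSd := hS d
    all_goals rcases eq_or_ne a i with ha | ha <;> rcases eq_or_ne a (i + 1) with ha' | ha' <;>
      try (exfalso; grind)
    all_goals rcases eq_or_ne b i with hb | hb <;> rcases eq_or_ne b (i + 1) with hb' | hb' <;>
      try (exfalso; grind)
    all_goals rcases eq_or_ne c i with hc | hc <;> rcases eq_or_ne c (i + 1) with hc' | hc' <;>
      try (exfalso; grind)
    all_goals rcases eq_or_ne d i with hd | hd <;> rcases eq_or_ne d (i + 1) with hd' | hd' <;>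
      try (exfalso; grind)
    all_goals simp [phi, eps, wF, wE, phiL, epsL, PNat.succ_ne, *]
    all_goals try refine ⟨?_, ?_⟩
    all_goals right
    all_goals first
      | exact .r4 _ _ _ _ _ _ (by grind) (by grind) (by grind)
      | exact .r3 _ _ _ _ _ _ (by grind) (by grind) (by grind)
      | exact .r9 _ _ _ _ _ _ (by grind) (by grind) (by grind)
  | r5 a b c d p q h1 h2 h3 =>
    have hSb := hS b
    have hSc := hS c
    have hSd := hS d
    all_goals rcases eq_or_ne a i with ha | ha <;> rcases eq_or_ne a (i + 1) with ha' | ha' <;>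
      try (exfalso; grind)
    all_goals rcases eq_or_ne b i with hb | hb <;> rcases eq_or_ne b (i + 1) with hb' | hb' <;>
      try (exfalso; grind)
    all_goals rcases eq_or_ne c i with hc | hc <;> rcases eq_or_ne c (i + 1) with hc' | hc' <;>
      try (exfalso; grind)
    all_goals rcases eq_or_ne d i with hd | hd <;> rcases eq_or_ne d (i + 1) with hd' | hd' <;>
      try (exfalso; grind)
    all_goals simp [phi, eps, wF, wE, phiL, epsL, PNat.succ_ne, *]
    all_goals try refine ⟨?_, ?_⟩
    all_goals right
    all_goals first
      | exact .r5 _ _ _ _ _ _ (by grind) (by grind) (by grind)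
      | exact .r8 _ _ _ _ _ _ (by grind) (by grind) (by grind)
  | r6 a b c d p q h1 h2 h3 =>
    have hSb := hS b
    have hSc := hS c
    have hSd := hS d
    all_goals rcases eq_or_ne a i with ha | ha <;> rcases eq_or_ne a (i + 1) with ha' | ha' <;>
      try (exfalso; grind)
    all_goals rcases eq_or_ne b i with hb | hb <;> rcases eq_or_ne b (i + 1) with hb' | hb' <;>
      try (exfalso; grind)
    all_goals rcases eq_or_ne c i with hc | hc <;> rcases eq_or_ne c (i + 1) with hc' | hc' <;>
      try (exfalso; grind)
    all_goals rcases eq_or_ne d i with hd | hd <;> rcases eq_or_ne d (i + 1) with hd' | hd' <;>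
      try (exfalso; grind)
    all_goals simp [phi, eps, wF, wE, phiL, epsL, PNat.succ_ne, *]
    all_goals try refine ⟨?_, ?_⟩
    all_goals right
    all_goals first
      | exact .r6 _ _ _ _ _ _ (by grind) (by grind) (by grind)
      | exact .r10 _ _ _ _ _ _ (by grind) (by grind) (by grind)
  | r7 a b c d p q h1 h2 h3 =>
    have hSb := hS b
    have hSc := hS c
    have hSd := hS d
    all_goals rcases eq_or_ne a i with ha | ha <;> rcases eq_or_ne a (i + 1) with ha' | ha' <;>
      try (exfalso; grind)
    all_goals rcases eq_or_ne b i with hb | hb <;> rcases eq_or_ne b (i + 1) with hb' | hb' <;>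
      try (exfalso; grind)
    all_goals rcases eq_or_ne c i with hc | hc <;> rcases eq_or_ne c (i + 1) with hc' | hc' <;>
      try (exfalso; grind)
    all_goals rcases eq_or_ne d i with hd | hd <;> rcases eq_or_ne d (i + 1) with hd' | hd' <;>
      try (exfalso; grind)
    all_goals simp [phi, eps, wF, wE, phiL, epsL, PNat.succ_ne, *]
    all_goals try refine ⟨?_, ?_⟩
    all_goals right
    all_goals first
      | exact .r7 _ _ _ _ _ _ (by grind) (by grind) (by grind)
      | exact .r8 _ _ _ _ _ _ (by grind) (by grind) (by grind)
  | r8 a b c d p q h1 h2 h3 =>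
    have hSb := hS b
    have hSc := hS c
    have hSd := hS d
    all_goals rcases eq_or_ne a i with ha | ha <;> rcases eq_or_ne a (i + 1) with ha' | ha' <;>
      try (exfalso; grind)
    all_goals rcases eq_or_ne b i with hb | hb <;> rcases eq_or_ne b (i + 1) with hb' | hb' <;>
      try (exfalso; grind)
    all_goals rcases eq_or_ne c i with hc | hc <;> rcases eq_or_ne c (i + 1) with hc' | hc' <;>
      try (exfalso; grind)
    all_goals rcases eq_or_ne d i with hd | hd <;> rcases eq_or_ne d (i + 1) with hd' | hd' <;>
      try (exfalso; grind)
    all_goals simp [phi, eps, wF, wE, phiL, epsL, PNat.succ_ne, *]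
    all_goals try refine ⟨?_, ?_⟩
    all_goals right
    all_goals first
      | exact .r8 _ _ _ _ _ _ (by grind) (by grind) (by grind)
      | exact .r5 _ _ _ _ _ _ (by grind) (by grind) (by grind)
      | exact .r7 _ _ _ _ _ _ (by grind) (by grind) (by grind)
  | r9 a b c d p q h1 h2 h3 =>
    have hSb := hS b
    have hSc := hS c
    have hSd := hS d
    all_goals rcases eq_or_ne a i with ha | ha <;> rcases eq_or_ne a (i + 1) with ha' | ha' <;>
      try (exfalso; grind)
    all_goals rcases eq_or_ne b i with hb | hb <;> rcases eq_or_ne b (i + 1) with hb' | hb' <;>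
      try (exfalso; grind)
    all_goals rcases eq_or_ne c i with hc | hc <;> rcases eq_or_ne c (i + 1) with hc' | hc' <;>
      try (exfalso; grind)
    all_goals rcases eq_or_ne d i with hd | hd <;> rcases eq_or_ne d (i + 1) with hd' | hd' <;>
      try (exfalso; grind)
    all_goals simp [phi, eps, wF, wE, phiL, epsL, PNat.succ_ne, *]
    all_goals try refine ⟨?_, ?_⟩
    all_goals right
    all_goals first
      | exact .r9 _ _ _ _ _ _ (by grind) (by grind) (by grind)
      | exact .r4 _ _ _ _ _ _ (by grind) (by grind) (by grind)
  | r10 a b c d p q h1 h2 h3 =>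
    have hSb := hS b
    have hSc := hS c
    have hSd := hS d
    all_goals rcases eq_or_ne a i with ha | ha <;> rcases eq_or_ne a (i + 1) with ha' | ha' <;>
      try (exfalso; grind)
    all_goals rcases eq_or_ne b i with hb | hb <;> rcases eq_or_ne b (i + 1) with hb' | hb' <;>
      try (exfalso; grind)
    all_goals rcases eq_or_ne c i with hc | hc <;> rcases eq_or_ne c (i + 1) with hc' | hc' <;>
      try (exfalso; grind)
    all_goals rcases eq_or_ne d i with hd | hd <;> rcases eq_or_ne d (i + 1) with hd' | hd' <;>
      try (exfalso; grind)
    all_goals simp [phi, eps, wF, wE, phiL, epsL, PNat.succ_ne, *]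
    all_goals try refine ⟨?_, ?_⟩
    all_goals right
    all_goals first
      | exact .r10 _ _ _ _ _ _ (by grind) (by grind) (by grind)
      | exact .r6 _ _ _ _ _ _ (by grind) (by grind) (by grind)

/-! ### The congruence and the operators of barred index -/

/-- Compatibility of two words with the operators of index `1̄`. -/
def BarCompat (R : List PNum → List PNum → Prop) (u v : List PNum) : Prop :=
  Option.Rel R (wFb u) (wFb v) ∧ Option.Rel R (wEb u) (wEb v)

-- Only the letters equal to 1 or 2 matter. Since the barred operators move primes between letters,
-- the image can be an instance of a relation with a different placement of superscripts.
set_option maxHeartbeats 2000000 in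
theorem DecRel.barCompat {u v : List PNum} (h : DecRel u v) : BarCompat DecEq u v := by
  have hi : (1 : ℕ+) ≠ 2 := by decide
  have hS : ∀ x : ℕ+, 2 ≤ x ↔ 1 < x := fun x => PNat.add_one_le_iff (a := 1)
  have hT : ∀ x : ℕ+, x < 2 ↔ x ≤ 1 := fun x => PNat.lt_add_one_iff (b := 1)
  unfold BarCompat
  cases h with
  | r1 a b p h1 =>
    have hSb := hS b
    have hO : 1 ≤ a := one_le
    all_goals rcases eq_or_ne a 1 with ha | ha <;> rcases eq_or_ne a 2 with ha' | ha' <;>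
      try (exfalso; grind)
    all_goals rcases eq_or_ne b 1 with hb | hb <;> rcases eq_or_ne b 2 with hb' | hb' <;>
      try (exfalso; grind)
    all_goals simp [wFb, wEb, QueerPlus.p0, QueerPlus.setp, *]
    all_goals right
    all_goals first
      | exact .r1 _ _ _ (by grind)
      | exact .r2 _ _ _ (by grind)
  | r2 a b p h1 =>
    have hSb := hS b
    have hO : 1 ≤ a := one_le
    all_goals rcases eq_or_ne a 1 with ha | ha <;> rcases eq_or_ne a 2 with ha' | ha' <;>
      try (exfalso; grind)
    all_goals rcases eq_or_ne b 1 with hb | hb <;> rcases eq_or_ne b 2 with hb' | hb' <;>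
      try (exfalso; grind)
    all_goals simp [wFb, wEb, QueerPlus.p0, QueerPlus.setp, *]
    all_goals right
    all_goals first
      | exact .r2 _ _ _ (by grind)
      | exact .r1 _ _ _ (by grind)
  | r3 a b c d p q h1 h2 h3 =>
    have hSb := hS b
    have hSc := hS c
    have hSd := hS d
    have hO : 1 ≤ a := one_le
    all_goals rcases eq_or_ne a 1 with ha | ha <;> rcases eq_or_ne a 2 with ha' | ha' <;>
      try (exfalso; grind)
    all_goals rcases eq_or_ne b 1 with hb | hb <;> rcases eq_or_ne b 2 with hb' | hb' <;>
      try (exfalso; grind)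
    all_goals rcases eq_or_ne c 1 with hc | hc <;> rcases eq_or_ne c 2 with hc' | hc' <;>
      try (exfalso; grind)
    all_goals rcases eq_or_ne d 1 with hd | hd <;> rcases eq_or_ne d 2 with hd' | hd' <;>
      try (exfalso; grind)
    all_goals simp [wFb, wEb, QueerPlus.p0, QueerPlus.setp, *]
    all_goals right
    all_goals first
      | exact .r3 _ _ _ _ _ _ (by grind) (by grind) (by grind)
      | exact .r10 _ _ _ _ _ _ (by grind) (by grind) (by grind)
      | exact .r6 _ _ _ _ _ _ (by grind) (by grind) (by grind)
  | r4 a b c d p q h1 h2 h3 =>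
    have hSb := hS b
    have hSc := hS c
    have hSd := hS d
    have hO : 1 ≤ a := one_le
    all_goals rcases eq_or_ne a 1 with ha | ha <;> rcases eq_or_ne a 2 with ha' | ha' <;>
      try (exfalso; grind)
    all_goals rcases eq_or_ne b 1 with hb | hb <;> rcases eq_or_ne b 2 with hb' | hb' <;>
      try (exfalso; grind)
    all_goals rcases eq_or_ne c 1 with hc | hc <;> rcases eq_or_ne c 2 with hc' | hc' <;>
      try (exfalso; grind)
    all_goals rcases eq_or_ne d 1 with hd | hd <;> rcases eq_or_ne d 2 with hd' | hd' <;>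
      try (exfalso; grind)
    all_goals simp [wFb, wEb, QueerPlus.p0, QueerPlus.setp, *]
    all_goals right
    all_goals first
      | exact .r4 _ _ _ _ _ _ (by grind) (by grind) (by grind)
      | exact .r9 _ _ _ _ _ _ (by grind) (by grind) (by grind)
  | r5 a b c d p q h1 h2 h3 =>
    have hSb := hS b
    have hSc := hS c
    have hSd := hS d
    have hO : 1 ≤ a := one_le
    all_goals rcases eq_or_ne a 1 with ha | ha <;> rcases eq_or_ne a 2 with ha' | ha' <;>
      try (exfalso; grind)
    all_goals rcases eq_or_ne b 1 with hb | hb <;> rcases eq_or_ne b 2 with hb' | hb' <;>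
      try (exfalso; grind)
    all_goals rcases eq_or_ne c 1 with hc | hc <;> rcases eq_or_ne c 2 with hc' | hc' <;>
      try (exfalso; grind)
    all_goals rcases eq_or_ne d 1 with hd | hd <;> rcases eq_or_ne d 2 with hd' | hd' <;>
      try (exfalso; grind)
    all_goals simp [wFb, wEb, QueerPlus.p0, QueerPlus.setp, *]
    all_goals right
    all_goals first
      | exact .r5 _ _ _ _ _ _ (by grind) (by grind) (by grind)
      | exact .r8 _ _ _ _ _ _ (by grind) (by grind) (by grind)
  | r6 a b c d p q h1 h2 h3 =>
    have hSb := hS b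
    have hSc := hS c
    have hSd := hS d
    have hO : 1 ≤ a := one_le
    all_goals rcases eq_or_ne a 1 with ha | ha <;> rcases eq_or_ne a 2 with ha' | ha' <;>
      try (exfalso; grind)
    all_goals rcases eq_or_ne b 1 with hb | hb <;> rcases eq_or_ne b 2 with hb' | hb' <;>
      try (exfalso; grind)
    all_goals rcases eq_or_ne c 1 with hc | hc <;> rcases eq_or_ne c 2 with hc' | hc' <;>
      try (exfalso; grind)
    all_goals rcases eq_or_ne d 1 with hd | hd <;> rcases eq_or_ne d 2 with hd' | hd' <;>
      try (exfalso; grind)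
    all_goals simp [wFb, wEb, QueerPlus.p0, QueerPlus.setp, *]
    all_goals right
    all_goals first
      | exact .r6 _ _ _ _ _ _ (by grind) (by grind) (by grind)
      | exact .r3 _ _ _ _ _ _ (by grind) (by grind) (by grind)
  | r7 a b c d p q h1 h2 h3 =>
    have hSb := hS b
    have hSc := hS c
    have hSd := hS d
    have hO : 1 ≤ a := one_le
    all_goals rcases eq_or_ne a 1 with ha | ha <;> rcases eq_or_ne a 2 with ha' | ha' <;>
      try (exfalso; grind)
    all_goals rcases eq_or_ne b 1 with hb | hb <;> rcases eq_or_ne b 2 with hb' | hb' <;>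
      try (exfalso; grind)
    all_goals rcases eq_or_ne c 1 with hc | hc <;> rcases eq_or_ne c 2 with hc' | hc' <;>
      try (exfalso; grind)
    all_goals rcases eq_or_ne d 1 with hd | hd <;> rcases eq_or_ne d 2 with hd' | hd' <;>
      try (exfalso; grind)
    all_goals simp [wFb, wEb, QueerPlus.p0, QueerPlus.setp, *]
    all_goals right
    all_goals first
      | exact .r7 _ _ _ _ _ _ (by grind) (by grind) (by grind)
      | exact .r10 _ _ _ _ _ _ (by grind) (by grind) (by grind)
  | r8 a b c d p q h1 h2 h3 =>
    have hSb := hS b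
    have hSc := hS c
    have hSd := hS d
    have hO : 1 ≤ a := one_le
    all_goals rcases eq_or_ne a 1 with ha | ha <;> rcases eq_or_ne a 2 with ha' | ha' <;>
      try (exfalso; grind)
    all_goals rcases eq_or_ne b 1 with hb | hb <;> rcases eq_or_ne b 2 with hb' | hb' <;>
      try (exfalso; grind)
    all_goals rcases eq_or_ne c 1 with hc | hc <;> rcases eq_or_ne c 2 with hc' | hc' <;>
      try (exfalso; grind)
    all_goals rcases eq_or_ne d 1 with hd | hd <;> rcases eq_or_ne d 2 with hd' | hd' <;>
      try (exfalso; grind)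
    all_goals simp [wFb, wEb, QueerPlus.p0, QueerPlus.setp, *]
    all_goals right
    all_goals first
      | exact .r8 _ _ _ _ _ _ (by grind) (by grind) (by grind)
      | exact .r5 _ _ _ _ _ _ (by grind) (by grind) (by grind)
  | r9 a b c d p q h1 h2 h3 =>
    have hSb := hS b
    have hSc := hS c
    have hSd := hS d
    have hO : 1 ≤ a := one_le
    all_goals rcases eq_or_ne a 1 with ha | ha <;> rcases eq_or_ne a 2 with ha' | ha' <;>
      try (exfalso; grind)
    all_goals rcases eq_or_ne b 1 with hb | hb <;> rcases eq_or_ne b 2 with hb' | hb' <;>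
      try (exfalso; grind)
    all_goals rcases eq_or_ne c 1 with hc | hc <;> rcases eq_or_ne c 2 with hc' | hc' <;>
      try (exfalso; grind)
    all_goals rcases eq_or_ne d 1 with hd | hd <;> rcases eq_or_ne d 2 with hd' | hd' <;>
      try (exfalso; grind)
    all_goals simp [wFb, wEb, QueerPlus.p0, QueerPlus.setp, *]
    all_goals right
    all_goals first
      | exact .r9 _ _ _ _ _ _ (by grind) (by grind) (by grind)
      | exact .r4 _ _ _ _ _ _ (by grind) (by grind) (by grind)
  | r10 a b c d p q h1 h2 h3 =>
    have hSb := hS b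
    have hSc := hS c
    have hSd := hS d
    have hO : 1 ≤ a := one_le
    all_goals rcases eq_or_ne a 1 with ha | ha <;> rcases eq_or_ne a 2 with ha' | ha' <;>
      try (exfalso; grind)
    all_goals rcases eq_or_ne b 1 with hb | hb <;> rcases eq_or_ne b 2 with hb' | hb' <;>
      try (exfalso; grind)
    all_goals rcases eq_or_ne c 1 with hc | hc <;> rcases eq_or_ne c 2 with hc' | hc' <;>
      try (exfalso; grind)
    all_goals rcases eq_or_ne d 1 with hd | hd <;> rcases eq_or_ne d 2 with hd' | hd' <;>
      try (exfalso; grind)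
    all_goals simp [wFb, wEb, QueerPlus.p0, QueerPlus.setp, *]
    all_goals right
    all_goals first
      | exact .r10 _ _ _ _ _ _ (by grind) (by grind) (by grind)
      | exact .r3 _ _ _ _ _ _ (by grind) (by grind) (by grind)
      | exact .r7 _ _ _ _ _ _ (by grind) (by grind) (by grind)

theorem _root_.Option.Rel.map_of {α β : Type} {R : α → α → Prop} {S : β → β → Prop} {f g : α → β}
    (hfg : ∀ a b, R a b → S (f a) (g b)) {x y : Option α} (h : Option.Rel R x y) :
    Option.Rel S (x.map f) (y.map g) := by
  cases h with
  | none => exact .none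
  | some h => exact .some (hfg _ _ h)

theorem _root_.Option.Rel.none_iff {α : Type} {R : α → α → Prop} {x y : Option α}
    (h : Option.Rel R x y) : x = none ↔ y = none := by
  cases h <;> simp

theorem _root_.Option.Rel.refl' {α : Type} {R : α → α → Prop} (hR : ∀ a, R a a) (x : Option α) :
    Option.Rel R x x := by
  cases x
  · exact .none
  · exact .some (hR _)

theorem _root_.Option.Rel.symm' {α : Type} {R : α → α → Prop} (hR : ∀ a b, R a b → R b a)
    {x y : Option α} (h : Option.Rel R x y) : Option.Rel R y x := by
  cases h with
  | none => exact .none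
  | some h => exact .some (hR _ _ h)

theorem _root_.Option.Rel.trans' {α : Type} {R : α → α → Prop} (hR : ∀ a b c, R a b → R b c → R a c)
    {x y z : Option α} (h : Option.Rel R x y) (h' : Option.Rel R y z) : Option.Rel R x z := by
  cases h with
  | none => exact h'
  | some h => cases h' with | some h' => exact .some (hR _ _ _ h h')

theorem _root_.Option.Rel.mono {α : Type} {R S : α → α → Prop} (hR : ∀ a b, R a b → S a b)
    {x y : Option α} (h : Option.Rel R x y) : Option.Rel S x y := by
  cases h with
  | none => exact .none
  | some h => exact .some (hR _ _ h)

theorem dec_trans (u v w : List PNum) : Dec u v → Dec v w → Dec u w := Dec.trans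

/-- Whether an operator acts on the left or the right factor of `u ++ v` depends only on `eps i u`
and `phi i v`. Carrying the string lengths in the induction therefore makes the statement stable
under concatenation. -/
theorem Dec.posCompat {v w : List PNum} (h : Dec v w) (i : ℕ+) : PosCompat Dec i v w := by
  refine (Dec.ind (Q := fun v w => Dec v w ∧ PosCompat Dec i v w) ?_ ?_ ?_ ?_ ?_ h).2
  · intro u v h
    obtain ⟨h1, h2, h3, h4⟩ := h.posCompat i
    exact ⟨h.dec, h1, h2, h3.mono fun _ _ => DecEq.dec, h4.mono fun _ _ => DecEq.dec⟩
  · exact fun u => ⟨.refl u, rfl, rfl, .refl' .refl _, .refl' .refl _⟩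
  · rintro u v ⟨h, h1, h2, h3, h4⟩
    exact ⟨h.symm, h1.symm, h2.symm, h3.symm' fun _ _ => Dec.symm, h4.symm' fun _ _ => Dec.symm⟩
  · rintro u v w ⟨h, h1, h2, h3, h4⟩ ⟨h', h1', h2', h3', h4'⟩
    exact ⟨h.trans h', h1.trans h1', h2.trans h2', h3.trans' dec_trans h3',
      h4.trans' dec_trans h4'⟩
  · rintro u u' v v' ⟨h, h1, h2, h3, h4⟩ ⟨h', h1', h2', h3', h4'⟩
    refine ⟨h.append h', ?_, ?_, ?_, ?_⟩
    · rw [phi_append, phi_append, h1, h1', h2]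
    · rw [eps_append, eps_append, h2, h1', h2']
    · rw [wF_append, wF_append, h1', h2]
      split_ifs
      · exact h3'.map_of fun _ _ hh => h.append hh
      · exact h3.map_of fun _ _ hh => hh.append h'
    · rw [wE_append, wE_append, h1', h2]
      split_ifs
      · exact h4'.map_of fun _ _ hh => h.append hh
      · exact h4.map_of fun _ _ hh => hh.append h'

theorem cn_setp (k : ℕ+) (b : Bool) (w : List PNum) : cn k (setp b w) = cn k w := by
  simp [cn]

theorem p0_eq_none (w : List PNum) : p0 w = none ↔ cn 1 w = 0 := by
  induction w with
  | nil => simp [p0]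
  | cons x w ih => simp only [p0, cn_cons]; split_ifs <;> simp [ih]

/-- With two letters 1 in `u`, the exchange of primes takes place inside `u`. With only one, its
partner is the leftmost 1 of `v`: give `u` the prime of `v` first, then lower, and hand the old
prime of `u` to `v`. -/
theorem wFb_append (u v : List PNum) : wFb (u ++ v) =
    if wFb u = none ∧ wEb u = none then (wFb v).map (u ++ ·)
    else if 2 ≤ cn 1 u then (wFb u).map (· ++ v)
    else (wFb (setp ((p0 v).getD ((p0 u).getD false)) u)).map
      (· ++ setp ((p0 u).getD false) v) := by
  induction u with
  | nil => simp [wFb, wEb]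
  | cons x u ih =>
    obtain ⟨a, p⟩ := x
    by_cases h1 : a = 1
    · subst h1
      by_cases h : p0 u = none
      · have : cn 1 u = 0 := (p0_eq_none u).1 h
        have hu : ∀ b, setp b u = u := fun b => setp_of_p0 (by simp [h])
        simp [wFb, wEb, cn_cons, this, p0, p0_append, setp, setp_append, h, hu]
      · have : 1 ≤ cn 1 u := Nat.pos_of_ne_zero fun h' => h ((p0_eq_none u).2 h')
        obtain ⟨c, hc⟩ := Option.ne_none_iff_exists'.1 h
        simp [wFb, wEb, cn_cons, this, p0_append, setp_append, hc]
    · by_cases h2 : a = 2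
      · subst h2; simp [wFb, wEb, setp]
      · simp only [List.cons_append, wFb, wEb, h1, h2, if_false, ih, Option.map_eq_none_iff, cn_cons,
          p0, setp, add_zero]
        split_ifs <;> simp [Function.comp_def]

/-- Raising creates a new 1 in `u`. If `u` had a 1 already, that one is the partner; otherwise the
new 1 exchanges its prime with the leftmost 1 of `v`. -/
theorem wEb_append (u v : List PNum) : wEb (u ++ v) =
    if wFb u = none ∧ wEb u = none then (wEb v).map (u ++ ·)
    else if p0 u ≠ none then (wEb u).map (· ++ v)
    else (wEb u).map fun x => setp ((p0 v).getD ((p0 x).getD false)) x ++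
      setp ((p0 x).getD false) v := by
  induction u with
  | nil => simp [wFb, wEb]
  | cons x u ih =>
    obtain ⟨a, p⟩ := x
    by_cases h1 : a = 2
    · subst h1
      by_cases h : p0 u = none
      · have hu : ∀ b, setp b u = u := fun b => setp_of_p0 (by simp [h])
        simp [wFb, wEb, p0, p0_append, setp, setp_append, h, hu]
      · obtain ⟨c, hc⟩ := Option.ne_none_iff_exists'.1 h
        simp [wFb, wEb, p0, p0_append, setp_append, hc]
    · by_cases h2 : a = 1
      · subst h2; simp [wFb, wEb, p0]
      · simp only [List.cons_append, wFb, wEb, h1, h2, if_false, ih, Option.map_eq_none_iff,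
          p0]
        split_ifs <;> simp [Function.comp_def, setp, p0, h2]

theorem wEb_eq_none_setp (b : Bool) (w : List PNum) : wEb (setp b w) = none ↔ wEb w = none := by
  induction w with
  | nil => simp [setp]
  | cons x w ih =>
    obtain ⟨a, p⟩ := x
    by_cases h1 : a = 1
    · simp [setp, wEb, h1]
    · by_cases h2 : a = 2
      · simp [setp, wEb, h2]
      · simp [setp, wEb, h1, h2, ih]

/-- Auxiliary invariant for the compatibility of the congruence with `f_{1̄}`. -/
structure FbCompat (v w : List PNum) : Prop where
  dec : Dec v w
  eb : wEb v = none ↔ wEb w = none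
  fb : Option.Rel Dec (wFb v) (wFb w)
  -- `wFb_append` lowers a re-primed left factor, so the induction must control all re-primings.
  fbs : ∀ s, Option.Rel Dec (wFb (setp s v)) (wFb (setp s w))

theorem FbCompat.setp {v w : List PNum} (h : FbCompat v w) (s : Bool) :
    FbCompat (setp s v) (setp s w) where
  dec := h.dec.setp s
  eb := by rw [wEb_eq_none_setp, wEb_eq_none_setp, h.eb]
  fb := h.fbs s
  fbs t := by simpa only [setp_setp] using h.fbs t

theorem FbCompat.append_fb {u u' v v' : List PNum} (h : FbCompat u u') (h' : FbCompat v v') :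
    Option.Rel Dec (wFb (u ++ v)) (wFb (u' ++ v')) := by
  rw [wFb_append, wFb_append]
  simp only [h.eb, h.fb.none_iff, h.dec.cn, h.dec.p0, h'.dec.p0]
  split_ifs
  · exact h'.fb.map_of fun _ _ hh => h.dec.append hh
  · exact h.fb.map_of fun _ _ hh => hh.append h'.dec
  · exact (h.fbs _).map_of fun _ _ hh => hh.append (h'.dec.setp _)

theorem Dec.barCompat {v w : List PNum} (h : Dec v w) : BarCompat Dec v w := by
  suffices h : FbCompat v w ∧ Option.Rel Dec (wEb v) (wEb w) from ⟨h.1.fb, h.2⟩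
  refine Dec.ind (Q := fun v w => FbCompat v w ∧ Option.Rel Dec (wEb v) (wEb w))
    ?_ ?_ ?_ ?_ ?_ h
  · intro u v h
    have key : ∀ {u v}, DecEq u v → BarCompat Dec u v := by
      rintro u v (rfl | h)
      · exact ⟨.refl' .refl _, .refl' .refl _⟩
      · exact ⟨h.barCompat.1.mono fun _ _ => DecEq.dec, h.barCompat.2.mono fun _ _ => DecEq.dec⟩
    have h0 := key (.inr h)
    exact ⟨⟨h.dec, h0.2.none_iff, h0.1, fun s => (key (h.p0.2 s)).1⟩, h0.2⟩
  · exact fun u => ⟨⟨.refl u, .rfl, .refl' .refl _, fun _ => .refl' .refl _⟩, .refl' .refl _⟩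
  · rintro u v ⟨⟨h1, h2, h3, h4⟩, h5⟩
    exact ⟨⟨h1.symm, h2.symm, h3.symm' fun _ _ => Dec.symm, fun s => (h4 s).symm' fun _ _ => Dec.symm⟩,
      h5.symm' fun _ _ => Dec.symm⟩
  · rintro u v w ⟨⟨h1, h2, h3, h4⟩, h5⟩ ⟨⟨h1', h2', h3', h4'⟩, h5'⟩
    exact ⟨⟨h1.trans h1', h2.trans h2', h3.trans' dec_trans h3',
      fun s => (h4 s).trans' dec_trans (h4' s)⟩,
      h5.trans' dec_trans h5'⟩
  · rintro u u' v v' ⟨h, h1⟩ ⟨h', h1'⟩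
    have hEb : Option.Rel Dec (wEb (u ++ v)) (wEb (u' ++ v')) := by
      rw [wEb_append, wEb_append]
      simp only [h.eb, h.fb.none_iff, h.dec.p0]
      split_ifs
      · exact h1'.map_of fun _ _ hh => h.dec.append hh
      · exact h1.map_of fun _ _ hh => hh.append h'.dec
      · refine h1.map_of fun x y hh => ?_
        rw [hh.p0, h'.dec.p0]
        exact (hh.setp _).append (h'.dec.setp _)
    refine ⟨⟨h.dec.append h'.dec, hEb.none_iff, h.append_fb h', fun s => ?_⟩, hEb⟩
    rw [setp_append, setp_append, h.dec.p0]
    split_ifs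
    · exact h.append_fb (h'.setp s)
    · exact (h.setp s).append_fb h'

/-! ### Hook subwords -/

/-- Words in reading order which are strictly decreasing and then weakly increasing. -/
def HookList (l : List ℕ+) : Prop :=
  ∃ d e, l = d ++ e ∧ d.Pairwise (· > ·) ∧ e.Pairwise (· ≤ ·)

/-- One step of the automaton accepting `HookList`: the state `y > 0` means that the last letter
was `y` and the word is decreasing so far, the state `-y` that the increasing part has begun. -/
def hstep (s : ℤ) (y : ℕ+) : Option ℤ :=
  if ((y : ℕ) : ℤ) < s then some ((y : ℕ) : ℤ)
  else if -((y : ℕ) : ℤ) ≤ s then some (-((y : ℕ) : ℤ)) else none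

/-- Run the automaton from a given state. -/
def hrun : ℤ → List ℕ+ → Option ℤ
  | s, [] => some s
  | s, y :: l => (hstep s y).bind fun t => hrun t l

theorem hrun_cons (s : ℤ) (y : ℕ+) (l : List ℕ+) : hrun s (y :: l) =
    if ((y : ℕ) : ℤ) < s then hrun (y : ℕ) l
    else if -((y : ℕ) : ℤ) ≤ s then hrun (-((y : ℕ) : ℤ)) l else none := by
  rw [hrun, hstep]; split_ifs <;> rfl

theorem hrun_nil (s : ℤ) : hrun s [] = some s := rfl

theorem hrun_append (s : ℤ) (l m : List ℕ+) :
    hrun s (l ++ m) = (hrun s l).bind fun t => hrun t m := by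
  induction l generalizing s with
  | nil => rfl
  | cons y l ih =>
    simp only [List.cons_append, hrun, ih]
    cases hstep s y <;> rfl

/-- States are signed so that a larger state permits every continuation that a smaller one does. The
deterministic automaton, which prefers the larger next state, is therefore optimal. -/
theorem hstep_mono {s s' t : ℤ} {y : ℕ+} (hs : s ≤ s') (h : hstep s y = some t) :
    ∃ t', hstep s' y = some t' ∧ t ≤ t' := by
  have := y.pos
  unfold hstep at *
  split_ifs at * <;> simp at h ⊢ <;> omega

theorem hrun_mono {s s' t : ℤ} {l : List ℕ+} (hs : s ≤ s') (h : hrun s l = some t) :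
    ∃ t', hrun s' l = some t' ∧ t ≤ t' := by
  induction l generalizing s s' with
  | nil => simp only [hrun, Option.some.injEq] at h; exact ⟨s', rfl, h ▸ hs⟩
  | cons y l ih =>
    simp only [hrun, Option.bind_eq_some_iff] at h ⊢
    obtain ⟨r, h1, h2⟩ := h
    obtain ⟨r', h1', hr⟩ := hstep_mono hs h1
    obtain ⟨t', h2', ht⟩ := ih hr h2
    exact ⟨t', ⟨r', h1', h2'⟩, ht⟩

theorem hrun_of_increasing {s : ℤ} {e : List ℕ+} (he : e.Pairwise (· ≤ ·))
    (hs : ∀ y ∈ e, -((y : ℕ) : ℤ) ≤ s) : ∃ t, hrun s e = some t := by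
  induction e generalizing s with
  | nil => exact ⟨s, rfl⟩
  | cons y e ih =>
    rw [List.pairwise_cons] at he
    have hy := hs y (by simp)
    -- The automaton may still count `y` as decreasing; the state it reaches is then larger than
    -- needed.
    obtain ⟨r, hr, hr'⟩ : ∃ r, hstep s y = some r ∧ -((y : ℕ) : ℤ) ≤ r := by
      unfold hstep; split_ifs
      · exact ⟨_, rfl, by omega⟩
      · exact ⟨_, rfl, le_rfl⟩
    obtain ⟨t, ht⟩ := ih he.2 (s := r) fun z hz => by
      have : (y : ℕ) ≤ z := he.1 z hz
      omega
    exact ⟨t, by simp [hrun, hr, ht]⟩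

theorem hrun_of_hook {d e : List ℕ+} (hd : d.Pairwise (· > ·)) (he : e.Pairwise (· ≤ ·)) {s : ℤ}
    (h0 : 0 ≤ s) (hs : ∀ y ∈ d, ((y : ℕ) : ℤ) < s) : ∃ t, hrun s (d ++ e) = some t := by
  induction d generalizing s with
  | nil => exact hrun_of_increasing he fun y _ => by omega
  | cons y d ih =>
    rw [List.pairwise_cons] at hd
    have hy := hs y (by simp)
    obtain ⟨t, ht⟩ := ih hd.2 (s := ((y : ℕ) : ℤ)) (by omega) fun z hz => by
      have : (z : ℕ) < y := hd.1 z hz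
      omega
    exact ⟨t, by simp [hrun, hstep, hy, ht]⟩

theorem hook_of_hrun {s t : ℤ} {l : List ℕ+} (h : hrun s l = some t) :
    ∃ d e, l = d ++ e ∧ d.Pairwise (· > ·) ∧ e.Pairwise (· ≤ ·) ∧ (∀ y ∈ d, ((y : ℕ) : ℤ) < s) ∧
      ∀ y ∈ e, -((y : ℕ) : ℤ) ≤ s := by
  induction l generalizing s with
  | nil => exact ⟨[], [], rfl, .nil, .nil, by simp, by simp⟩
  | cons y l ih =>
    simp only [hrun, Option.bind_eq_some_iff] at h
    obtain ⟨r, h1, h2⟩ := h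
    obtain ⟨d, e, rfl, hd, he, hds, hes⟩ := ih h2
    have hy := y.pos
    unfold hstep at h1
    split_ifs at h1 with h3 h4
    · simp only [Option.some.injEq] at h1
      subst h1
      refine ⟨y :: d, e, rfl, List.pairwise_cons.2 ⟨fun z hz => ?_, hd⟩, he, ?_, ?_⟩
      · have := hds z hz
        change (z : ℕ) < y
        omega
      · simp only [List.mem_cons, forall_eq_or_imp]
        exact ⟨h3, fun z hz => by have := hds z hz; omega⟩
      · intro z hz; omega
    · simp only [Option.some.injEq] at h1
      subst h1
      cases d with
      | cons z d => have := hds z (by simp); omega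
      | nil =>
        refine ⟨[], y :: e, rfl, .nil, List.pairwise_cons.2 ⟨fun z hz => ?_, he⟩, by simp, ?_⟩
        · have := hes z hz
          change (y : ℕ) ≤ z
          omega
        · simp only [List.mem_cons, forall_eq_or_imp]
          exact ⟨h4, fun z hz => by have := hes z hz; omega⟩

theorem hookList_iff_hrun (l : List ℕ+) : HookList l ↔ ∃ s t, hrun s l = some t := by
  constructor
  · rintro ⟨d, e, rfl, hd, he⟩
    obtain ⟨s, h0, hs⟩ : ∃ s : ℤ, 0 ≤ s ∧ ∀ y ∈ d, ((y : ℕ) : ℤ) < s := by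
      -- Any starting state above all letters of the decreasing part will do.
      refine ⟨((d.map PNat.val).sum : ℤ) + 1, by omega, fun y hy => ?_⟩
      have := List.le_sum_of_mem (List.mem_map_of_mem (f := PNat.val) hy)
      change y.val ≤ _ at this
      change ((y.val : ℕ) : ℤ) < _
      omega
    exact ⟨s, hrun_of_hook hd he h0 hs⟩
  · rintro ⟨s, t, h⟩
    obtain ⟨d, e, h1, h2, h3, -⟩ := hook_of_hrun h
    exact ⟨d, e, h1, h2, h3⟩

/-! ### Domination of hook subwords -/

/-- Every subword of `u` can be replaced by an equally long subword of `v` in a hook word. -/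
def HookDom (u v : List ℕ+) : Prop :=
  ∀ s t l, l.Sublist u → hrun s l = some t →
    ∃ l', l'.Sublist v ∧ l'.length = l.length ∧ ∃ t', hrun s l' = some t' ∧ t ≤ t'

theorem HookDom.refl (u : List ℕ+) : HookDom u u := fun _ t l h h' => ⟨l, h, rfl, t, h', le_rfl⟩

theorem HookDom.trans {u v w : List ℕ+} (h : HookDom u v) (h' : HookDom v w) : HookDom u w := by
  intro s t l hl ht
  obtain ⟨l', hl', e', t', ht', hle⟩ := h s t l hl ht
  obtain ⟨l'', hl'', e'', t'', ht'', hle'⟩ := h' s t' l' hl' ht'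
  exact ⟨l'', hl'', e''.trans e', t'', ht'', hle.trans hle'⟩

/-- Quantifying over all starting states and asking for a final state that is no smaller makes
domination a local condition. It can be checked on the relations and then multiplied out. -/
theorem HookDom.append {u u' v v' : List ℕ+} (h : HookDom u u') (h' : HookDom v v') :
    HookDom (u ++ v) (u' ++ v') := by
  intro s t l hl ht
  obtain ⟨l1, l2, rfl, h1, h2⟩ := List.sublist_append_iff.1 hl
  rw [hrun_append, Option.bind_eq_some_iff] at ht
  obtain ⟨r, hr, ht⟩ := ht
  obtain ⟨l1', hl1, e1, r', hr', hle1⟩ := h s r l1 h1 hr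
  obtain ⟨t1, ht1, hle⟩ := hrun_mono hle1 ht
  obtain ⟨l2', hl2, e2, t', ht', hle2⟩ := h' r' t1 l2 h2 ht1
  refine ⟨l1' ++ l2', hl1.append hl2, by simp [e1, e2], t', ?_, hle.trans hle2⟩
  rw [hrun_append, hr']
  exact ht'

theorem hrun_cons_some {s t : ℤ} {y : ℕ+} {l : List ℕ+} (h : hrun s (y :: l) = some t) :
    (((y : ℕ) : ℤ) < s ∧ hrun (y : ℕ) l = some t) ∨
    (s ≤ ((y : ℕ) : ℤ) ∧ -((y : ℕ) : ℤ) ≤ s ∧ hrun (-((y : ℕ) : ℤ)) l = some t) := by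
  rw [hrun_cons] at h
  split_ifs at h with h1 h2
  · exact .inl ⟨h1, h⟩
  · exact .inr ⟨by omega, h2, h⟩

theorem hrun_dec {s t : ℤ} {y : ℕ+} {l : List ℕ+} (h : ((y : ℕ) : ℤ) < s)
    (h' : ∃ t', hrun (y : ℕ) l = some t' ∧ t ≤ t') : ∃ t', hrun s (y :: l) = some t' ∧ t ≤ t' := by
  rwa [hrun_cons, if_pos h]

/-- One may choose to read `y` as part of the increasing branch even where the automaton prefers the
decreasing one; monotonicity absorbs the difference. -/
theorem hrun_inc {s t : ℤ} {y : ℕ+} {l : List ℕ+} (h : -((y : ℕ) : ℤ) ≤ s)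
    (h' : ∃ t', hrun (-((y : ℕ) : ℤ)) l = some t' ∧ t ≤ t') :
    ∃ t', hrun s (y :: l) = some t' ∧ t ≤ t' := by
  rw [hrun_cons]
  split_ifs with h1
  · obtain ⟨t', h2, h3⟩ := h'
    obtain ⟨t'', h4, h5⟩ := hrun_mono (s' := (y : ℕ)) (by omega) h2
    exact ⟨t'', h4, h3.trans h5⟩
  · exact h'

-- This lemma and the next fifteen treat both directions of the eight relations that move letters.
-- Among the sixteen subwords of a side, those that are also subwords of the other side need
-- nothing. The others either contain an ascent followed by a descent, hence are never hooks, or are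
-- replaced by an explicit subword of the same length that ends in a state at least as large.
set_option maxHeartbeats 400000 in
theorem hookDom_r3 (a b c d : ℕ+) (h1 : a ≤ b) (h2 : b ≤ c) (h3 : c < d) :
    HookDom [a, b, d, c] [a, d, b, c] := by
  have ha := a.pos
  simp only [← PNat.coe_lt_coe, ← PNat.coe_le_coe] at h1 h2 h3
  intro s t l hl ht
  simp only [← List.mem_sublists', List.sublists'_cons, List.sublists'_nil, List.map_cons,
    List.map_nil, List.nil_append, List.cons_append, List.mem_cons, List.not_mem_nil, or_false]
    at hl
  rcases hl with rfl | rfl | rfl | rfl | rfl | rfl | rfl | rfl | rfl | rfl | rfl | rfl | rfl |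
    rfl | rfl | rfl
  -- A subword common to both sides is its own replacement.
  all_goals try
    (refine ⟨_, ?_, rfl, t, ht, le_rfl⟩
     (repeat first | exact List.nil_sublist _ | apply List.Sublist.cons_cons | apply List.Sublist.cons)
     done)
  · obtain ⟨h4, ht⟩ | ⟨h4, h4', ht⟩ := hrun_cons_some ht <;> try omega
    all_goals obtain ⟨h5, ht⟩ | ⟨h5, h5', ht⟩ := hrun_cons_some ht <;> try omega
    all_goals
      simp only [hrun_nil, Option.some.injEq] at ht
      refine ⟨[b, c], ?_, rfl, ?_⟩
      · repeat first | exact List.nil_sublist _ | apply List.Sublist.cons_cons | apply List.Sublist.cons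
      · repeat first | (refine hrun_dec (by omega) ?_) | (refine hrun_inc (by omega) ?_)
        exact ⟨_, hrun_nil _, by omega⟩
  -- The subword `[b, d, c]` has an ascent followed by a descent, so no run exists.
  · obtain ⟨h4, ht⟩ | ⟨h4, h4', ht⟩ := hrun_cons_some ht <;> try omega
    all_goals obtain ⟨h5, ht⟩ | ⟨h5, h5', ht⟩ := hrun_cons_some ht <;> try omega
    all_goals obtain ⟨h6, ht⟩ | ⟨h6, h6', ht⟩ := hrun_cons_some ht <;> try omega
  · obtain ⟨h4, ht⟩ | ⟨h4, h4', ht⟩ := hrun_cons_some ht <;> try omega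
    all_goals obtain ⟨h5, ht⟩ | ⟨h5, h5', ht⟩ := hrun_cons_some ht <;> try omega
    all_goals obtain ⟨h6, ht⟩ | ⟨h6, h6', ht⟩ := hrun_cons_some ht <;> try omega
    all_goals
      simp only [hrun_nil, Option.some.injEq] at ht
      refine ⟨[a, b, c], ?_, rfl, ?_⟩
      · repeat first | exact List.nil_sublist _ | apply List.Sublist.cons_cons | apply List.Sublist.cons
      · repeat first | (refine hrun_dec (by omega) ?_) | (refine hrun_inc (by omega) ?_)
        exact ⟨_, hrun_nil _, by omega⟩
  · obtain ⟨h4, ht⟩ | ⟨h4, h4', ht⟩ := hrun_cons_some ht <;> try omega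
    all_goals obtain ⟨h5, ht⟩ | ⟨h5, h5', ht⟩ := hrun_cons_some ht <;> try omega
    all_goals obtain ⟨h6, ht⟩ | ⟨h6, h6', ht⟩ := hrun_cons_some ht <;> try omega
    all_goals obtain ⟨h7, ht⟩ | ⟨h7, h7', ht⟩ := hrun_cons_some ht <;> try omega

set_option maxHeartbeats 400000 in
theorem hookDom_r3' (a b c d : ℕ+) (h1 : a ≤ b) (h2 : b ≤ c) (h3 : c < d) :
    HookDom [a, d, b, c] [a, b, d, c] := by
  have ha := a.pos
  simp only [← PNat.coe_lt_coe, ← PNat.coe_le_coe] at h1 h2 h3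
  intro s t l hl ht
  simp only [← List.mem_sublists', List.sublists'_cons, List.sublists'_nil, List.map_cons,
    List.map_nil, List.nil_append, List.cons_append, List.mem_cons, List.not_mem_nil, or_false]
    at hl
  rcases hl with rfl | rfl | rfl | rfl | rfl | rfl | rfl | rfl | rfl | rfl | rfl | rfl | rfl |
    rfl | rfl | rfl
  all_goals try
    (refine ⟨_, ?_, rfl, t, ht, le_rfl⟩
     (repeat first | exact List.nil_sublist _ | apply List.Sublist.cons_cons | apply List.Sublist.cons)
     done)
  · obtain ⟨h4, ht⟩ | ⟨h4, h4', ht⟩ := hrun_cons_some ht <;> try omega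
    all_goals obtain ⟨h5, ht⟩ | ⟨h5, h5', ht⟩ := hrun_cons_some ht <;> try omega
    all_goals
      simp only [hrun_nil, Option.some.injEq] at ht
      refine ⟨[d, c], ?_, rfl, ?_⟩
      · repeat first | exact List.nil_sublist _ | apply List.Sublist.cons_cons | apply List.Sublist.cons
      · repeat first | (refine hrun_dec (by omega) ?_) | (refine hrun_inc (by omega) ?_)
        exact ⟨_, hrun_nil _, by omega⟩
  · obtain ⟨h4, ht⟩ | ⟨h4, h4', ht⟩ := hrun_cons_some ht <;> try omega
    all_goals obtain ⟨h5, ht⟩ | ⟨h5, h5', ht⟩ := hrun_cons_some ht <;> try omega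
    all_goals obtain ⟨h6, ht⟩ | ⟨h6, h6', ht⟩ := hrun_cons_some ht <;> try omega
    all_goals
      simp only [hrun_nil, Option.some.injEq] at ht
      -- This replaces `[d, b, c]`. Since `b < d`, the letter `d` can only be read in the decreasing
      -- branch, where the smaller `a` is admissible too.
      refine ⟨[a, b, c], ?_, rfl, ?_⟩
      · repeat first | exact List.nil_sublist _ | apply List.Sublist.cons_cons | apply List.Sublist.cons
      · repeat first | (refine hrun_dec (by omega) ?_) | (refine hrun_inc (by omega) ?_)
        exact ⟨_, hrun_nil _, by omega⟩
  · obtain ⟨h4, ht⟩ | ⟨h4, h4', ht⟩ := hrun_cons_some ht <;> try omega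
    all_goals obtain ⟨h5, ht⟩ | ⟨h5, h5', ht⟩ := hrun_cons_some ht <;> try omega
    all_goals obtain ⟨h6, ht⟩ | ⟨h6, h6', ht⟩ := hrun_cons_some ht <;> try omega
  · obtain ⟨h4, ht⟩ | ⟨h4, h4', ht⟩ := hrun_cons_some ht <;> try omega
    all_goals obtain ⟨h5, ht⟩ | ⟨h5, h5', ht⟩ := hrun_cons_some ht <;> try omega
    all_goals obtain ⟨h6, ht⟩ | ⟨h6, h6', ht⟩ := hrun_cons_some ht <;> try omega

set_option maxHeartbeats 400000 in
theorem hookDom_r4 (a b c d : ℕ+) (h1 : a ≤ b) (h2 : b < c) (h3 : c ≤ d) :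
    HookDom [a, c, d, b] [a, c, b, d] := by
  have ha := a.pos
  simp only [← PNat.coe_lt_coe, ← PNat.coe_le_coe] at h1 h2 h3
  intro s t l hl ht
  simp only [← List.mem_sublists', List.sublists'_cons, List.sublists'_nil, List.map_cons,
    List.map_nil, List.nil_append, List.cons_append, List.mem_cons, List.not_mem_nil, or_false]
    at hl
  rcases hl with rfl | rfl | rfl | rfl | rfl | rfl | rfl | rfl | rfl | rfl | rfl | rfl | rfl |
    rfl | rfl | rfl
  all_goals try
    (refine ⟨_, ?_, rfl, t, ht, le_rfl⟩
     (repeat first | exact List.nil_sublist _ | apply List.Sublist.cons_cons | apply List.Sublist.cons)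
     done)
  · obtain ⟨h4, ht⟩ | ⟨h4, h4', ht⟩ := hrun_cons_some ht <;> try omega
    all_goals obtain ⟨h5, ht⟩ | ⟨h5, h5', ht⟩ := hrun_cons_some ht <;> try omega
    all_goals
      simp only [hrun_nil, Option.some.injEq] at ht
      refine ⟨[c, b], ?_, rfl, ?_⟩
      · repeat first | exact List.nil_sublist _ | apply List.Sublist.cons_cons | apply List.Sublist.cons
      · repeat first | (refine hrun_dec (by omega) ?_) | (refine hrun_inc (by omega) ?_)
        exact ⟨_, hrun_nil _, by omega⟩
  · obtain ⟨h4, ht⟩ | ⟨h4, h4', ht⟩ := hrun_cons_some ht <;> try omega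
    all_goals obtain ⟨h5, ht⟩ | ⟨h5, h5', ht⟩ := hrun_cons_some ht <;> try omega
    all_goals obtain ⟨h6, ht⟩ | ⟨h6, h6', ht⟩ := hrun_cons_some ht <;> try omega
  · obtain ⟨h4, ht⟩ | ⟨h4, h4', ht⟩ := hrun_cons_some ht <;> try omega
    all_goals obtain ⟨h5, ht⟩ | ⟨h5, h5', ht⟩ := hrun_cons_some ht <;> try omega
    all_goals obtain ⟨h6, ht⟩ | ⟨h6, h6', ht⟩ := hrun_cons_some ht <;> try omega
  · obtain ⟨h4, ht⟩ | ⟨h4, h4', ht⟩ := hrun_cons_some ht <;> try omega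
    all_goals obtain ⟨h5, ht⟩ | ⟨h5, h5', ht⟩ := hrun_cons_some ht <;> try omega
    all_goals obtain ⟨h6, ht⟩ | ⟨h6, h6', ht⟩ := hrun_cons_some ht <;> try omega
    all_goals obtain ⟨h7, ht⟩ | ⟨h7, h7', ht⟩ := hrun_cons_some ht <;> try omega

set_option maxHeartbeats 400000 in
theorem hookDom_r4' (a b c d : ℕ+) (h1 : a ≤ b) (h2 : b < c) (h3 : c ≤ d) :
    HookDom [a, c, b, d] [a, c, d, b] := by
  have ha := a.pos
  simp only [← PNat.coe_lt_coe, ← PNat.coe_le_coe] at h1 h2 h3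
  intro s t l hl ht
  simp only [← List.mem_sublists', List.sublists'_cons, List.sublists'_nil, List.map_cons,
    List.map_nil, List.nil_append, List.cons_append, List.mem_cons, List.not_mem_nil, or_false]
    at hl
  rcases hl with rfl | rfl | rfl | rfl | rfl | rfl | rfl | rfl | rfl | rfl | rfl | rfl | rfl |
    rfl | rfl | rfl
  all_goals try
    (refine ⟨_, ?_, rfl, t, ht, le_rfl⟩
     (repeat first | exact List.nil_sublist _ | apply List.Sublist.cons_cons | apply List.Sublist.cons)
     done)
  · obtain ⟨h4, ht⟩ | ⟨h4, h4', ht⟩ := hrun_cons_some ht <;> try omega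
    all_goals obtain ⟨h5, ht⟩ | ⟨h5, h5', ht⟩ := hrun_cons_some ht <;> try omega
    all_goals
      simp only [hrun_nil, Option.some.injEq] at ht
      refine ⟨[c, d], ?_, rfl, ?_⟩
      · repeat first | exact List.nil_sublist _ | apply List.Sublist.cons_cons | apply List.Sublist.cons
      · repeat first | (refine hrun_dec (by omega) ?_) | (refine hrun_inc (by omega) ?_)
        exact ⟨_, hrun_nil _, by omega⟩
  · obtain ⟨h4, ht⟩ | ⟨h4, h4', ht⟩ := hrun_cons_some ht <;> try omega
    all_goals obtain ⟨h5, ht⟩ | ⟨h5, h5', ht⟩ := hrun_cons_some ht <;> try omega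
    all_goals obtain ⟨h6, ht⟩ | ⟨h6, h6', ht⟩ := hrun_cons_some ht <;> try omega
    all_goals
      simp only [hrun_nil, Option.some.injEq] at ht
      refine ⟨[a, c, d], ?_, rfl, ?_⟩
      · repeat first | exact List.nil_sublist _ | apply List.Sublist.cons_cons | apply List.Sublist.cons
      · repeat first | (refine hrun_dec (by omega) ?_) | (refine hrun_inc (by omega) ?_)
        exact ⟨_, hrun_nil _, by omega⟩
  · obtain ⟨h4, ht⟩ | ⟨h4, h4', ht⟩ := hrun_cons_some ht <;> try omega
    all_goals obtain ⟨h5, ht⟩ | ⟨h5, h5', ht⟩ := hrun_cons_some ht <;> try omega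
    all_goals obtain ⟨h6, ht⟩ | ⟨h6, h6', ht⟩ := hrun_cons_some ht <;> try omega
    all_goals
      simp only [hrun_nil, Option.some.injEq] at ht
      refine ⟨[a, c, d], ?_, rfl, ?_⟩
      · repeat first | exact List.nil_sublist _ | apply List.Sublist.cons_cons | apply List.Sublist.cons
      · repeat first | (refine hrun_dec (by omega) ?_) | (refine hrun_inc (by omega) ?_)
        exact ⟨_, hrun_nil _, by omega⟩
  · obtain ⟨h4, ht⟩ | ⟨h4, h4', ht⟩ := hrun_cons_some ht <;> try omega
    all_goals obtain ⟨h5, ht⟩ | ⟨h5, h5', ht⟩ := hrun_cons_some ht <;> try omega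
    all_goals obtain ⟨h6, ht⟩ | ⟨h6, h6', ht⟩ := hrun_cons_some ht <;> try omega

set_option maxHeartbeats 400000 in
theorem hookDom_r5 (a b c d : ℕ+) (h1 : a ≤ b) (h2 : b < c) (h3 : c < d) :
    HookDom [d, a, c, b] [a, d, c, b] := by
  have ha := a.pos
  simp only [← PNat.coe_lt_coe, ← PNat.coe_le_coe] at h1 h2 h3
  intro s t l hl ht
  simp only [← List.mem_sublists', List.sublists'_cons, List.sublists'_nil, List.map_cons,
    List.map_nil, List.nil_append, List.cons_append, List.mem_cons, List.not_mem_nil, or_false]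
    at hl
  rcases hl with rfl | rfl | rfl | rfl | rfl | rfl | rfl | rfl | rfl | rfl | rfl | rfl | rfl |
    rfl | rfl | rfl
  all_goals try
    (refine ⟨_, ?_, rfl, t, ht, le_rfl⟩
     (repeat first | exact List.nil_sublist _ | apply List.Sublist.cons_cons | apply List.Sublist.cons)
     done)
  · obtain ⟨h4, ht⟩ | ⟨h4, h4', ht⟩ := hrun_cons_some ht <;> try omega
    all_goals obtain ⟨h5, ht⟩ | ⟨h5, h5', ht⟩ := hrun_cons_some ht <;> try omega
    all_goals
      simp only [hrun_nil, Option.some.injEq] at ht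
      refine ⟨[d, c], ?_, rfl, ?_⟩
      · repeat first | exact List.nil_sublist _ | apply List.Sublist.cons_cons | apply List.Sublist.cons
      · repeat first | (refine hrun_dec (by omega) ?_) | (refine hrun_inc (by omega) ?_)
        exact ⟨_, hrun_nil _, by omega⟩
  · obtain ⟨h4, ht⟩ | ⟨h4, h4', ht⟩ := hrun_cons_some ht <;> try omega
    all_goals obtain ⟨h5, ht⟩ | ⟨h5, h5', ht⟩ := hrun_cons_some ht <;> try omega
    all_goals obtain ⟨h6, ht⟩ | ⟨h6, h6', ht⟩ := hrun_cons_some ht <;> try omega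
    all_goals
      simp only [hrun_nil, Option.some.injEq] at ht
      refine ⟨[d, c, b], ?_, rfl, ?_⟩
      · repeat first | exact List.nil_sublist _ | apply List.Sublist.cons_cons | apply List.Sublist.cons
      · repeat first | (refine hrun_dec (by omega) ?_) | (refine hrun_inc (by omega) ?_)
        exact ⟨_, hrun_nil _, by omega⟩
  · obtain ⟨h4, ht⟩ | ⟨h4, h4', ht⟩ := hrun_cons_some ht <;> try omega
    all_goals obtain ⟨h5, ht⟩ | ⟨h5, h5', ht⟩ := hrun_cons_some ht <;> try omega
    all_goals obtain ⟨h6, ht⟩ | ⟨h6, h6', ht⟩ := hrun_cons_some ht <;> try omega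
    all_goals
      simp only [hrun_nil, Option.some.injEq] at ht
      refine ⟨[d, c, b], ?_, rfl, ?_⟩
      · repeat first | exact List.nil_sublist _ | apply List.Sublist.cons_cons | apply List.Sublist.cons
      · repeat first | (refine hrun_dec (by omega) ?_) | (refine hrun_inc (by omega) ?_)
        exact ⟨_, hrun_nil _, by omega⟩
  · obtain ⟨h4, ht⟩ | ⟨h4, h4', ht⟩ := hrun_cons_some ht <;> try omega
    all_goals obtain ⟨h5, ht⟩ | ⟨h5, h5', ht⟩ := hrun_cons_some ht <;> try omega
    all_goals obtain ⟨h6, ht⟩ | ⟨h6, h6', ht⟩ := hrun_cons_some ht <;> try omega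
    all_goals obtain ⟨h7, ht⟩ | ⟨h7, h7', ht⟩ := hrun_cons_some ht <;> try omega

set_option maxHeartbeats 400000 in
theorem hookDom_r5' (a b c d : ℕ+) (h1 : a ≤ b) (h2 : b < c) (h3 : c < d) :
    HookDom [a, d, c, b] [d, a, c, b] := by
  have ha := a.pos
  simp only [← PNat.coe_lt_coe, ← PNat.coe_le_coe] at h1 h2 h3
  intro s t l hl ht
  simp only [← List.mem_sublists', List.sublists'_cons, List.sublists'_nil, List.map_cons,
    List.map_nil, List.nil_append, List.cons_append, List.mem_cons, List.not_mem_nil, or_false]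
    at hl
  rcases hl with rfl | rfl | rfl | rfl | rfl | rfl | rfl | rfl | rfl | rfl | rfl | rfl | rfl |
    rfl | rfl | rfl
  all_goals try
    (refine ⟨_, ?_, rfl, t, ht, le_rfl⟩
     (repeat first | exact List.nil_sublist _ | apply List.Sublist.cons_cons | apply List.Sublist.cons)
     done)
  · obtain ⟨h4, ht⟩ | ⟨h4, h4', ht⟩ := hrun_cons_some ht <;> try omega
    all_goals obtain ⟨h5, ht⟩ | ⟨h5, h5', ht⟩ := hrun_cons_some ht <;> try omega
    all_goals
      simp only [hrun_nil, Option.some.injEq] at ht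
      refine ⟨[a, c], ?_, rfl, ?_⟩
      · repeat first | exact List.nil_sublist _ | apply List.Sublist.cons_cons | apply List.Sublist.cons
      · repeat first | (refine hrun_dec (by omega) ?_) | (refine hrun_inc (by omega) ?_)
        exact ⟨_, hrun_nil _, by omega⟩
  · obtain ⟨h4, ht⟩ | ⟨h4, h4', ht⟩ := hrun_cons_some ht <;> try omega
    all_goals obtain ⟨h5, ht⟩ | ⟨h5, h5', ht⟩ := hrun_cons_some ht <;> try omega
    all_goals obtain ⟨h6, ht⟩ | ⟨h6, h6', ht⟩ := hrun_cons_some ht <;> try omega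
  · obtain ⟨h4, ht⟩ | ⟨h4, h4', ht⟩ := hrun_cons_some ht <;> try omega
    all_goals obtain ⟨h5, ht⟩ | ⟨h5, h5', ht⟩ := hrun_cons_some ht <;> try omega
    all_goals obtain ⟨h6, ht⟩ | ⟨h6, h6', ht⟩ := hrun_cons_some ht <;> try omega
  · obtain ⟨h4, ht⟩ | ⟨h4, h4', ht⟩ := hrun_cons_some ht <;> try omega
    all_goals obtain ⟨h5, ht⟩ | ⟨h5, h5', ht⟩ := hrun_cons_some ht <;> try omega
    all_goals obtain ⟨h6, ht⟩ | ⟨h6, h6', ht⟩ := hrun_cons_some ht <;> try omega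

set_option maxHeartbeats 400000 in
theorem hookDom_r6 (a b c d : ℕ+) (h1 : a < b) (h2 : b ≤ c) (h3 : c < d) :
    HookDom [b, a, d, c] [b, d, a, c] := by
  have ha := a.pos
  simp only [← PNat.coe_lt_coe, ← PNat.coe_le_coe] at h1 h2 h3
  intro s t l hl ht
  simp only [← List.mem_sublists', List.sublists'_cons, List.sublists'_nil, List.map_cons,
    List.map_nil, List.nil_append, List.cons_append, List.mem_cons, List.not_mem_nil, or_false]
    at hl
  rcases hl with rfl | rfl | rfl | rfl | rfl | rfl | rfl | rfl | rfl | rfl | rfl | rfl | rfl |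
    rfl | rfl | rfl
  all_goals try
    (refine ⟨_, ?_, rfl, t, ht, le_rfl⟩
     (repeat first | exact List.nil_sublist _ | apply List.Sublist.cons_cons | apply List.Sublist.cons)
     done)
  · obtain ⟨h4, ht⟩ | ⟨h4, h4', ht⟩ := hrun_cons_some ht <;> try omega
    all_goals obtain ⟨h5, ht⟩ | ⟨h5, h5', ht⟩ := hrun_cons_some ht <;> try omega
    all_goals
      simp only [hrun_nil, Option.some.injEq] at ht
      refine ⟨[b, d], ?_, rfl, ?_⟩
      · repeat first | exact List.nil_sublist _ | apply List.Sublist.cons_cons | apply List.Sublist.cons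
      · repeat first | (refine hrun_dec (by omega) ?_) | (refine hrun_inc (by omega) ?_)
        exact ⟨_, hrun_nil _, by omega⟩
  · obtain ⟨h4, ht⟩ | ⟨h4, h4', ht⟩ := hrun_cons_some ht <;> try omega
    all_goals obtain ⟨h5, ht⟩ | ⟨h5, h5', ht⟩ := hrun_cons_some ht <;> try omega
    all_goals obtain ⟨h6, ht⟩ | ⟨h6, h6', ht⟩ := hrun_cons_some ht <;> try omega
  · obtain ⟨h4, ht⟩ | ⟨h4, h4', ht⟩ := hrun_cons_some ht <;> try omega
    all_goals obtain ⟨h5, ht⟩ | ⟨h5, h5', ht⟩ := hrun_cons_some ht <;> try omega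
    all_goals obtain ⟨h6, ht⟩ | ⟨h6, h6', ht⟩ := hrun_cons_some ht <;> try omega
    all_goals
      simp only [hrun_nil, Option.some.injEq] at ht
      refine ⟨[b, a, c], ?_, rfl, ?_⟩
      · repeat first | exact List.nil_sublist _ | apply List.Sublist.cons_cons | apply List.Sublist.cons
      · repeat first | (refine hrun_dec (by omega) ?_) | (refine hrun_inc (by omega) ?_)
        exact ⟨_, hrun_nil _, by omega⟩
  · obtain ⟨h4, ht⟩ | ⟨h4, h4', ht⟩ := hrun_cons_some ht <;> try omega
    all_goals obtain ⟨h5, ht⟩ | ⟨h5, h5', ht⟩ := hrun_cons_some ht <;> try omega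
    all_goals obtain ⟨h6, ht⟩ | ⟨h6, h6', ht⟩ := hrun_cons_some ht <;> try omega
    all_goals obtain ⟨h7, ht⟩ | ⟨h7, h7', ht⟩ := hrun_cons_some ht <;> try omega

set_option maxHeartbeats 400000 in
theorem hookDom_r6' (a b c d : ℕ+) (h1 : a < b) (h2 : b ≤ c) (h3 : c < d) :
    HookDom [b, d, a, c] [b, a, d, c] := by
  have ha := a.pos
  simp only [← PNat.coe_lt_coe, ← PNat.coe_le_coe] at h1 h2 h3
  intro s t l hl ht
  simp only [← List.mem_sublists', List.sublists'_cons, List.sublists'_nil, List.map_cons,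
    List.map_nil, List.nil_append, List.cons_append, List.mem_cons, List.not_mem_nil, or_false]
    at hl
  rcases hl with rfl | rfl | rfl | rfl | rfl | rfl | rfl | rfl | rfl | rfl | rfl | rfl | rfl |
    rfl | rfl | rfl
  all_goals try
    (refine ⟨_, ?_, rfl, t, ht, le_rfl⟩
     (repeat first | exact List.nil_sublist _ | apply List.Sublist.cons_cons | apply List.Sublist.cons)
     done)
  · obtain ⟨h4, ht⟩ | ⟨h4, h4', ht⟩ := hrun_cons_some ht <;> try omega
    all_goals obtain ⟨h5, ht⟩ | ⟨h5, h5', ht⟩ := hrun_cons_some ht <;> try omega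
    all_goals
      simp only [hrun_nil, Option.some.injEq] at ht
      refine ⟨[b, a], ?_, rfl, ?_⟩
      · repeat first | exact List.nil_sublist _ | apply List.Sublist.cons_cons | apply List.Sublist.cons
      · repeat first | (refine hrun_dec (by omega) ?_) | (refine hrun_inc (by omega) ?_)
        exact ⟨_, hrun_nil _, by omega⟩
  · obtain ⟨h4, ht⟩ | ⟨h4, h4', ht⟩ := hrun_cons_some ht <;> try omega
    all_goals obtain ⟨h5, ht⟩ | ⟨h5, h5', ht⟩ := hrun_cons_some ht <;> try omega
    all_goals obtain ⟨h6, ht⟩ | ⟨h6, h6', ht⟩ := hrun_cons_some ht <;> try omega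
    all_goals
      simp only [hrun_nil, Option.some.injEq] at ht
      refine ⟨[b, a, c], ?_, rfl, ?_⟩
      · repeat first | exact List.nil_sublist _ | apply List.Sublist.cons_cons | apply List.Sublist.cons
      · repeat first | (refine hrun_dec (by omega) ?_) | (refine hrun_inc (by omega) ?_)
        exact ⟨_, hrun_nil _, by omega⟩
  · obtain ⟨h4, ht⟩ | ⟨h4, h4', ht⟩ := hrun_cons_some ht <;> try omega
    all_goals obtain ⟨h5, ht⟩ | ⟨h5, h5', ht⟩ := hrun_cons_some ht <;> try omega
    all_goals obtain ⟨h6, ht⟩ | ⟨h6, h6', ht⟩ := hrun_cons_some ht <;> try omega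
  · obtain ⟨h4, ht⟩ | ⟨h4, h4', ht⟩ := hrun_cons_some ht <;> try omega
    all_goals obtain ⟨h5, ht⟩ | ⟨h5, h5', ht⟩ := hrun_cons_some ht <;> try omega
    all_goals obtain ⟨h6, ht⟩ | ⟨h6, h6', ht⟩ := hrun_cons_some ht <;> try omega

set_option maxHeartbeats 400000 in
theorem hookDom_r7 (a b c d : ℕ+) (h1 : a < b) (h2 : b < c) (h3 : c ≤ d) :
    HookDom [c, b, d, a] [c, d, b, a] := by
  have ha := a.pos
  simp only [← PNat.coe_lt_coe, ← PNat.coe_le_coe] at h1 h2 h3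
  intro s t l hl ht
  simp only [← List.mem_sublists', List.sublists'_cons, List.sublists'_nil, List.map_cons,
    List.map_nil, List.nil_append, List.cons_append, List.mem_cons, List.not_mem_nil, or_false]
    at hl
  rcases hl with rfl | rfl | rfl | rfl | rfl | rfl | rfl | rfl | rfl | rfl | rfl | rfl | rfl |
    rfl | rfl | rfl
  all_goals try
    (refine ⟨_, ?_, rfl, t, ht, le_rfl⟩
     (repeat first | exact List.nil_sublist _ | apply List.Sublist.cons_cons | apply List.Sublist.cons)
     done)
  · obtain ⟨h4, ht⟩ | ⟨h4, h4', ht⟩ := hrun_cons_some ht <;> try omega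
    all_goals obtain ⟨h5, ht⟩ | ⟨h5, h5', ht⟩ := hrun_cons_some ht <;> try omega
    all_goals
      simp only [hrun_nil, Option.some.injEq] at ht
      refine ⟨[c, d], ?_, rfl, ?_⟩
      · repeat first | exact List.nil_sublist _ | apply List.Sublist.cons_cons | apply List.Sublist.cons
      · repeat first | (refine hrun_dec (by omega) ?_) | (refine hrun_inc (by omega) ?_)
        exact ⟨_, hrun_nil _, by omega⟩
  · obtain ⟨h4, ht⟩ | ⟨h4, h4', ht⟩ := hrun_cons_some ht <;> try omega
    all_goals obtain ⟨h5, ht⟩ | ⟨h5, h5', ht⟩ := hrun_cons_some ht <;> try omega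
    all_goals obtain ⟨h6, ht⟩ | ⟨h6, h6', ht⟩ := hrun_cons_some ht <;> try omega
  · obtain ⟨h4, ht⟩ | ⟨h4, h4', ht⟩ := hrun_cons_some ht <;> try omega
    all_goals obtain ⟨h5, ht⟩ | ⟨h5, h5', ht⟩ := hrun_cons_some ht <;> try omega
    all_goals obtain ⟨h6, ht⟩ | ⟨h6, h6', ht⟩ := hrun_cons_some ht <;> try omega
    all_goals
      simp only [hrun_nil, Option.some.injEq] at ht
      refine ⟨[c, b, a], ?_, rfl, ?_⟩
      · repeat first | exact List.nil_sublist _ | apply List.Sublist.cons_cons | apply List.Sublist.cons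
      · repeat first | (refine hrun_dec (by omega) ?_) | (refine hrun_inc (by omega) ?_)
        exact ⟨_, hrun_nil _, by omega⟩
  · obtain ⟨h4, ht⟩ | ⟨h4, h4', ht⟩ := hrun_cons_some ht <;> try omega
    all_goals obtain ⟨h5, ht⟩ | ⟨h5, h5', ht⟩ := hrun_cons_some ht <;> try omega
    all_goals obtain ⟨h6, ht⟩ | ⟨h6, h6', ht⟩ := hrun_cons_some ht <;> try omega
    all_goals obtain ⟨h7, ht⟩ | ⟨h7, h7', ht⟩ := hrun_cons_some ht <;> try omega

set_option maxHeartbeats 400000 in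
theorem hookDom_r7' (a b c d : ℕ+) (h1 : a < b) (h2 : b < c) (h3 : c ≤ d) :
    HookDom [c, d, b, a] [c, b, d, a] := by
  have ha := a.pos
  simp only [← PNat.coe_lt_coe, ← PNat.coe_le_coe] at h1 h2 h3
  intro s t l hl ht
  simp only [← List.mem_sublists', List.sublists'_cons, List.sublists'_nil, List.map_cons,
    List.map_nil, List.nil_append, List.cons_append, List.mem_cons, List.not_mem_nil, or_false]
    at hl
  rcases hl with rfl | rfl | rfl | rfl | rfl | rfl | rfl | rfl | rfl | rfl | rfl | rfl | rfl |
    rfl | rfl | rfl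
  all_goals try
    (refine ⟨_, ?_, rfl, t, ht, le_rfl⟩
     (repeat first | exact List.nil_sublist _ | apply List.Sublist.cons_cons | apply List.Sublist.cons)
     done)
  · obtain ⟨h4, ht⟩ | ⟨h4, h4', ht⟩ := hrun_cons_some ht <;> try omega
    all_goals obtain ⟨h5, ht⟩ | ⟨h5, h5', ht⟩ := hrun_cons_some ht <;> try omega
    all_goals
      simp only [hrun_nil, Option.some.injEq] at ht
      refine ⟨[c, b], ?_, rfl, ?_⟩
      · repeat first | exact List.nil_sublist _ | apply List.Sublist.cons_cons | apply List.Sublist.cons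
      · repeat first | (refine hrun_dec (by omega) ?_) | (refine hrun_inc (by omega) ?_)
        exact ⟨_, hrun_nil _, by omega⟩
  · obtain ⟨h4, ht⟩ | ⟨h4, h4', ht⟩ := hrun_cons_some ht <;> try omega
    all_goals obtain ⟨h5, ht⟩ | ⟨h5, h5', ht⟩ := hrun_cons_some ht <;> try omega
    all_goals obtain ⟨h6, ht⟩ | ⟨h6, h6', ht⟩ := hrun_cons_some ht <;> try omega
    all_goals
      simp only [hrun_nil, Option.some.injEq] at ht
      refine ⟨[c, b, a], ?_, rfl, ?_⟩
      · repeat first | exact List.nil_sublist _ | apply List.Sublist.cons_cons | apply List.Sublist.cons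
      · repeat first | (refine hrun_dec (by omega) ?_) | (refine hrun_inc (by omega) ?_)
        exact ⟨_, hrun_nil _, by omega⟩
  · obtain ⟨h4, ht⟩ | ⟨h4, h4', ht⟩ := hrun_cons_some ht <;> try omega
    all_goals obtain ⟨h5, ht⟩ | ⟨h5, h5', ht⟩ := hrun_cons_some ht <;> try omega
    all_goals obtain ⟨h6, ht⟩ | ⟨h6, h6', ht⟩ := hrun_cons_some ht <;> try omega
  · obtain ⟨h4, ht⟩ | ⟨h4, h4', ht⟩ := hrun_cons_some ht <;> try omega
    all_goals obtain ⟨h5, ht⟩ | ⟨h5, h5', ht⟩ := hrun_cons_some ht <;> try omega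
    all_goals obtain ⟨h6, ht⟩ | ⟨h6, h6', ht⟩ := hrun_cons_some ht <;> try omega

set_option maxHeartbeats 400000 in
theorem hookDom_r8 (a b c d : ℕ+) (h1 : a < b) (h2 : b ≤ c) (h3 : c < d) :
    HookDom [d, b, c, a] [b, d, c, a] := by
  have ha := a.pos
  simp only [← PNat.coe_lt_coe, ← PNat.coe_le_coe] at h1 h2 h3
  intro s t l hl ht
  simp only [← List.mem_sublists', List.sublists'_cons, List.sublists'_nil, List.map_cons,
    List.map_nil, List.nil_append, List.cons_append, List.mem_cons, List.not_mem_nil, or_false]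
    at hl
  rcases hl with rfl | rfl | rfl | rfl | rfl | rfl | rfl | rfl | rfl | rfl | rfl | rfl | rfl |
    rfl | rfl | rfl
  all_goals try
    (refine ⟨_, ?_, rfl, t, ht, le_rfl⟩
     (repeat first | exact List.nil_sublist _ | apply List.Sublist.cons_cons | apply List.Sublist.cons)
     done)
  · obtain ⟨h4, ht⟩ | ⟨h4, h4', ht⟩ := hrun_cons_some ht <;> try omega
    all_goals obtain ⟨h5, ht⟩ | ⟨h5, h5', ht⟩ := hrun_cons_some ht <;> try omega
    all_goals
      simp only [hrun_nil, Option.some.injEq] at ht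
      refine ⟨[d, c], ?_, rfl, ?_⟩
      · repeat first | exact List.nil_sublist _ | apply List.Sublist.cons_cons | apply List.Sublist.cons
      · repeat first | (refine hrun_dec (by omega) ?_) | (refine hrun_inc (by omega) ?_)
        exact ⟨_, hrun_nil _, by omega⟩
  · obtain ⟨h4, ht⟩ | ⟨h4, h4', ht⟩ := hrun_cons_some ht <;> try omega
    all_goals obtain ⟨h5, ht⟩ | ⟨h5, h5', ht⟩ := hrun_cons_some ht <;> try omega
    all_goals obtain ⟨h6, ht⟩ | ⟨h6, h6', ht⟩ := hrun_cons_some ht <;> try omega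
    all_goals
      simp only [hrun_nil, Option.some.injEq] at ht
      refine ⟨[d, c, a], ?_, rfl, ?_⟩
      · repeat first | exact List.nil_sublist _ | apply List.Sublist.cons_cons | apply List.Sublist.cons
      · repeat first | (refine hrun_dec (by omega) ?_) | (refine hrun_inc (by omega) ?_)
        exact ⟨_, hrun_nil _, by omega⟩
  · obtain ⟨h4, ht⟩ | ⟨h4, h4', ht⟩ := hrun_cons_some ht <;> try omega
    all_goals obtain ⟨h5, ht⟩ | ⟨h5, h5', ht⟩ := hrun_cons_some ht <;> try omega
    all_goals obtain ⟨h6, ht⟩ | ⟨h6, h6', ht⟩ := hrun_cons_some ht <;> try omega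
    all_goals
      simp only [hrun_nil, Option.some.injEq] at ht
      refine ⟨[d, c, a], ?_, rfl, ?_⟩
      · repeat first | exact List.nil_sublist _ | apply List.Sublist.cons_cons | apply List.Sublist.cons
      · repeat first | (refine hrun_dec (by omega) ?_) | (refine hrun_inc (by omega) ?_)
        exact ⟨_, hrun_nil _, by omega⟩
  · obtain ⟨h4, ht⟩ | ⟨h4, h4', ht⟩ := hrun_cons_some ht <;> try omega
    all_goals obtain ⟨h5, ht⟩ | ⟨h5, h5', ht⟩ := hrun_cons_some ht <;> try omega
    all_goals obtain ⟨h6, ht⟩ | ⟨h6, h6', ht⟩ := hrun_cons_some ht <;> try omega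
    all_goals obtain ⟨h7, ht⟩ | ⟨h7, h7', ht⟩ := hrun_cons_some ht <;> try omega

set_option maxHeartbeats 400000 in
theorem hookDom_r8' (a b c d : ℕ+) (h1 : a < b) (h2 : b ≤ c) (h3 : c < d) :
    HookDom [b, d, c, a] [d, b, c, a] := by
  have ha := a.pos
  simp only [← PNat.coe_lt_coe, ← PNat.coe_le_coe] at h1 h2 h3
  intro s t l hl ht
  simp only [← List.mem_sublists', List.sublists'_cons, List.sublists'_nil, List.map_cons,
    List.map_nil, List.nil_append, List.cons_append, List.mem_cons, List.not_mem_nil, or_false]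
    at hl
  rcases hl with rfl | rfl | rfl | rfl | rfl | rfl | rfl | rfl | rfl | rfl | rfl | rfl | rfl |
    rfl | rfl | rfl
  all_goals try
    (refine ⟨_, ?_, rfl, t, ht, le_rfl⟩
     (repeat first | exact List.nil_sublist _ | apply List.Sublist.cons_cons | apply List.Sublist.cons)
     done)
  · obtain ⟨h4, ht⟩ | ⟨h4, h4', ht⟩ := hrun_cons_some ht <;> try omega
    all_goals obtain ⟨h5, ht⟩ | ⟨h5, h5', ht⟩ := hrun_cons_some ht <;> try omega
    all_goals
      simp only [hrun_nil, Option.some.injEq] at ht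
      refine ⟨[b, c], ?_, rfl, ?_⟩
      · repeat first | exact List.nil_sublist _ | apply List.Sublist.cons_cons | apply List.Sublist.cons
      · repeat first | (refine hrun_dec (by omega) ?_) | (refine hrun_inc (by omega) ?_)
        exact ⟨_, hrun_nil _, by omega⟩
  · obtain ⟨h4, ht⟩ | ⟨h4, h4', ht⟩ := hrun_cons_some ht <;> try omega
    all_goals obtain ⟨h5, ht⟩ | ⟨h5, h5', ht⟩ := hrun_cons_some ht <;> try omega
    all_goals obtain ⟨h6, ht⟩ | ⟨h6, h6', ht⟩ := hrun_cons_some ht <;> try omega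
  · obtain ⟨h4, ht⟩ | ⟨h4, h4', ht⟩ := hrun_cons_some ht <;> try omega
    all_goals obtain ⟨h5, ht⟩ | ⟨h5, h5', ht⟩ := hrun_cons_some ht <;> try omega
    all_goals obtain ⟨h6, ht⟩ | ⟨h6, h6', ht⟩ := hrun_cons_some ht <;> try omega
  · obtain ⟨h4, ht⟩ | ⟨h4, h4', ht⟩ := hrun_cons_some ht <;> try omega
    all_goals obtain ⟨h5, ht⟩ | ⟨h5, h5', ht⟩ := hrun_cons_some ht <;> try omega
    all_goals obtain ⟨h6, ht⟩ | ⟨h6, h6', ht⟩ := hrun_cons_some ht <;> try omega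

set_option maxHeartbeats 400000 in
theorem hookDom_r9 (a b c d : ℕ+) (h1 : a < b) (h2 : b ≤ c) (h3 : c ≤ d) :
    HookDom [b, c, d, a] [b, c, a, d] := by
  have ha := a.pos
  simp only [← PNat.coe_lt_coe, ← PNat.coe_le_coe] at h1 h2 h3
  intro s t l hl ht
  simp only [← List.mem_sublists', List.sublists'_cons, List.sublists'_nil, List.map_cons,
    List.map_nil, List.nil_append, List.cons_append, List.mem_cons, List.not_mem_nil, or_false]
    at hl
  rcases hl with rfl | rfl | rfl | rfl | rfl | rfl | rfl | rfl | rfl | rfl | rfl | rfl | rfl |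
    rfl | rfl | rfl
  all_goals try
    (refine ⟨_, ?_, rfl, t, ht, le_rfl⟩
     (repeat first | exact List.nil_sublist _ | apply List.Sublist.cons_cons | apply List.Sublist.cons)
     done)
  · obtain ⟨h4, ht⟩ | ⟨h4, h4', ht⟩ := hrun_cons_some ht <;> try omega
    all_goals obtain ⟨h5, ht⟩ | ⟨h5, h5', ht⟩ := hrun_cons_some ht <;> try omega
    all_goals
      simp only [hrun_nil, Option.some.injEq] at ht
      refine ⟨[b, a], ?_, rfl, ?_⟩
      · repeat first | exact List.nil_sublist _ | apply List.Sublist.cons_cons | apply List.Sublist.cons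
      · repeat first | (refine hrun_dec (by omega) ?_) | (refine hrun_inc (by omega) ?_)
        exact ⟨_, hrun_nil _, by omega⟩
  · obtain ⟨h4, ht⟩ | ⟨h4, h4', ht⟩ := hrun_cons_some ht <;> try omega
    all_goals obtain ⟨h5, ht⟩ | ⟨h5, h5', ht⟩ := hrun_cons_some ht <;> try omega
    all_goals obtain ⟨h6, ht⟩ | ⟨h6, h6', ht⟩ := hrun_cons_some ht <;> try omega
  · obtain ⟨h4, ht⟩ | ⟨h4, h4', ht⟩ := hrun_cons_some ht <;> try omega
    all_goals obtain ⟨h5, ht⟩ | ⟨h5, h5', ht⟩ := hrun_cons_some ht <;> try omega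
    all_goals obtain ⟨h6, ht⟩ | ⟨h6, h6', ht⟩ := hrun_cons_some ht <;> try omega
  · obtain ⟨h4, ht⟩ | ⟨h4, h4', ht⟩ := hrun_cons_some ht <;> try omega
    all_goals obtain ⟨h5, ht⟩ | ⟨h5, h5', ht⟩ := hrun_cons_some ht <;> try omega
    all_goals obtain ⟨h6, ht⟩ | ⟨h6, h6', ht⟩ := hrun_cons_some ht <;> try omega
    all_goals obtain ⟨h7, ht⟩ | ⟨h7, h7', ht⟩ := hrun_cons_some ht <;> try omega

set_option maxHeartbeats 400000 in
theorem hookDom_r9' (a b c d : ℕ+) (h1 : a < b) (h2 : b ≤ c) (h3 : c ≤ d) :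
    HookDom [b, c, a, d] [b, c, d, a] := by
  have ha := a.pos
  simp only [← PNat.coe_lt_coe, ← PNat.coe_le_coe] at h1 h2 h3
  intro s t l hl ht
  simp only [← List.mem_sublists', List.sublists'_cons, List.sublists'_nil, List.map_cons,
    List.map_nil, List.nil_append, List.cons_append, List.mem_cons, List.not_mem_nil, or_false]
    at hl
  rcases hl with rfl | rfl | rfl | rfl | rfl | rfl | rfl | rfl | rfl | rfl | rfl | rfl | rfl |
    rfl | rfl | rfl
  all_goals try
    (refine ⟨_, ?_, rfl, t, ht, le_rfl⟩
     (repeat first | exact List.nil_sublist _ | apply List.Sublist.cons_cons | apply List.Sublist.cons)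
     done)
  · obtain ⟨h4, ht⟩ | ⟨h4, h4', ht⟩ := hrun_cons_some ht <;> try omega
    all_goals obtain ⟨h5, ht⟩ | ⟨h5, h5', ht⟩ := hrun_cons_some ht <;> try omega
    all_goals
      simp only [hrun_nil, Option.some.injEq] at ht
      refine ⟨[b, c], ?_, rfl, ?_⟩
      · repeat first | exact List.nil_sublist _ | apply List.Sublist.cons_cons | apply List.Sublist.cons
      · repeat first | (refine hrun_dec (by omega) ?_) | (refine hrun_inc (by omega) ?_)
        exact ⟨_, hrun_nil _, by omega⟩
  · obtain ⟨h4, ht⟩ | ⟨h4, h4', ht⟩ := hrun_cons_some ht <;> try omega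
    all_goals obtain ⟨h5, ht⟩ | ⟨h5, h5', ht⟩ := hrun_cons_some ht <;> try omega
    all_goals obtain ⟨h6, ht⟩ | ⟨h6, h6', ht⟩ := hrun_cons_some ht <;> try omega
    all_goals
      simp only [hrun_nil, Option.some.injEq] at ht
      refine ⟨[b, c, d], ?_, rfl, ?_⟩
      · repeat first | exact List.nil_sublist _ | apply List.Sublist.cons_cons | apply List.Sublist.cons
      · repeat first | (refine hrun_dec (by omega) ?_) | (refine hrun_inc (by omega) ?_)
        exact ⟨_, hrun_nil _, by omega⟩
  · obtain ⟨h4, ht⟩ | ⟨h4, h4', ht⟩ := hrun_cons_some ht <;> try omega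
    all_goals obtain ⟨h5, ht⟩ | ⟨h5, h5', ht⟩ := hrun_cons_some ht <;> try omega
    all_goals obtain ⟨h6, ht⟩ | ⟨h6, h6', ht⟩ := hrun_cons_some ht <;> try omega
    all_goals
      simp only [hrun_nil, Option.some.injEq] at ht
      refine ⟨[b, c, d], ?_, rfl, ?_⟩
      · repeat first | exact List.nil_sublist _ | apply List.Sublist.cons_cons | apply List.Sublist.cons
      · repeat first | (refine hrun_dec (by omega) ?_) | (refine hrun_inc (by omega) ?_)
        exact ⟨_, hrun_nil _, by omega⟩
  · obtain ⟨h4, ht⟩ | ⟨h4, h4', ht⟩ := hrun_cons_some ht <;> try omega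
    all_goals obtain ⟨h5, ht⟩ | ⟨h5, h5', ht⟩ := hrun_cons_some ht <;> try omega
    all_goals obtain ⟨h6, ht⟩ | ⟨h6, h6', ht⟩ := hrun_cons_some ht <;> try omega

set_option maxHeartbeats 400000 in
theorem hookDom_r10 (a b c d : ℕ+) (h1 : a ≤ b) (h2 : b < c) (h3 : c ≤ d) :
    HookDom [c, a, d, b] [c, d, a, b] := by
  have ha := a.pos
  simp only [← PNat.coe_lt_coe, ← PNat.coe_le_coe] at h1 h2 h3
  intro s t l hl ht
  simp only [← List.mem_sublists', List.sublists'_cons, List.sublists'_nil, List.map_cons,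
    List.map_nil, List.nil_append, List.cons_append, List.mem_cons, List.not_mem_nil, or_false]
    at hl
  rcases hl with rfl | rfl | rfl | rfl | rfl | rfl | rfl | rfl | rfl | rfl | rfl | rfl | rfl |
    rfl | rfl | rfl
  all_goals try
    (refine ⟨_, ?_, rfl, t, ht, le_rfl⟩
     (repeat first | exact List.nil_sublist _ | apply List.Sublist.cons_cons | apply List.Sublist.cons)
     done)
  · obtain ⟨h4, ht⟩ | ⟨h4, h4', ht⟩ := hrun_cons_some ht <;> try omega
    all_goals obtain ⟨h5, ht⟩ | ⟨h5, h5', ht⟩ := hrun_cons_some ht <;> try omega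
    all_goals
      simp only [hrun_nil, Option.some.injEq] at ht
      refine ⟨[c, d], ?_, rfl, ?_⟩
      · repeat first | exact List.nil_sublist _ | apply List.Sublist.cons_cons | apply List.Sublist.cons
      · repeat first | (refine hrun_dec (by omega) ?_) | (refine hrun_inc (by omega) ?_)
        exact ⟨_, hrun_nil _, by omega⟩
  · obtain ⟨h4, ht⟩ | ⟨h4, h4', ht⟩ := hrun_cons_some ht <;> try omega
    all_goals obtain ⟨h5, ht⟩ | ⟨h5, h5', ht⟩ := hrun_cons_some ht <;> try omega
    all_goals obtain ⟨h6, ht⟩ | ⟨h6, h6', ht⟩ := hrun_cons_some ht <;> try omega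
  · obtain ⟨h4, ht⟩ | ⟨h4, h4', ht⟩ := hrun_cons_some ht <;> try omega
    all_goals obtain ⟨h5, ht⟩ | ⟨h5, h5', ht⟩ := hrun_cons_some ht <;> try omega
    all_goals obtain ⟨h6, ht⟩ | ⟨h6, h6', ht⟩ := hrun_cons_some ht <;> try omega
    all_goals
      simp only [hrun_nil, Option.some.injEq] at ht
      refine ⟨[c, a, b], ?_, rfl, ?_⟩
      · repeat first | exact List.nil_sublist _ | apply List.Sublist.cons_cons | apply List.Sublist.cons
      · repeat first | (refine hrun_dec (by omega) ?_) | (refine hrun_inc (by omega) ?_)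
        exact ⟨_, hrun_nil _, by omega⟩
  · obtain ⟨h4, ht⟩ | ⟨h4, h4', ht⟩ := hrun_cons_some ht <;> try omega
    all_goals obtain ⟨h5, ht⟩ | ⟨h5, h5', ht⟩ := hrun_cons_some ht <;> try omega
    all_goals obtain ⟨h6, ht⟩ | ⟨h6, h6', ht⟩ := hrun_cons_some ht <;> try omega
    all_goals obtain ⟨h7, ht⟩ | ⟨h7, h7', ht⟩ := hrun_cons_some ht <;> try omega

set_option maxHeartbeats 400000 in
theorem hookDom_r10' (a b c d : ℕ+) (h1 : a ≤ b) (h2 : b < c) (h3 : c ≤ d) :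
    HookDom [c, d, a, b] [c, a, d, b] := by
  have ha := a.pos
  simp only [← PNat.coe_lt_coe, ← PNat.coe_le_coe] at h1 h2 h3
  intro s t l hl ht
  simp only [← List.mem_sublists', List.sublists'_cons, List.sublists'_nil, List.map_cons,
    List.map_nil, List.nil_append, List.cons_append, List.mem_cons, List.not_mem_nil, or_false]
    at hl
  rcases hl with rfl | rfl | rfl | rfl | rfl | rfl | rfl | rfl | rfl | rfl | rfl | rfl | rfl |
    rfl | rfl | rfl
  all_goals try
    (refine ⟨_, ?_, rfl, t, ht, le_rfl⟩
     (repeat first | exact List.nil_sublist _ | apply List.Sublist.cons_cons | apply List.Sublist.cons)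
     done)
  · obtain ⟨h4, ht⟩ | ⟨h4, h4', ht⟩ := hrun_cons_some ht <;> try omega
    all_goals obtain ⟨h5, ht⟩ | ⟨h5, h5', ht⟩ := hrun_cons_some ht <;> try omega
    all_goals
      simp only [hrun_nil, Option.some.injEq] at ht
      refine ⟨[c, a], ?_, rfl, ?_⟩
      · repeat first | exact List.nil_sublist _ | apply List.Sublist.cons_cons | apply List.Sublist.cons
      · repeat first | (refine hrun_dec (by omega) ?_) | (refine hrun_inc (by omega) ?_)
        exact ⟨_, hrun_nil _, by omega⟩
  · obtain ⟨h4, ht⟩ | ⟨h4, h4', ht⟩ := hrun_cons_some ht <;> try omega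
    all_goals obtain ⟨h5, ht⟩ | ⟨h5, h5', ht⟩ := hrun_cons_some ht <;> try omega
    all_goals obtain ⟨h6, ht⟩ | ⟨h6, h6', ht⟩ := hrun_cons_some ht <;> try omega
    all_goals
      simp only [hrun_nil, Option.some.injEq] at ht
      refine ⟨[c, a, b], ?_, rfl, ?_⟩
      · repeat first | exact List.nil_sublist _ | apply List.Sublist.cons_cons | apply List.Sublist.cons
      · repeat first | (refine hrun_dec (by omega) ?_) | (refine hrun_inc (by omega) ?_)
        exact ⟨_, hrun_nil _, by omega⟩
  · obtain ⟨h4, ht⟩ | ⟨h4, h4', ht⟩ := hrun_cons_some ht <;> try omega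
    all_goals obtain ⟨h5, ht⟩ | ⟨h5, h5', ht⟩ := hrun_cons_some ht <;> try omega
    all_goals obtain ⟨h6, ht⟩ | ⟨h6, h6', ht⟩ := hrun_cons_some ht <;> try omega
  · obtain ⟨h4, ht⟩ | ⟨h4, h4', ht⟩ := hrun_cons_some ht <;> try omega
    all_goals obtain ⟨h5, ht⟩ | ⟨h5, h5', ht⟩ := hrun_cons_some ht <;> try omega
    all_goals obtain ⟨h6, ht⟩ | ⟨h6, h6', ht⟩ := hrun_cons_some ht <;> try omega

/-! ### A bound for hook subwords -/

/-- Every hook subword of `w` has length at most `k`. -/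
def HB (w : List PNum) (k : ℕ) : Prop :=
  ∀ l : List ℕ+, l.Sublist (w.map PNum.num) → HookList l → l.length ≤ k

theorem DecRel.hookDom {u v : List PNum} (h : DecRel u v) :
    HookDom (u.map PNum.num) (v.map PNum.num) ∧ HookDom (v.map PNum.num) (u.map PNum.num) := by
  cases h with
  | r1 a b p h1 => exact ⟨.refl _, .refl _⟩
  | r2 a b p h1 => exact ⟨.refl _, .refl _⟩
  | r3 a b c d p q h1 h2 h3 => exact ⟨hookDom_r3 a b c d h1 h2 h3, hookDom_r3' a b c d h1 h2 h3⟩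
  | r4 a b c d p q h1 h2 h3 => exact ⟨hookDom_r4 a b c d h1 h2 h3, hookDom_r4' a b c d h1 h2 h3⟩
  | r5 a b c d p q h1 h2 h3 => exact ⟨hookDom_r5 a b c d h1 h2 h3, hookDom_r5' a b c d h1 h2 h3⟩
  | r6 a b c d p q h1 h2 h3 => exact ⟨hookDom_r6 a b c d h1 h2 h3, hookDom_r6' a b c d h1 h2 h3⟩
  | r7 a b c d p q h1 h2 h3 => exact ⟨hookDom_r7 a b c d h1 h2 h3, hookDom_r7' a b c d h1 h2 h3⟩
  | r8 a b c d p q h1 h2 h3 => exact ⟨hookDom_r8 a b c d h1 h2 h3, hookDom_r8' a b c d h1 h2 h3⟩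
  | r9 a b c d p q h1 h2 h3 => exact ⟨hookDom_r9 a b c d h1 h2 h3, hookDom_r9' a b c d h1 h2 h3⟩
  | r10 a b c d p q h1 h2 h3 =>
    exact ⟨hookDom_r10 a b c d h1 h2 h3, hookDom_r10' a b c d h1 h2 h3⟩

theorem Dec.hookDom {v w : List PNum} (h : Dec v w) :
    HookDom (v.map PNum.num) (w.map PNum.num) ∧ HookDom (w.map PNum.num) (v.map PNum.num) := by
  refine Dec.ind (Q := fun v w => HookDom (v.map PNum.num) (w.map PNum.num) ∧
    HookDom (w.map PNum.num) (v.map PNum.num)) (fun _ _ h => h.hookDom) (fun _ => ⟨.refl _, .refl _⟩)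
    (fun _ _ h => h.symm) (fun _ _ _ h h' => ⟨h.1.trans h'.1, h'.2.trans h.2⟩) ?_ h
  intro u u' v v' h h'
  simp only [List.map_append]
  exact ⟨h.1.append h'.1, h.2.append h'.2⟩

/-- Domination in both directions makes the length of a longest hook subword an invariant of the
congruence class, an analogue of Greene's theorem for the first row. -/
theorem Dec.hb {v w : List PNum} (h : Dec v w) {k : ℕ} (hv : HB v k) : HB w k := by
  intro l hl hh
  obtain ⟨s, t, ht⟩ := (hookList_iff_hrun l).1 hh
  obtain ⟨l', hl', e, t', ht', -⟩ := h.hookDom.2 s t l hl ht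
  rw [← e]
  exact hv l' hl' ((hookList_iff_hrun _).2 ⟨s, t', ht'⟩)

theorem HB.sublist {v w : List PNum} {k : ℕ} (h : HB w k)
    (hv : (v.map PNum.num).Sublist (w.map PNum.num)) : HB v k :=
  fun l hl hh => h l (hl.trans hv) hh

theorem HB.setp {w : List PNum} {k : ℕ} (h : HB w k) (b : Bool) : HB (setp b w) k := by
  intro l hl
  rw [map_num_setp] at hl
  exact h l hl

/-! ### Crystal operators preserve the bound on hook subwords -/

theorem sorted_split_ge {i : ℕ+} {l : List ℕ+} (h : l.Pairwise (· ≤ ·)) (hi : ∀ y ∈ l, i ≤ y) :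
    ∃ t l', l = List.replicate t i ++ l' ∧ ∀ y ∈ l', i < y := by
  induction l with
  | nil => exact ⟨0, [], rfl, by simp⟩
  | cons x l ih =>
    rw [List.pairwise_cons] at h
    rcases (hi x (by simp)).eq_or_lt with rfl | hx
    · obtain ⟨t, l', rfl, h'⟩ := ih h.2 fun y hy => hi y (by simp [hy])
      exact ⟨t + 1, l', rfl, h'⟩
    · exact ⟨0, x :: l, rfl, by
        simp only [List.mem_cons, forall_eq_or_imp]
        exact ⟨hx, fun y hy => hx.trans_le (h.1 y hy)⟩⟩

theorem sorted_split_le {i : ℕ+} {l : List ℕ+} (h : l.Pairwise (· ≤ ·)) (hi : ∀ y ∈ l, y ≤ i) :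
    ∃ t l', l = l' ++ List.replicate t i ∧ ∀ y ∈ l', y < i := by
  induction l with
  | nil => exact ⟨0, [], rfl, by simp⟩
  | cons x l ih =>
    rw [List.pairwise_cons] at h
    obtain ⟨t, l', rfl, h'⟩ := ih h.2 fun y hy => hi y (by simp [hy])
    rcases (hi x (by simp)).eq_or_lt with rfl | hx
    · cases l' with
      | nil => exact ⟨t + 1, [], rfl, by simp⟩
      | cons y l' => exact absurd (h' y (by simp)) (h.1 y (by simp)).not_gt
    · exact ⟨t, x :: l', rfl, by simpa using ⟨hx, h'⟩⟩

theorem HookList.split {x : ℕ+} {lA lB : List ℕ+} (h : HookList (lA ++ x :: lB)) :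
    (∃ c e, lB = c ++ e ∧ (lA ++ x :: c).Pairwise (· > ·) ∧ e.Pairwise (· ≤ ·)) ∨
    ∃ d c, lA = d ++ c ∧ d.Pairwise (· > ·) ∧ (c ++ x :: lB).Pairwise (· ≤ ·) := by
  obtain ⟨d, e, hde, hd, he⟩ := h
  rcases List.append_eq_append_iff.1 hde with ⟨c, rfl, hc⟩ | ⟨c, rfl, hc⟩
  · cases c with
    | nil => exact .inr ⟨lA, [], by simp, by simpa using hd, by simp at hc; simpa [hc] using he⟩
    | cons y c =>
      obtain ⟨rfl, rfl⟩ : x = y ∧ lB = c ++ e := by simpa using hc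
      exact .inl ⟨c, e, rfl, hd, he⟩
  · subst hc
    exact .inr ⟨d, c, rfl, hd, he⟩

/-- The changed letter of a raised word is pulled back. The hypotheses say that every `i + 1` in `A`
is bracketed inside `A`, and every `i` in `B` inside `B`. If simply replacing `i` by `i + 1`
destroys the hook, the bracketing supplies other letters of the right value. -/
theorem hookList_raise {i : ℕ+} {A B lA lB : List ℕ+}
    (hA : ∀ A1 A2, A = A1 ++ A2 → A2.count (i + 1) ≤ A2.count i)
    (hB : ∀ B1 B2, B = B1 ++ B2 → B1.count i ≤ B1.count (i + 1))
    (hlA : lA.Sublist A) (hlB : lB.Sublist B) (h : HookList (lA ++ i :: lB)) :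
    ∃ l', l'.Sublist (A ++ (i + 1) :: B) ∧ l'.length = (lA ++ i :: lB).length ∧ HookList l' := by
  have hi : i < i + 1 := PNat.lt_add_one_iff.2 le_rfl
  have hi' : ∀ {y : ℕ+}, i < y → i + 1 ≤ y := PNat.add_one_le_iff.2
  rcases h.split with ⟨c, e, rfl, hd, he⟩ | ⟨d, c, rfl, hd, he⟩
  · by_cases hm : i + 1 ∈ lA
    -- Here `i` lies in the decreasing part and `i + 1` occurs directly before it. By bracketing,
    -- some `i` in `A` follows that `i + 1`, and it takes over the role of the changed letter.
    · obtain ⟨l1, l2, rfl⟩ := List.append_of_mem hm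
      obtain rfl : l2 = [] := by
        cases l2 with
        | nil => rfl
        | cons y l2 =>
          simp only [List.append_assoc, List.pairwise_append, List.cons_append, List.pairwise_cons,
            List.mem_cons, List.mem_append] at hd
          have h1 : i < y := hd.2.1.2.1 i (by simp)
          have h2 : y < i + 1 := hd.2.1.1 y (by simp)
          exact absurd h2 (hi' h1).not_gt
      obtain ⟨A1, A2, rfl, h1, h2⟩ := List.append_sublist_iff.1 hlA
      obtain ⟨X, Y, rfl⟩ := List.append_of_mem (List.singleton_sublist.1 h2)
      have h3 := hA (A1 ++ X) ((i + 1) :: Y) (by simp)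
      have h4 : i ∈ Y := by
        rw [List.count_cons_self, List.count_cons_of_ne hi.ne'] at h3
        exact List.count_pos_iff.1 (by omega)
      refine ⟨_, ?_, rfl, (l1 ++ [i + 1]) ++ i :: c, e, by simp, hd, he⟩
      have h5 : ((i + 1) :: i :: (c ++ e)).Sublist ((i + 1) :: Y ++ (i + 1) :: B) :=
        ((List.singleton_sublist.2 h4).append (hlB.cons (i + 1))).cons_cons _
      simpa using h1.append (h5.trans (List.sublist_append_right X _))
    · refine ⟨lA ++ (i + 1) :: (c ++ e), hlA.append (hlB.cons_cons _), by simp, lA ++ (i + 1) :: c,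
          e, by simp, ?_, he⟩
      simp only [List.pairwise_append, List.pairwise_cons, List.mem_cons] at hd ⊢
      refine ⟨hd.1, ⟨fun y hy => (hd.2.1.1 y hy).trans hi, hd.2.1.2⟩, ?_⟩
      rintro y hy z (rfl | hz)
      · exact lt_of_le_of_ne (hi' (hd.2.2 y hy i (by simp))) fun h => hm (h ▸ hy)
      · exact hd.2.2 y hy z (by simp [hz])
  · simp only [List.pairwise_append, List.pairwise_cons, List.mem_cons] at he
    -- Here `i` lies in the increasing part. The `t` copies of `i` chosen after it are exchanged for
    -- copies of `i + 1`, which are at least as frequent in the same prefix of `B`.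
    obtain ⟨t, l', rfl, hl'⟩ := sorted_split_ge he.2.1.2 he.2.1.1
    obtain ⟨B1, B2, rfl, h1, h2⟩ := List.append_sublist_iff.1 hlB
    have h3 : (List.replicate t (i + 1)).Sublist B1 :=
      List.replicate_sublist_iff.2
        ((List.replicate_sublist_iff.1 h1).trans (hB B1 B2 rfl))
    refine ⟨d ++ c ++ (i + 1) :: (List.replicate t (i + 1) ++ l'),
      hlA.append ((h3.append h2).cons_cons _), by simp, d,
      c ++ (i + 1) :: (List.replicate t (i + 1) ++ l'), by simp, hd, ?_⟩
    have h4 := (List.pairwise_append.1 he.2.1.2).2.1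
    simp only [List.pairwise_append, List.pairwise_cons, List.mem_cons, List.mem_append,
      List.mem_replicate, List.pairwise_replicate]
    refine ⟨he.1, ⟨?_, by simp, h4, ?_⟩, ?_⟩
    · rintro y (⟨-, rfl⟩ | hy)
      · exact le_rfl
      · exact hi' (hl' y hy)
    · rintro y ⟨-, rfl⟩ z hz
      exact hi' (hl' z hz)
    · rintro y hy z (rfl | ⟨-, rfl⟩ | hz)
      · exact (he.2.2 y hy i (by simp)).trans hi.le
      · exact (he.2.2 y hy i (by simp)).trans hi.le
      · exact he.2.2 y hy z (by simp [hz])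

/-- The mirror image of `hookList_raise`: the decreasing branch is repaired by an `i + 1` in `B`
before the conflicting `i`, the increasing branch by copies of `i` in a suffix of `A`. -/
theorem hookList_lower {i : ℕ+} {A B lA lB : List ℕ+}
    (hA : ∀ A1 A2, A = A1 ++ A2 → A2.count (i + 1) ≤ A2.count i)
    (hB : ∀ B1 B2, B = B1 ++ B2 → B1.count i ≤ B1.count (i + 1))
    (hlA : lA.Sublist A) (hlB : lB.Sublist B) (h : HookList (lA ++ (i + 1) :: lB)) :
    ∃ l', l'.Sublist (A ++ i :: B) ∧ l'.length = (lA ++ (i + 1) :: lB).length ∧ HookList l' := by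
  have hi : i < i + 1 := PNat.lt_add_one_iff.2 le_rfl
  have hi' : ∀ {y : ℕ+}, y < i + 1 → y ≤ i := PNat.lt_add_one_iff.1
  rcases h.split with ⟨c, e, rfl, hd, he⟩ | ⟨d, c, rfl, hd, he⟩
  · by_cases hm : i ∈ c
    · obtain ⟨l1, c, rfl⟩ := List.append_of_mem hm
      obtain rfl : l1 = [] := by
        cases l1 with
        | nil => rfl
        | cons y l2 =>
          simp only [List.append_assoc, List.pairwise_append, List.cons_append, List.pairwise_cons,
            List.mem_cons, List.mem_append] at hd
          have h1 : y < i + 1 := hd.2.1.1 y (by simp)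
          have h2 : i < y := hd.2.1.2.1 i (by simp)
          exact absurd h2 (hi' h1).not_gt
      simp only [List.nil_append, List.cons_append] at hlB hd ⊢
      obtain ⟨B1, B2, rfl, h1, h2⟩ := List.cons_sublist_iff.1 hlB
      obtain ⟨X, Y, rfl⟩ := List.append_of_mem h1
      have h3 := hB (X ++ [i]) (Y ++ B2) (by simp)
      have h4 : i + 1 ∈ X := by
        simp only [List.count_append, List.count_singleton_self, List.count_singleton,
          beq_iff_eq, hi.ne, if_false] at h3
        exact List.count_pos_iff.1 (by omega)
      refine ⟨_, ?_, rfl, lA ++ (i + 1) :: i :: c, e, by simp, hd, he⟩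
      refine hlA.append (List.Sublist.cons _ ?_)
      have h5 : (i :: (c ++ e)).Sublist (i :: (Y ++ B2)) :=
        (h2.trans (List.sublist_append_right Y _)).cons_cons _
      simpa using (List.singleton_sublist.2 h4).append h5
    · refine ⟨lA ++ i :: (c ++ e), hlA.append (hlB.cons_cons _), by simp, lA ++ i :: c,
          e, by simp, ?_, he⟩
      simp only [List.pairwise_append, List.pairwise_cons, List.mem_cons] at hd ⊢
      refine ⟨hd.1, ⟨fun y hy => lt_of_le_of_ne (hi' (hd.2.1.1 y hy)) fun h => hm (h ▸ hy),
        hd.2.1.2⟩, ?_⟩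
      rintro y hy z (rfl | hz)
      · exact hi.trans (hd.2.2 y hy _ (.inl rfl))
      · exact hd.2.2 y hy z (by simp [hz])
  · simp only [List.pairwise_append, List.pairwise_cons, List.mem_cons] at he
    obtain ⟨t, l', rfl, hl'⟩ := sorted_split_le he.1 fun y hy => he.2.2 y hy _ (.inl rfl)
    rw [← List.append_assoc] at hlA
    obtain ⟨A1, A2, rfl, h1, h2⟩ := List.append_sublist_iff.1 hlA
    have h3 : (List.replicate t i).Sublist A2 :=
      List.replicate_sublist_iff.2
        ((List.replicate_sublist_iff.1 h2).trans (hA A1 A2 rfl))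
    refine ⟨(d ++ l') ++ List.replicate t i ++ i :: lB,
      (h1.append h3).append (hlB.cons_cons _), by simp, d,
      l' ++ (List.replicate t i ++ i :: lB), by simp, hd, ?_⟩
    have h4 := (List.pairwise_append.1 he.1).1
    simp only [List.pairwise_append, List.pairwise_cons, List.mem_cons, List.mem_append,
      List.mem_replicate, List.pairwise_replicate]
    refine ⟨h4, ⟨by simp, ⟨fun y hy => hi.le.trans (he.2.1.1 y hy), he.2.1.2⟩, ?_⟩, ?_⟩
    · rintro y ⟨-, rfl⟩ z (rfl | hz)
      · exact le_rfl
      · exact hi.le.trans (he.2.1.1 z hz)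
    · rintro y hy z (⟨-, rfl⟩ | rfl | hz)
      · exact hi' (hl' y hy)
      · exact hi' (hl' y hy)
      · exact he.2.2 y (by simp [hy]) z (by simp [hz])

theorem HB.replace {A B : List PNum} {x y : PNum} {k : ℕ} (h : HB (A ++ x :: B) k)
    (hxy : ∀ lA lB : List ℕ+, lA.Sublist (A.map PNum.num) → lB.Sublist (B.map PNum.num) →
      HookList (lA ++ y.num :: lB) → ∃ l' : List ℕ+,
        l'.Sublist ((A ++ x :: B).map PNum.num) ∧ l'.length = (lA ++ y.num :: lB).length ∧
        HookList l') : HB (A ++ y :: B) k := by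
  intro l hl hh
  rw [List.map_append, List.map_cons] at hl
  obtain ⟨lA, lB, rfl, h1, h2⟩ := List.sublist_append_iff.1 hl
  rcases List.sublist_cons_iff.1 h2 with h3 | ⟨lB, rfl, h3⟩
  · refine h _ ?_ hh
    rw [List.map_append, List.map_cons]
    exact h1.append (h3.cons _)
  · obtain ⟨l', hl', e, hh'⟩ := hxy lA lB h1 h3 hh
    rw [← e]
    exact h l' hl' hh'

/-- An `i + 1` in `A` can only be cancelled by letters to its right, so vanishing of `eps` passes to
suffixes, where it is a count inequality. -/
theorem eps_zero_suffix {i : ℕ+} {A : List PNum} (h : eps i A = 0) (A1 A2 : List ℕ+)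
    (hA : A.map PNum.num = A1 ++ A2) : A2.count (i + 1) ≤ A2.count i := by
  obtain ⟨u, v, rfl, rfl, rfl⟩ := List.map_eq_append_iff.1 hA
  rw [eps_append] at h
  have := phi_add_cn i v
  change cn (i + 1) v ≤ cn i v
  omega

theorem phi_zero_prefix {i : ℕ+} {B : List PNum} (h : phi i B = 0) (B1 B2 : List ℕ+)
    (hB : B.map PNum.num = B1 ++ B2) : B1.count i ≤ B1.count (i + 1) := by
  obtain ⟨u, v, rfl, rfl, rfl⟩ := List.map_eq_append_iff.1 hB
  rw [phi_append] at h
  have := phi_add_cn i u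
  change cn i u ≤ cn (i + 1) u
  omega

theorem HB.wF {i : ℕ+} {w w' : List PNum} {k : ℕ} (h : HB w k) (hw : wF i w = some w') :
    HB w' k := by
  obtain ⟨A, B, p, rfl, rfl, hA, hB⟩ := (wF_eq_some _ _ _).1 hw
  refine h.replace fun lA lB h1 h2 h3 => ?_
  simpa using hookList_lower (eps_zero_suffix hA) (phi_zero_prefix hB) h1 h2 h3

theorem HB.wE {i : ℕ+} {w w' : List PNum} {k : ℕ} (h : HB w k) (hw : wE i w = some w') :
    HB w' k := by
  obtain ⟨A, B, p, rfl, rfl, hA, hB⟩ := (wE_eq_some _ _ _).1 hw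
  refine h.replace fun lA lB h1 h2 h3 => ?_
  simpa using hookList_raise (eps_zero_suffix hA) (phi_zero_prefix hB) h1 h2 h3

/-- All letters before `x` exceed 2, so they must decrease. At most one letter smaller than `x` can
follow, so `lB` is weakly increasing in every case. Thus `y` can serve as the end of the decreasing
part with no condition relating it to `lB`. -/
theorem hookList_bar {x y : ℕ+} (hx : x = 1 ∨ x = 2) (hy : y = 1 ∨ y = 2) {lA lB : List ℕ+}
    (hA : ∀ z ∈ lA, z ≠ 1 ∧ z ≠ 2) (h : HookList (lA ++ x :: lB)) : HookList (lA ++ y :: lB) := by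
  have h3 : ∀ z : ℕ+, z ≠ 1 ∧ z ≠ 2 → 2 < z := by
    rintro z ⟨h1, h2⟩
    have := z.pos
    have h1' : (z : ℕ) ≠ 1 := fun h => h1 (PNat.coe_injective h)
    have h2' : (z : ℕ) ≠ 2 := fun h => h2 (PNat.coe_injective h)
    change 2 < (z : ℕ)
    omega
  have hxle : x ≤ 2 := by rcases hx with rfl | rfl <;> decide
  have hyle : y ≤ 2 := by rcases hy with rfl | rfl <;> decide
  suffices hs : lA.Pairwise (· > ·) ∧ lB.Pairwise (· ≤ ·) by
    refine ⟨lA ++ [y], lB, by simp, ?_, hs.2⟩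
    simp only [List.pairwise_append, List.pairwise_singleton, List.mem_singleton]
    refine ⟨hs.1, trivial, ?_⟩
    rintro z hz _ rfl
    exact hyle.trans_lt (h3 z (hA z hz))
  rcases h.split with ⟨c, e, rfl, hd, he⟩ | ⟨d, c, rfl, hd, he⟩
  · simp only [List.pairwise_append, List.pairwise_cons, List.mem_cons] at hd
    refine ⟨hd.1, ?_⟩
    have hc1 : ∀ z ∈ c, z = 1 := fun z hz => by
      have h1 : z < x := hd.2.1.1 z hz
      exact le_one_iff_eq_one.1 (PNat.lt_add_one_iff.1 (h1.trans_le hxle))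
    match c, hc1, hd.2.1.2 with
    | [], _, _ => simpa using he
    | [z], hz, _ =>
      have := hz z (by simp)
      subst this
      simpa using he
    | z :: z' :: c, hz, h4 =>
      have h5 : z' < z := (List.pairwise_cons.1 h4).1 z' (by simp)
      rw [hz z (by simp)] at h5
      exact absurd h5 not_lt_one
  · simp only [List.pairwise_append, List.pairwise_cons, List.mem_cons] at he
    refine ⟨?_, he.2.1.2⟩
    cases c with
    | nil => simpa using hd
    | cons z c =>
      exact absurd ((he.2.2 z (by simp) x (.inl rfl)).trans hxle) (h3 z (hA z (by simp))).not_ge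

theorem HB.bar {A B : List PNum} {x y : PNum} {b : Bool} {k : ℕ} (hx : x.num = 1 ∨ x.num = 2)
    (hy : y.num = 1 ∨ y.num = 2) (hA : ∀ z ∈ A, z.num ≠ 1 ∧ z.num ≠ 2)
    (h : HB (A ++ x :: B) k) : HB (A ++ y :: QueerPlus.setp b B) k := by
  have h' : HB (A ++ y :: B) k := h.replace fun lA lB h1 h2 h3 => by
    refine ⟨lA ++ x.num :: lB, ?_, by simp, hookList_bar hy hx ?_ h3⟩
    · simpa using h1.append (h2.cons_cons _)
    · intro z hz
      obtain ⟨a, ha, rfl⟩ := List.mem_map.1 (h1.subset hz)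
      exact hA a ha
  exact h'.sublist (by simp)

theorem HB.wFb {w w' : List PNum} {k : ℕ} (h : HB w k) (hw : wFb w = some w') : HB w' k := by
  obtain ⟨A, B, p, hA, rfl, rfl⟩ := (wFb_eq_some _ _).1 hw
  exact HB.bar (.inl rfl) (.inr rfl) hA h

theorem HB.wEb {w w' : List PNum} {k : ℕ} (h : HB w k) (hw : wEb w = some w') : HB w' k := by
  obtain ⟨A, B, p, hA, rfl, rfl⟩ := (wEb_eq_some _ _).1 hw
  exact HB.bar (.inr rfl) (.inl rfl) hA h

/-! ### Rows -/

/-- The unprimed word with given absolute values. -/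
def un (l : List ℕ+) : List PNum := l.map fun x => ⟨x, false⟩

@[simp] theorem un_nil : un [] = [] := rfl
@[simp] theorem un_cons (x : ℕ+) (l : List ℕ+) : un (x :: l) = ⟨x, false⟩ :: un l := rfl
@[simp] theorem un_append (l m : List ℕ+) : un (l ++ m) = un l ++ un m := by simp [un]
@[simp] theorem map_num_un (l : List ℕ+) : (un l).map PNum.num = l := by
  simp [un, Function.comp_def]
@[simp] theorem un_length (l : List ℕ+) : (un l).length = l.length := by simp [un]
@[simp] theorem un_reverse (l : List ℕ+) : (un l).reverse = un l.reverse := by simp [un]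

/-- The row with weakly decreasing entries `D`, middle element `m` with prime `q` and increasing
part `I`. -/
def row (D : List ℕ+) (m : ℕ+) (q : Bool) (I : List ℕ+) : List PNum := un D ++ ⟨m, q⟩ :: un I

/-- The word `D m I` is a hook word with middle element `m`. -/
structure RowOK (D : List ℕ+) (m : ℕ+) (I : List ℕ+) : Prop where
  dec : D.Pairwise (· ≥ ·)
  le_dec : ∀ y ∈ D, m ≤ y
  lt_inc : ∀ y ∈ I, m < y
  inc : I.Pairwise (· < ·)

@[simp] theorem map_num_row (D : List ℕ+) (m : ℕ+) (q : Bool) (I : List ℕ+) :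
    (row D m q I).map PNum.num = D ++ m :: I := by simp [row]

@[simp] theorem row_length (D : List ℕ+) (m : ℕ+) (q : Bool) (I : List ℕ+) :
    (row D m q I).length = D.length + I.length + 1 := by simp [row]; omega

theorem row_reverse (D : List ℕ+) (m : ℕ+) (q : Bool) (I : List ℕ+) :
    (row D m q I).reverse = un I.reverse ++ ⟨m, q⟩ :: un D.reverse := by simp [row]

theorem RowOK.isHookWord {D I : List ℕ+} {m : ℕ+} (h : RowOK D m I) :
    IsHookWord (D ++ m :: I) := by
  refine ⟨D.length + 1, by simp, ?_, ?_⟩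
  · rw [List.take_append]
    simp only [List.take_of_length_le (Nat.le_succ D.length), Nat.add_sub_cancel_left,
      List.take_succ_cons, List.take_zero, List.pairwise_append, List.pairwise_singleton,
      List.mem_singleton]
    exact ⟨h.dec, trivial, fun y hy z hz => hz ▸ h.le_dec y hy⟩
  · simp only [Nat.add_sub_cancel, List.drop_left]
    exact List.pairwise_cons.2 ⟨h.lt_inc, h.inc⟩

/-- After an ascent a hook word has entered its increasing part and stays there. -/
theorem IsHookWord.lt_of_sublist {u : List ℕ+} (h : IsHookWord u) {a b c : ℕ+}
    (hs : [a, b, c].Sublist u) (hab : a < b) : b < c := by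
  obtain ⟨k, -, h1, h2⟩ := h
  rw [← List.take_append_drop k u] at hs
  have h3 : (u.drop k).Pairwise (· < ·) :=
    h2.sublist (List.drop_sublist_drop_left u (Nat.sub_le k 1))
  obtain ⟨l1, l2, e, hl1, hl2⟩ := List.sublist_append_iff.1 hs
  match l1, e with
  | [], e => 
    simp at e; subst e
    have := h3.sublist hl2
    simp at this; exact this.2
  | [x], e =>
    simp at e; obtain ⟨rfl, rfl⟩ := e
    have := h3.sublist hl2
    simpa using this
  | x :: y :: l, e =>
    simp at e; obtain ⟨rfl, rfl, -⟩ := e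
    have := h1.sublist hl1
    simp at this
    exact absurd hab this.1.1.not_gt

theorem decPart_row {D I : List ℕ+} {m : ℕ+} (h : RowOK D m I) :
    decPart (D ++ m :: I) = D ++ [m] := by
  obtain ⟨h1, h2, h3, -⟩ := h
  induction D with
  | nil =>
    cases I with
    | nil => rfl
    | cons y I => simp [decPart, (h3 y (by simp)).not_ge]
  | cons d D ih =>
    rw [List.pairwise_cons] at h1
    have ih := ih h1.2 fun y hy => h2 y (by simp [hy])
    cases D with
    | nil => simpa [decPart, h2 d (by simp)] using ih
    | cons d' D =>
      have : d' ≤ d := h1.1 d' (by simp)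
      simpa [decPart, this] using ih

theorem incPart_row {D I : List ℕ+} {m : ℕ+} (h : RowOK D m I) : incPart (D ++ m :: I) = I := by
  rw [incPart, decPart_row h, List.append_cons D m I, List.drop_left]

theorem midIdx_row {D I : List ℕ+} {m : ℕ+} (h : RowOK D m I) :
    midIdx (D ++ m :: I) = D.length := by
  simp [midIdx, decPart_row h]

theorem midPrimed_row {D I : List ℕ+} {m : ℕ+} (q : Bool) (h : RowOK D m I) :
    midPrimed (row D m q I) = q := by
  rw [midPrimed, map_num_row, midIdx_row h]
  simp [row]

theorem primeAt_row (D I : List ℕ+) (m : ℕ+) (q : Bool) :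
    primeAt (D ++ m :: I) D.length q = row D m q I := by
  simp only [primeAt, row, un, List.mapIdx_append, List.mapIdx_cons]
  congr 1
  · apply List.ext_getElem (by simp)
    intro j h1 h2
    simp only [List.length_mapIdx] at h1
    simp [h1.ne]
  · congr 1
    · simp
    · apply List.ext_getElem (by simp)
      intro j h1 h2
      simp

theorem replaceFirst_eq (P : ℕ+ → Prop) [DecidablePred P] (a y : ℕ+) (l1 l2 : List ℕ+)
    (h1 : ∀ z ∈ l1, ¬ P z) (hy : P y) :
    replaceFirst P a (l1 ++ y :: l2) = some (y, l1 ++ a :: l2) := by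
  induction l1 with
  | nil => simp [replaceFirst, hy]
  | cons z l1 ih =>
    simp [replaceFirst, h1 z (by simp), ih fun z hz => h1 z (by simp [hz])]

/-- The possible outcomes of inserting `⟨x, p⟩` into `row D m q I`: the new row and the bumped
letter. -/
inductive RowIns (D : List ℕ+) (m : ℕ+) (q : Bool) (I : List ℕ+) (x : ℕ+) (p : Bool) :
    List ℕ+ → ℕ+ → Bool → List ℕ+ → Option PNum → Prop
  | add_inc : m < x → (∀ y ∈ I, y < x) → RowIns D m q I x p D m q (I ++ [x]) none
  | add_dec : I = [] → x ≤ m → RowIns D m q I x p (D ++ [m]) x p [] none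
  | bump_mid (I1 I2 t : List ℕ+) (b h : ℕ+) : I = I1 ++ b :: I2 → (∀ y ∈ I1, y < x) → x ≤ b →
      (∀ y ∈ D, b ≤ y) → I1 ++ [x] = h :: t →
      RowIns D m q I x p (D ++ [b]) h p (t ++ I2) (some ⟨m, q⟩)
  | bump_move (I2 D1 D2 : List ℕ+) (b c : ℕ+) : I = b :: I2 → x ≤ m →
      D = D1 ++ c :: D2 → (∀ y ∈ D1, b ≤ y) → c < b →
      RowIns D m q I x p (D1 ++ b :: (D2 ++ [m])) x p I2 (some ⟨c, q⟩)
  | bump_stay (I1 I2 D1 D2 : List ℕ+) (b c : ℕ+) : I = I1 ++ b :: I2 → (∀ y ∈ I1, y < x) → x ≤ b →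
      m < x → D = D1 ++ c :: D2 → (∀ y ∈ D1, b ≤ y) → c < b →
      RowIns D m q I x p (D1 ++ b :: D2) m q (I1 ++ x :: I2) (some ⟨c, p⟩)

theorem RowIns.rowOK {D D' I I' : List ℕ+} {m m' x : ℕ+} {q q' p : Bool} {o : Option PNum}
    (h : RowIns D m q I x p D' m' q' I' o) (hr : RowOK D m I) : RowOK D' m' I' := by
  obtain ⟨h1, h2, h3, h4⟩ := hr
  cases h with
  | add_inc hm hI =>
    refine ⟨h1, h2, ?_, ?_⟩
    · simp only [List.mem_append, List.mem_singleton]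
      rintro y (hy | rfl)
      exacts [h3 y hy, hm]
    · simp only [List.pairwise_append, List.pairwise_singleton, List.mem_singleton]
      exact ⟨h4, trivial, fun y hy z hz => hz ▸ hI y hy⟩
  | add_dec hI hx =>
    refine ⟨?_, ?_, by simp, .nil⟩
    · simp only [List.pairwise_append, List.pairwise_singleton, List.mem_singleton]
      exact ⟨h1, trivial, fun y hy z hz => hz ▸ h2 y hy⟩
    · simp only [List.mem_append, List.mem_singleton]
      rintro y (hy | rfl)
      exacts [hx.trans (h2 y hy), hx]
  | bump_mid I1 I2 t b _ hI hI1 hxb hD e =>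
    subst hI
    simp only [List.pairwise_append, List.pairwise_cons, List.mem_cons] at h4
    have h5 : (m' :: t).Pairwise (· < ·) ∧ ∀ y ∈ m' :: t, y ≤ x := by
      rw [← e]
      simp only [List.pairwise_append, List.pairwise_singleton, List.mem_singleton, List.mem_append]
      refine ⟨⟨h4.1, trivial, fun y hy z hz => hz ▸ hI1 y hy⟩, ?_⟩
      rintro y (hy | rfl)
      exacts [(hI1 y hy).le, le_rfl]
    rw [List.pairwise_cons] at h5
    refine ⟨?_, ?_, ?_, ?_⟩
    · simp only [List.pairwise_append, List.pairwise_singleton, List.mem_singleton]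
      exact ⟨h1, trivial, fun y hy z hz => hz ▸ hD y hy⟩
    · simp only [List.mem_append, List.mem_singleton]
      have hb : m' ≤ b := (h5.2 m' (by simp)).trans hxb
      rintro y (hy | rfl)
      exacts [hb.trans (hD y hy), hb]
    · simp only [List.mem_append]
      rintro y (hy | hy)
      · exact h5.1.1 y hy
      · exact ((h5.2 m' (by simp)).trans hxb).trans_lt (h4.2.1.1 y hy)
    · simp only [List.pairwise_append]
      exact ⟨h5.1.2, h4.2.1.2, fun y hy z hz =>
        ((h5.2 y (by simp [hy])).trans hxb).trans_lt (h4.2.1.1 z hz)⟩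
  | bump_move I2 D1 D2 b c hI hx hD hD1 hc =>
    subst hI hD
    simp only [List.pairwise_append, List.pairwise_cons, List.mem_cons, List.mem_append] at *
    refine ⟨?_, ?_, ?_, h4.2⟩
    · simp only [List.pairwise_append, List.pairwise_cons, List.mem_cons, List.mem_append,
        List.not_mem_nil, or_false]
      refine ⟨h1.1, ⟨?_, h1.2.1.2, ⟨by simp, .nil⟩, ?_⟩, ?_⟩
      · rintro y (hy | rfl)
        · exact (h1.2.1.1 y hy).trans hc.le
        · exact (h3 b (.inl rfl)).le
      · rintro y hy z rfl
        exact h2 y (by simp [hy])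
      · rintro y hy z (rfl | hz | rfl)
        · exact hD1 y hy
        · exact h1.2.2 y hy z (.inr hz)
        · exact h2 y (.inl hy)
    · simp only [List.mem_cons, List.mem_append, List.not_mem_nil, or_false]
      rintro y (hy | rfl | hy | rfl)
      · exact hx.trans (h2 y (.inl hy))
      · exact hx.trans (h3 y (.inl rfl)).le
      · exact hx.trans (h2 y (by simp [hy]))
      · exact hx
    · exact fun y hy => hx.trans_lt (h3 y (.inr hy))
  | bump_stay I1 I2 D1 D2 b c hI hI1 hxb hm hD hD1 hc =>
    subst hI hD
    simp only [List.pairwise_append, List.pairwise_cons, List.mem_cons, List.mem_append] at *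
    refine ⟨?_, ?_, ?_, ?_⟩
    · simp only [List.pairwise_append, List.pairwise_cons, List.mem_cons]
      refine ⟨h1.1, ⟨fun y hy => (h1.2.1.1 y hy).trans hc.le, h1.2.1.2⟩, ?_⟩
      rintro y hy z (rfl | hz)
      · exact hD1 y hy
      · exact h1.2.2 y hy z (.inr hz)
    · simp only [List.mem_cons, List.mem_append]
      rintro y (hy | rfl | hy)
      · exact h2 y (.inl hy)
      · exact (h3 y (by simp)).le
      · exact h2 y (by simp [hy])
    · simp only [List.mem_cons, List.mem_append]
      rintro y (hy | rfl | hy)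
      · exact h3 y (.inl hy)
      · exact hm
      · exact h3 y (by simp [hy])
    · simp only [List.pairwise_append, List.pairwise_cons, List.mem_cons]
      refine ⟨h4.1, ⟨fun y hy => hxb.trans_lt (h4.2.1.1 y hy), h4.2.1.2⟩, ?_⟩
      rintro y hy z (rfl | hz)
      · exact hI1 y hy
      · exact h4.2.2 y hy z (.inr hz)

theorem rowInsert_row {D D' I I' : List ℕ+} {m m' x : ℕ+} {c : Option ℕ+} (q p : Bool)
    (hr : RowOK D m I) (hr' : RowOK D' m' I')
    (h : unprimedRowInsert (D ++ m :: I) x = (D' ++ m' :: I', c)) :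
    rowInsert (row D m q I) ⟨x, p⟩ =
      if D'.length ≠ D.length then (row D' m' p I', c.map fun c => ⟨c, q⟩)
      else (row D' m' q I', c.map fun c => ⟨c, p⟩) := by
  rw [rowInsert]
  simp only [map_num_row, h, midIdx_row hr, midIdx_row hr', midPrimed_row q hr, primeAt_row]
  simp

theorem exists_first {P : ℕ+ → Prop} {l : List ℕ+} (h : ¬ ∀ y ∈ l, ¬ P y) :
    ∃ l1 b l2, l = l1 ++ b :: l2 ∧ (∀ y ∈ l1, ¬ P y) ∧ P b := by
  induction l with
  | nil => simp at h
  | cons x l ih =>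
    by_cases hx : P x
    · exact ⟨[], x, l, rfl, by simp, hx⟩
    · obtain ⟨l1, b, l2, rfl, h1, h2⟩ := ih fun h' => h (by simpa using ⟨hx, h'⟩)
      exact ⟨x :: l1, b, l2, rfl, by simpa using ⟨hx, h1⟩, h2⟩

theorem not_isHookWord_append {D I1 I2 : List ℕ+} {m b x : ℕ+} (hm : m < b) (hx : x ≤ b) :
    ¬ IsHookWord (D ++ m :: (I1 ++ b :: I2) ++ [x]) := by
  intro h
  refine (h.lt_of_sublist (a := m) (b := b) (c := x) ?_ hm).not_ge hx
  have h1 : [m, b, x].Sublist (m :: (I1 ++ b :: I2) ++ [x]) := by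
    refine List.Sublist.cons_cons _ ?_
    have h2 : ([b] ++ [x]).Sublist (I1 ++ b :: I2 ++ [x]) :=
      (List.singleton_sublist.2 (by simp)).append (.refl _)
    exact h2
  exact h1.trans (by rw [List.append_assoc]; exact List.sublist_append_right _ _)

/-- The middle element belongs to the decreasing part, so splitting `D ++ [m]` treats a bumped
middle element and a bumped entry of `D` alike. -/
theorem unprimedRowInsert_bump {D I1 I2 D1 D2 : List ℕ+} {m x b c : ℕ+}
    (hr : RowOK D m (I1 ++ b :: I2)) (hI1 : ∀ y ∈ I1, y < x) (hx : x ≤ b)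
    (hD : D ++ [m] = D1 ++ c :: D2) (hD1 : ∀ y ∈ D1, b ≤ y) (hc : c < b) :
    unprimedRowInsert (D ++ m :: (I1 ++ b :: I2)) x = (D1 ++ b :: D2 ++ (I1 ++ x :: I2), some c) := by
  rw [unprimedRowInsert, if_neg (not_isHookWord_append (hr.lt_inc b (by simp)) hx), incPart_row hr,
    decPart_row hr, replaceFirst_eq (fun b => x ≤ b) x b I1 I2 (fun z hz => (hI1 z hz).not_ge) hx]
  simp only
  rw [hD, replaceFirst_eq (fun c => c < b) b c D1 D2 (fun z hz => (hD1 z hz).not_gt) hc]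

/-- If no entry of `I` is at least `x`, a box is added. Otherwise an entry `b` of `I` is replaced,
and since `m < b` the second replacement always succeeds. The fallback branches of the definition
are therefore never taken. -/
theorem rowInsert_spec {D I : List ℕ+} {m : ℕ+} (q : Bool) (x : ℕ+) (p : Bool)
    (hr : RowOK D m I) : ∃ D' m' q' I' o, RowIns D m q I x p D' m' q' I' o ∧
      rowInsert (row D m q I) ⟨x, p⟩ = (row D' m' q' I', o) := by
  by_cases hI : ∀ y ∈ I, ¬ x ≤ y
  · by_cases hm : m < x
    · have hi := RowIns.add_inc (D := D) (q := q) (p := p) hm fun y hy => not_le.1 (hI y hy)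
      refine ⟨_, _, _, _, _, hi, ?_⟩
      have hr' := hi.rowOK hr
      rw [rowInsert_row (c := none) q p hr hr']
      · simp
      · have := hr'.isHookWord
        rw [unprimedRowInsert, if_pos (by simpa using this)]
        simp
    · rw [not_lt] at hm
      obtain rfl : I = [] := by
        cases I with
        | nil => rfl
        | cons y I => exact absurd (hm.trans (hr.lt_inc y (by simp)).le) (hI y (by simp))
      have hi := RowIns.add_dec (D := D) (I := []) (q := q) (p := p) rfl hm
      refine ⟨_, _, _, _, _, hi, ?_⟩
      have hr' := hi.rowOK hr
      rw [rowInsert_row (c := none) q p hr hr']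
      · simp
      · have := hr'.isHookWord
        rw [unprimedRowInsert, if_pos (by simpa using this)]
  · obtain ⟨I1, b, I2, rfl, hI1, hb⟩ := exists_first hI
    have hI1' : ∀ y ∈ I1, y < x := fun y hy => not_le.1 (hI1 y hy)
    have hmb := hr.lt_inc b (by simp)
    by_cases hD : ∀ y ∈ D, ¬ y < b
    · have hD' : ∀ y ∈ D, b ≤ y := fun y hy => not_lt.1 (hD y hy)
      obtain ⟨h, t, e⟩ : ∃ h t, I1 ++ [x] = h :: t := by cases I1 <;> simp
      have hi := RowIns.bump_mid (q := q) (p := p) (m := m) I1 I2 t b h rfl hI1' hb hD' e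
      refine ⟨_, _, _, _, _, hi, ?_⟩
      have hr' := hi.rowOK hr
      rw [rowInsert_row (c := some m) q p hr hr']
      · simp
      · rw [unprimedRowInsert_bump hr hI1' hb rfl hD' hmb]
        have : I1 ++ x :: I2 = (I1 ++ [x]) ++ I2 := by simp
        simp [this, e]
    · obtain ⟨D1, c, D2, rfl, hD1, hc⟩ := exists_first hD
      have hD1' : ∀ y ∈ D1, b ≤ y := fun y hy => not_lt.1 (hD1 y hy)
      by_cases hm : x ≤ m
      · obtain rfl : I1 = [] := by
          cases I1 with
          | nil => rfl
          | cons y I1 =>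
            exact absurd (hm.trans (hr.lt_inc y (by simp)).le) (hI1' y (by simp)).not_ge
        have hi := RowIns.bump_move (m := m) (q := q) (p := p) (x := x) I2 D1 D2 b c rfl hm rfl hD1' hc
        refine ⟨_, _, _, _, _, hi, ?_⟩
        have hr' := hi.rowOK hr
        rw [rowInsert_row (c := some c) q p hr hr']
        · simp
        · have := unprimedRowInsert_bump (I1 := []) (D2 := D2 ++ [m]) hr hI1' hb
            (by simp) hD1' hc
          rw [List.nil_append] at this ⊢
          rw [this]
          simp
      · have hi := RowIns.bump_stay (q := q) (p := p) (x := x) I1 I2 D1 D2 b c rfl hI1' hb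
          (not_le.1 hm) rfl hD1' hc
        refine ⟨_, _, _, _, _, hi, ?_⟩
        have hr' := hi.rowOK hr
        rw [rowInsert_row (c := some c) q p hr hr']
        · simp
        · have := unprimedRowInsert_bump (D2 := D2 ++ [m]) hr hI1' hb
            (by simp) hD1' hc
          rw [this]
          simp

theorem rowInsert_nil (x : PNum) : rowInsert [] x = (row [] x.num x.primed [], none) := by
  have : IsHookWord [x.num] := RowOK.isHookWord (D := []) (I := []) ⟨.nil, by simp, by simp, .nil⟩
  simp [rowInsert, unprimedRowInsert, this, primeAt, midIdx, decPart, row]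

/-! ### Row insertion and the congruence -/

theorem dec_unprime_left (b a : ℕ+) (s p : Bool) (h : a < b) (R : List PNum) :
    Dec (⟨b, s⟩ :: ⟨a, p⟩ :: R) (⟨b, false⟩ :: ⟨a, p⟩ :: R) := by
  cases s
  · exact .refl _
  · exact ((DecRel.r2 a b p h).dec.append_right R).symm

theorem dec_unprime_right (a b : ℕ+) (p s : Bool) (h : a ≤ b) (R : List PNum) :
    Dec (⟨a, p⟩ :: ⟨b, s⟩ :: R) (⟨a, p⟩ :: ⟨b, false⟩ :: R) := by
  cases s
  · exact .refl _
  · exact ((DecRel.r1 a b p h).dec.append_right R).symm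

/-- The small letter `c` travels right through an increasing run. Each step needs the two preceding
letters as witnesses; the relation used is the ninth or the fourth according to whether `c` is below
`y`. -/
theorem dec_slide_small (y z c : ℕ+) (p q : Bool) (E : List ℕ+) (hcz : c < z) (hyz : y ≤ z)
    (hz : ∀ e ∈ E, z ≤ e) (hE : E.Pairwise (· ≤ ·)) :
    Dec (⟨y, p⟩ :: ⟨z, false⟩ :: ⟨c, q⟩ :: un E) (⟨y, p⟩ :: ⟨z, false⟩ :: (un E ++ [⟨c, q⟩])) := by
  induction E generalizing y z p with
  | nil => exact .refl _
  | cons e E ih =>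
    rw [List.pairwise_cons] at hE
    have hze := hz e (by simp)
    have h1 := (ih z e false (hcz.trans_le hze) hze hE.1 hE.2).cons ⟨y, p⟩
    refine Dec.trans ?_ h1
    rcases lt_or_ge c y with hcy | hcy
    · exact (DecRel.r9 c y z e p q hcy hyz hze).dec.symm.append_right (un E)
    · exact (DecRel.r4 y c z e p q hcy hcz hze).dec.symm.append_right (un E)

/-- The word with given absolute values of which only the first letter may be primed. -/
def prim (r : Bool) : List ℕ+ → List PNum
  | [] => []
  | e :: l => ⟨e, r⟩ :: un l

/-- By the third relation `b` travels right until it has passed the letters before `c`, pushing the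
prime `r` one letter ahead at each step. Then `c`, carrying that prime, moves to the end. -/
theorem dec_slide (y b c : ℕ+) (s r : Bool) (E1 E2 : List ℕ+) (hyb : y ≤ b) (hcb : c < b)
    (h1 : (E1 ++ [c]).Pairwise (· ≤ ·)) (hy : E1 ≠ [] → ∀ e ∈ E1, y ≤ e)
    (h2 : ∀ e ∈ E2, b ≤ e) (h3 : E2.Pairwise (· ≤ ·)) :
    Dec (⟨y, s⟩ :: ⟨b, false⟩ :: (prim r (E1 ++ [c]) ++ un E2))
      (⟨y, s⟩ :: (un E1 ++ ⟨b, false⟩ :: (un E2 ++ [⟨c, r⟩]))) := by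
  induction E1 generalizing y s with
  | nil => exact dec_slide_small y b c s r E2 hcb hyb h2 h3
  | cons e E1 ih =>
    have he := hy (by simp) e (by simp)
    rw [List.cons_append, List.pairwise_cons] at h1
    have hec : e ≤ c := h1.1 c (by simp)
    have ih := (ih e false (hec.trans hcb.le) h1.2 fun _ e' he' => h1.1 e' (by simp [he'])).cons
      ⟨y, s⟩
    refine Dec.trans ?_ ih
    cases E1 with
    | nil => exact (DecRel.r3 y e c b s r he hec hcb).dec.symm.append_right (un E2)
    | cons f E1 =>
      have hfc : f ≤ c := (List.pairwise_cons.1 h1.2).1 c (by simp)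
      exact (DecRel.r3 y e f b s r he (h1.1 f (by simp)) (hfc.trans_lt hcb)).dec.symm.append_right
        (un (E1 ++ [c]) ++ un E2)

/-- The inserted letter passes the entries of the increasing part beyond the entry `b` it will
replace. The letter `y` after `b` is only a witness: the relations involve four letters. -/
theorem dec_pass_large (x b : ℕ+) (y : PNum) (p : Bool) (J : List ℕ+) (R : List PNum)
    (hxb : x ≤ b) (hy : y.num < b) (hJ : (J ++ [b]).Pairwise (· > ·)) :
    Dec (⟨x, p⟩ :: (un J ++ ⟨b, false⟩ :: y :: R)) (un J ++ ⟨x, p⟩ :: ⟨b, false⟩ :: y :: R) := by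
  have key : ∀ (d c : ℕ+) (z : PNum) (S : List PNum), x ≤ c → c < d → z.num < c →
      Dec (⟨x, p⟩ :: ⟨d, false⟩ :: ⟨c, false⟩ :: z :: S)
        (⟨d, false⟩ :: ⟨x, p⟩ :: ⟨c, false⟩ :: z :: S) := by
    intro d c z S h1 h2 h3
    rcases lt_or_ge z.num x with h4 | h4
    · exact (DecRel.r8 z.num x c d p z.primed h4 h1 h2).dec.symm.append_right S
    · exact (DecRel.r5 x z.num c d p z.primed h4 h3 h2).dec.symm.append_right S
  induction J with
  | nil => exact .refl _
  | cons d J ih =>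
    rw [List.cons_append, List.pairwise_cons] at hJ
    refine Dec.trans ?_ ((ih hJ.2).cons ⟨d, false⟩)
    match J, hJ with
    | [], hJ => exact key d b y R hxb (hJ.1 b (by simp)) hy
    | [c], hJ =>
      have hbc : b < c := (List.pairwise_cons.1 hJ.2).1 b (by simp)
      exact key d c ⟨b, false⟩ (y :: R) (hxb.trans hbc.le) (hJ.1 c (by simp)) hbc
    | c :: c' :: J, hJ =>
      have hbc : b < c := (List.pairwise_cons.1 hJ.2).1 b (by simp)
      exact key d c ⟨c', false⟩ (un J ++ ⟨b, false⟩ :: y :: R) (hxb.trans hbc.le)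
        (hJ.1 c (by simp)) ((List.pairwise_cons.1 hJ.2).1 c' (by simp))

/-- By the seventh relation `b` passes the smaller entries of the increasing part, while the prime
of the inserted letter is handed on until it rests on the smallest of them. -/
theorem dec_pass_small (y b l : ℕ+) (z : PNum) (p : Bool) (J K : List ℕ+) (R : List PNum)
    (hyb : y ≤ b) (hJ : (y :: J).Pairwise (· > ·)) (hz : ∀ j ∈ J, z.num < j)
    (e : y :: J = K ++ [l]) :
    Dec (⟨y, p⟩ :: ⟨b, false⟩ :: (un J ++ z :: R)) (un K ++ ⟨l, p⟩ :: ⟨b, false⟩ :: z :: R) := by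
  induction J generalizing y K with
  | nil =>
    cases K with
    | nil => simp at e; subst e; exact .refl _
    | cons k K => simp at e
  | cons j J ih =>
    cases K with
    | nil => simp at e
    | cons k K =>
      simp only [List.cons_append, List.cons.injEq] at e
      obtain ⟨rfl, e⟩ := e
      have hjy : j < y := (List.pairwise_cons.1 hJ).1 j (by simp)
      have hJ' := (List.pairwise_cons.1 hJ).2
      refine Dec.trans ?_ ((ih j K (hjy.le.trans hyb) hJ' (fun i hi => hz i (by simp [hi]))
        e).cons ⟨y, false⟩)
      cases J with
      | nil => exact (DecRel.r7 z.num j y b p z.primed (hz j (by simp)) hjy hyb).dec.symm.append_right R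
      | cons i J =>
        exact (DecRel.r7 i j y b p false ((List.pairwise_cons.1 hJ').1 i (by simp)) hjy
          hyb).dec.symm.append_right (un J ++ z :: R)

/-- The letter `b` crosses the middle element, and the prime `p` jumps over it to the first letter
of `E`; this is how the bumped entry comes to inherit the prime of the inserted letter. -/
theorem dec_pass_mid (l b m : ℕ+) (p q : Bool) (E R : List ℕ+) (hml : m < l) (hlb : l ≤ b)
    (hE : ∀ e ∈ E, m ≤ e ∧ e < b) (hne : E ≠ []) :
    Dec (⟨l, p⟩ :: ⟨b, false⟩ :: ⟨m, q⟩ :: (un E ++ un R))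
      (⟨l, false⟩ :: ⟨m, q⟩ :: ⟨b, false⟩ :: (prim p E ++ un R)) := by
  cases E with
  | nil => exact absurd rfl hne
  | cons e E =>
    obtain ⟨h1, h2⟩ := hE e (by simp)
    rcases le_or_gt l e with h | h
    · exact (DecRel.r6 m l e b q p hml h h2).dec.symm.append_right (un E ++ un R)
    · exact (DecRel.r10 m e l b q p h1 h hlb).dec.symm.append_right (un E ++ un R)

/-- Rows are read from right to left, so `x` enters at the large end. It settles at its place, then
`b` moves on to its place in the decreasing part, and then the bumped letter goes to the far end,
ready for the next row. The primes follow as the insertion rule prescribes. -/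
theorem RowIns.dec {D D' I I' : List ℕ+} {m m' x : ℕ+} {q q' p : Bool} {o : Option PNum}
    (h : RowIns D m q I x p D' m' q' I' o) (hr : RowOK D m I) :
    Dec (⟨x, p⟩ :: (row D m q I).reverse) ((row D' m' q' I').reverse ++ o.toList) := by
  obtain ⟨h1, h2, h3, h4⟩ := hr
  simp only [row_reverse]
  cases h with
  | add_inc hm hI =>
    simp only [List.reverse_append, List.reverse_cons, List.reverse_nil, List.nil_append,
      Option.toList_none, List.append_nil, List.cons_append, un_cons]
    rcases I.eq_nil_or_concat with rfl | ⟨I, i, rfl⟩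
    · exact dec_unprime_left x m p q hm _
    · simp only [List.concat_eq_append, List.reverse_append, List.reverse_cons, List.reverse_nil,
        List.nil_append, List.cons_append, un_cons]
      exact dec_unprime_left x i p false (hI i (by simp)) _
  | add_dec hI hx =>
    subst hI
    simpa using dec_unprime_right m' m q' q hx (un D.reverse)
  | bump_mid I1 I2 t b _ hI hI1 hxb hD e =>
    subst hI
    have h5 : (b :: I2).reverse.Pairwise (· > ·) :=
      List.pairwise_reverse.2 (List.pairwise_append.1 h4).2.1
    have h6 : (x :: I1.reverse).Pairwise (· > ·) := by
      rw [List.pairwise_cons]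
      exact ⟨fun y hy => hI1 y (List.mem_reverse.1 hy),
        List.pairwise_reverse.2 (List.pairwise_append.1 h4).1⟩
    have e' : x :: I1.reverse = t.reverse ++ [m'] := by
      have := congrArg List.reverse e
      simpa using this
    have hl : m' ≤ b := by
      have : m' ∈ I1 ++ [x] := by rw [e]; simp
      simp only [List.mem_append, List.mem_singleton] at this
      rcases this with h | rfl
      exacts [(hI1 m' h).le.trans hxb, hxb]
    have hmb := h3 b (by simp)
    -- The witness after `b` is whichever letter comes next, an entry of `I1` or the middle element.
    have s1 := dec_pass_large x b ((un I1.reverse ++ ⟨m, q⟩ :: un D.reverse).head (by simp)) q'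
      I2.reverse (un I1.reverse ++ ⟨m, q⟩ :: un D.reverse).tail hxb (by
        rcases I1.eq_nil_or_concat with rfl | ⟨I, i, rfl⟩
        · simpa using hmb
        · simpa using (hI1 i (by simp)).trans_le hxb) (by simpa using h5)
    rw [List.cons_head_tail] at s1
    have s2 := (dec_pass_small x b m' ⟨m, q⟩ q' I1.reverse t.reverse (un D.reverse) hxb h6
      (fun j hj => h3 j (by simp at hj; simp [hj])) e').append_left (un I2.reverse)
    have s3 := (dec_slide_small m' b m q' q D.reverse hmb hl (by simpa using hD)
      (List.pairwise_reverse.2 h1)).append_left (un I2.reverse ++ un t.reverse)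
    simp only [List.reverse_append, List.reverse_cons, List.reverse_nil, List.nil_append, un_append,
      un_cons, un_nil, List.append_assoc, List.cons_append, Option.toList_some] at s1 s2 s3 ⊢
    exact s1.trans (s2.trans s3)
  | bump_move _ D1 D2 b c hI hx hD hD1 hc =>
    subst hI hD
    have h5 : (b :: I').reverse.Pairwise (· > ·) := List.pairwise_reverse.2 h4
    have hmb := h3 b (by simp)
    have h1' : (D1 ++ (c :: D2) ++ [m]).Pairwise (· ≥ ·) := by
      simp only [List.pairwise_append, List.pairwise_singleton, List.mem_singleton]
      exact ⟨List.pairwise_append.1 h1, trivial, fun y hy z hz => hz ▸ h2 y hy⟩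
    have s1 := dec_pass_large m' b ⟨m, q⟩ q' I'.reverse (un (D1 ++ c :: D2).reverse)
      (hx.trans hmb.le) hmb (by simpa using h5)
    have s2 := (dec_slide m' b c q' q (m :: D2.reverse) D1.reverse (hx.trans hmb.le) hc (by
        have := List.pairwise_reverse.2 (h1'.sublist (l₁ := (c :: D2) ++ [m]) (by simp))
        simpa using this) (fun _ e he => by
        simp only [List.mem_cons, List.mem_reverse] at he
        rcases he with rfl | he
        exacts [hx, hx.trans (h2 e (by simp [he]))]) (by simpa using hD1)
      (List.pairwise_reverse.2 (List.pairwise_append.1 h1).1)).append_left (un I'.reverse)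
    simp only [List.reverse_append, List.reverse_cons, List.reverse_nil, List.nil_append, un_append,
      un_cons, un_nil, List.append_assoc, List.cons_append, Option.toList_some, prim] at s1 s2 ⊢
    exact s1.trans s2
  | bump_stay I1 I2 D1 D2 b c hI hI1 hxb hm hD hD1 hc =>
    subst hI hD
    have h5 : (b :: I2).reverse.Pairwise (· > ·) :=
      List.pairwise_reverse.2 (List.pairwise_append.1 h4).2.1
    have h6 : (x :: I1.reverse).Pairwise (· > ·) := by
      rw [List.pairwise_cons]
      exact ⟨fun y hy => hI1 y (List.mem_reverse.1 hy),
        List.pairwise_reverse.2 (List.pairwise_append.1 h4).1⟩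
    obtain ⟨K, l, e⟩ : ∃ K l, x :: I1.reverse = K ++ [l] := by
      rcases I1 with _ | ⟨i, I1⟩
      · exact ⟨[], x, rfl⟩
      · exact ⟨x :: I1.reverse, i, by simp⟩
    have hl : l ∈ x :: I1.reverse := by rw [e]; simp
    simp only [List.mem_cons, List.mem_reverse] at hl
    have hlb : l ≤ b := by
      rcases hl with rfl | hl
      exacts [hxb, (hI1 l hl).le.trans hxb]
    have hml : m < l := by
      rcases hl with rfl | hl
      exacts [hm, h3 l (by simp [hl])]
    have hmb := h3 b (by simp)
    have s1 := dec_pass_large x b ((un I1.reverse ++ ⟨m, q⟩ :: un (D1 ++ c :: D2).reverse).head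
      (by simp)) p I2.reverse (un I1.reverse ++ ⟨m, q⟩ :: un (D1 ++ c :: D2).reverse).tail hxb (by
        rcases I1.eq_nil_or_concat with rfl | ⟨I, i, rfl⟩
        · simpa using hmb
        · simpa using (hI1 i (by simp)).trans_le hxb) (by simpa using h5)
    rw [List.cons_head_tail] at s1
    have s2 := (dec_pass_small x b l ⟨m, q⟩ p I1.reverse K (un (D1 ++ c :: D2).reverse) hxb h6
      (fun j hj => h3 j (by simp at hj; simp [hj])) e).append_left (un I2.reverse)
    have h7 := (List.pairwise_append.1 h1).2.1
    have s3 := (dec_pass_mid l b m p q (D2.reverse ++ [c]) D1.reverse hml hlb (by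
        simp only [List.mem_append, List.mem_reverse, List.mem_singleton]
        rintro y (hy | rfl)
        · exact ⟨h2 y (by simp [hy]), ((List.pairwise_cons.1 h7).1 y hy).trans_lt hc⟩
        · exact ⟨h2 y (by simp), hc⟩) (by simp)).append_left (un I2.reverse ++ un K)
    have s4 := (dec_slide m b c q p D2.reverse D1.reverse hmb.le hc (by
        simpa using List.pairwise_reverse.2 h7) (fun _ e he => h2 e (by simp at he; simp [he]))
      (by simpa using hD1) (List.pairwise_reverse.2 (List.pairwise_append.1 h1).1)).append_left
      (un I2.reverse ++ un (K ++ [l]))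
    have e' : un K ++ [⟨l, false⟩] = ⟨x, false⟩ :: un I1.reverse := by
      have := congrArg un e
      simpa using this.symm
    have s5 := s1.trans (s2.trans (by
      simpa only [List.reverse_append, List.reverse_cons, List.append_assoc, List.cons_append,
        List.nil_append, un_append, un_cons, un_nil] using s3))
    have s6 : Dec _ _ := s5.trans (by
      simpa only [List.reverse_append, List.reverse_cons, List.append_assoc, List.cons_append,
        List.nil_append, un_append, un_cons, un_nil] using s4)
    rw [List.append_cons (un K), e'] at s6
    simp only [List.reverse_append, List.reverse_cons, List.reverse_nil, List.nil_append, un_append,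
      un_cons, un_nil, List.append_assoc, List.cons_append, Option.toList_some] at s6 ⊢
    exact s6

/-! ### Decomposition tableaux -/

/-- The reading word of a tableau. -/
def read : Tableau → List PNum
  | [] => []
  | r :: T => r.reverse ++ read T

@[simp] theorem read_nil : read [] = [] := rfl
theorem read_cons (r : List PNum) (T : Tableau) : read (r :: T) = r.reverse ++ read T := rfl

/-- Hook words with possibly a prime on the middle element. -/
def ValidRow (r : List PNum) : Prop := ∃ D m q I, r = row D m q I ∧ RowOK D m I

/-- Decomposition tableaux: each row is a longest hook subword of the word read from this row and
the following ones. -/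
inductive DT : Tableau → Prop
  | nil : DT []
  | cons {r : List PNum} {T : Tableau} : ValidRow r → HB (read (r :: T)) r.length → DT T →
      DT (r :: T)

theorem HookList.of_cons {x : ℕ+} {l : List ℕ+} (h : HookList (x :: l)) : HookList l := by
  rcases HookList.split (lA := []) h with ⟨c, e, rfl, hd, he⟩ | ⟨d, c, h1, hd, he⟩
  · exact ⟨c, e, rfl, (List.pairwise_cons.1 hd).2, he⟩
  · have := (List.pairwise_append.1 he).2.1
    exact ⟨[], l, rfl, .nil, (List.pairwise_cons.1 this).2⟩

theorem HB.cons {w : List PNum} {k : ℕ} (h : HB w k) (x : PNum) : HB (x :: w) (k + 1) := by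
  intro l hl hh
  rw [List.map_cons] at hl
  rcases List.sublist_cons_iff.1 hl with h1 | ⟨l, rfl, h1⟩
  · exact (h l h1 hh).trans (Nat.le_succ k)
  · exact Nat.succ_le_succ (h l h1 hh.of_cons)

/-- When `x` bumps, the last entry `d` of the row satisfies `x ≤ d`. A hook subword starting with
the new `x` can then be exchanged for an at least equally long one of the old word, so the bound
does not grow. -/
theorem HB.cons_of_bump {d x m : ℕ+} {J E Y : List ℕ+} {w w' : List PNum}
    (hw : w.map PNum.num = (d :: J) ++ m :: E ++ Y) (hw' : w'.map PNum.num = x :: w.map PNum.num)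
    (hx : x ≤ d) (hJ : (d :: J ++ [m]).Pairwise (· > ·))
    (h : HB w (J.length + E.length + 2)) : HB w' (J.length + E.length + 2) := by
  intro l hl hh
  rw [hw'] at hl
  rcases List.sublist_cons_iff.1 hl with h1 | ⟨l, rfl, h1⟩
  · exact h l h1 hh
  clear hl
  rename' h1 => hl
  by_contra hlen
  rw [not_le] at hlen
  by_cases hfirst : ∃ y l', l = y :: l' ∧ y < x
  -- If the second letter lies below `x`, it also lies below `d`, and `d` replaces `x`.
  · obtain ⟨y, l', rfl, hyx⟩ := hfirst
    have hl' : (d :: y :: l').Sublist (w.map PNum.num) := by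
      rw [hw] at hl ⊢
      rcases List.sublist_cons_iff.1 hl with hl | ⟨l', e, -⟩
      · exact hl.cons_cons _
      · simp only [List.cons.injEq] at e
        exact absurd (e.1 ▸ hx) hyx.not_ge
    refine hlen.not_ge (show (d :: y :: l').length ≤ _ from h _ hl' ?_)
    rcases HookList.split (lA := []) hh with ⟨c, e, h1, hd, he⟩ | ⟨d', c, h1, hd, he⟩
    · refine ⟨d :: c, e, by simp [h1], ?_, he⟩
      simp only [List.nil_append, List.pairwise_cons] at hd ⊢
      exact ⟨fun z hz => (hd.1 z hz).trans_le hx, hd.2⟩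
    · have := (List.pairwise_append.1 he).2.1
      exact absurd ((List.pairwise_cons.1 this).1 y (by simp)) hyx.not_ge
  · have hinc : l.Pairwise (· ≤ ·) := by
      rcases HookList.split (lA := []) hh with ⟨c, e, rfl, hd, he⟩ | ⟨d', c, h1, hd, he⟩
      · cases c with
        | nil => exact he
        | cons y c =>
          exact absurd ⟨y, c ++ e, rfl, (List.pairwise_cons.1 hd).1 y (by simp)⟩ hfirst
      · have := (List.pairwise_append.1 he).2.1
        exact (List.pairwise_cons.1 this).2
    rw [hw, List.append_cons (d :: J), List.append_assoc] at hl
    obtain ⟨g, l2, rfl, hg, hl2⟩ := List.sublist_append_iff.1 hl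
    have hg1 : g.length ≤ 1 := by
      have h1 := hJ.sublist hg
      have h2 := (List.pairwise_append.1 hinc).1
      match g, h1, h2 with
      | [], _, _ => simp
      | [_], _, _ => simp
      | a :: b :: g, h1, h2 =>
        exact absurd ((List.pairwise_cons.1 h1).1 b (by simp))
          ((List.pairwise_cons.1 h2).1 b (by simp)).not_gt
    -- Otherwise the subword increases and meets the decreasing segment from `d` to `m` at most
    -- once. Trading `x` and that letter for the descent `d, m` loses no length.
    have h1 : ([d, m] ++ l2).Sublist (w.map PNum.num) := by
      rw [hw, List.append_cons (d :: J), List.append_assoc]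
      refine List.Sublist.append ?_ hl2
      exact List.Sublist.cons_cons _ (by simp)
    have h2 := h _ h1 ⟨[d, m], l2, rfl, by simpa using (List.pairwise_cons.1 hJ).1 m (by simp),
      (List.pairwise_append.1 hinc).2.1⟩
    simp only [List.length_append, List.length_cons, List.length_nil] at h2 hlen
    omega

theorem DT.rowInsert_some {r r' : List PNum} {x y : PNum} {T : Tableau} (h : DT (r :: T))
    (hx : rowInsert r x = (r', some y)) :
    ValidRow r' ∧ r'.length = r.length ∧ Dec (x :: r.reverse) (r'.reverse ++ [y]) ∧
      HB (x :: read (r :: T)) r.length := by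
  cases h with
  | cons hr hb hT =>
  obtain ⟨D, m, q, I, rfl, hr⟩ := hr
  obtain ⟨D', m', q', I', o, hi, e⟩ := rowInsert_spec q x.num x.primed hr
  have hx' : rowInsert (row D m q I) x = (row D' m' q' I', o) := e
  rw [hx] at hx'
  simp only [Prod.mk.injEq] at hx'
  obtain ⟨rfl, ho⟩ := hx'
  subst ho
  refine ⟨⟨_, _, _, _, rfl, hi.rowOK hr⟩, ?_, hi.dec hr, ?_⟩
  · cases hi with
    | bump_mid I1 I2 t b _ hI hI1 hxb hD ht =>
      have := congrArg List.length ht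
      subst hI
      simp at this ⊢
      omega
    | bump_move => subst_vars; simp; omega
    | bump_stay => subst_vars; simp
  -- The last entry of the increasing part is at least the replaced entry `b`, which is at least the
  -- inserted letter.
  · obtain ⟨d, I0, hId, hxd⟩ : ∃ d I0, I = I0 ++ [d] ∧ x.num ≤ d := by
      have key : ∀ (I1 I2 : List ℕ+) (b : ℕ+), I = I1 ++ b :: I2 → x.num ≤ b →
          ∃ d I0, I = I0 ++ [d] ∧ x.num ≤ d := by
        intro I1 I2 b hI hb
        rcases I2.eq_nil_or_concat with rfl | ⟨I2, d, rfl⟩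
        · exact ⟨b, I1, hI, hb⟩
        · refine ⟨d, I1 ++ b :: I2, by simp [hI], hb.trans ?_⟩
          have := hr.inc
          rw [hI, List.pairwise_append, List.pairwise_cons] at this
          exact (this.2.1.1 d (by simp)).le
      have hmI : ∀ {b I2}, I = b :: I2 → x.num ≤ m → x.num ≤ b := fun h hx =>
        hx.trans (hr.lt_inc _ (by simp [h])).le
      cases hi with
      | bump_mid I1 I2 t b _ hI hI1 hxb hD e => exact key I1 I2 b hI hxb
      | bump_move _ D1 D2 b c hI hxm => exact key [] _ b hI (hmI hI hxm)
      | bump_stay I1 I2 D1 D2 b c hI hI1 hxb => exact key I1 I2 b hI hxb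
    subst hId
    have h1 : (row D m q (I0 ++ [d])).length = I0.reverse.length + D.reverse.length + 2 := by
      simp; omega
    rw [h1] at hb ⊢
    refine HB.cons_of_bump (d := d) (m := m) (J := I0.reverse) (E := D.reverse)
      (Y := (read T).map PNum.num) (w := read (row D m q (I0 ++ [d]) :: T)) (x := x.num) ?_ rfl hxd ?_ hb
    · simp [read_cons, row_reverse]
    · have h2 : (m :: (I0 ++ [d])).Pairwise (· < ·) := List.pairwise_cons.2 ⟨hr.lt_inc, hr.inc⟩
      simpa using List.pairwise_reverse.2 h2

theorem DT.rowInsert_none {r r' : List PNum} {x : PNum} (hr : ValidRow r)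
    (hx : rowInsert r x = (r', none)) :
    ValidRow r' ∧ r'.length = r.length + 1 ∧ Dec (x :: r.reverse) r'.reverse := by
  obtain ⟨D, m, q, I, rfl, hr⟩ := hr
  obtain ⟨D', m', q', I', o, hi, e⟩ := rowInsert_spec q x.num x.primed hr
  have hx' : rowInsert (row D m q I) x = (row D' m' q' I', o) := e
  rw [hx] at hx'
  simp only [Prod.mk.injEq] at hx'
  obtain ⟨rfl, ho⟩ := hx'
  subst ho
  refine ⟨⟨_, _, _, _, rfl, hi.rowOK hr⟩, ?_, by simpa using hi.dec hr⟩
  cases hi <;> subst_vars <;> simp; omega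

/-- Row length and bound rise together. If a box is added, both may grow by one; if an entry is
bumped, neither grows. The bound is first obtained for `x` followed by the old reading word and then
transported along the congruence. -/
theorem decInsert_spec (x : PNum) {T : Tableau} (h : DT T) :
    DT (decInsert x T) ∧ Dec (x :: read T) (read (decInsert x T)) := by
  induction T generalizing x with
  | nil =>
    rw [decInsert, rowInsert_nil]
    have : row [] x.num x.primed [] = [x] := by simp [row]
    refine ⟨.cons ⟨_, _, _, _, rfl, ⟨.nil, by simp, by simp, .nil⟩⟩ ?_ .nil, ?_⟩
    · intro l hl _
      have := hl.length_le
      simpa [read_cons, row] using this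
    · simp only [read_cons, this]
      exact .refl _
  | cons r T ih =>
    have hT : DT T := by cases h; assumption
    rw [decInsert]
    rcases hri : rowInsert r x with ⟨r', _ | y⟩
    · simp only
      cases h with
      | cons hr hb _ =>
      obtain ⟨h1, h2, h3⟩ := DT.rowInsert_none hr hri
      have h4 : Dec (x :: read (r :: T)) (read (r' :: T)) := h3.append_right (read T)
      refine ⟨.cons h1 ?_ hT, h4⟩
      rw [h2]
      exact h4.hb (hb.cons x)
    · simp only
      obtain ⟨h1, h2, h3, h4⟩ := h.rowInsert_some hri
      obtain ⟨h5, h6⟩ := ih y hT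
      have h7 : Dec (x :: read (r :: T)) (read (r' :: decInsert y T)) := by
        refine (h3.append_right (read T)).trans ?_
        rw [List.append_assoc]
        exact h6.append_left r'.reverse
      exact ⟨.cons h1 (h2 ▸ h7.hb h4) h5, h7⟩

theorem Pdec_spec (w : List PNum) : DT (Pdec w) ∧ Dec w (read (Pdec w)) := by
  induction w with
  | nil => exact ⟨.nil, .refl _⟩
  | cons x w ih =>
    have := decInsert_spec x ih.1
    exact ⟨this.1, (ih.2.cons x).trans this.2⟩

theorem dec_of_Pdec_eq {v w : List PNum} (h : Pdec v = Pdec w) : Dec v w :=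
  (Pdec_spec v).2.trans (h ▸ (Pdec_spec w).2.symm)

/-! ### Decomposition tableaux are closed under the crystal operators -/

/-- Hook words in reading order. -/
structure WordOK (J : List ℕ+) (m : ℕ+) (E : List ℕ+) : Prop where
  dec : J.Pairwise (· > ·)
  lt_dec : ∀ y ∈ J, m < y
  le_inc : ∀ y ∈ E, m ≤ y
  inc : E.Pairwise (· ≤ ·)

theorem validRow_reverse {u : List PNum} : ValidRow u.reverse ↔
    ∃ J m q E, u = un J ++ ⟨m, q⟩ :: un E ∧ WordOK J m E := by
  constructor
  · rintro ⟨D, m, q, I, e, h⟩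
    refine ⟨I.reverse, m, q, D.reverse, ?_, List.pairwise_reverse.2 h.inc, by simpa using h.lt_inc,
      by simpa using h.le_dec, List.pairwise_reverse.2 h.dec⟩
    rw [← row_reverse, ← e, List.reverse_reverse]
  · rintro ⟨J, m, q, E, rfl, h⟩
    refine ⟨E.reverse, m, q, J.reverse, ?_, List.pairwise_reverse.2 h.inc, by simpa using h.le_inc,
      by simpa using h.lt_dec, List.pairwise_reverse.2 h.dec⟩
    simp [row]

theorem ValidRow.word {r : List PNum} (h : ValidRow r) :
    ∃ J m q E, r.reverse = un J ++ ⟨m, q⟩ :: un E ∧ WordOK J m E :=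
  validRow_reverse.1 (by rwa [List.reverse_reverse])

theorem un_eq_append_cons {J : List ℕ+} {A B : List PNum} {y : PNum} (h : un J = A ++ y :: B) :
    ∃ J1 k J2, J = J1 ++ k :: J2 ∧ A = un J1 ∧ y = ⟨k, false⟩ ∧ B = un J2 := by
  obtain ⟨J1, J', rfl, rfl, h'⟩ := List.map_eq_append_iff.1 h
  obtain ⟨k, J2, rfl, rfl, rfl⟩ := List.map_eq_cons_iff.1 h'
  exact ⟨J1, k, J2, rfl, rfl, rfl, rfl⟩

theorem word_split {J E : List ℕ+} {x y : PNum} {A B : List PNum}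
    (h : un J ++ x :: un E = A ++ y :: B) :
    (∃ J1 k J2, J = J1 ++ k :: J2 ∧ A = un J1 ∧ y = ⟨k, false⟩ ∧ B = un J2 ++ x :: un E) ∨
    (A = un J ∧ y = x ∧ B = un E) ∨
    ∃ E1 k E2, E = E1 ++ k :: E2 ∧ A = un J ++ x :: un E1 ∧ y = ⟨k, false⟩ ∧ B = un E2 := by
  rcases List.append_eq_append_iff.1 h with ⟨c, rfl, hc⟩ | ⟨c, hJ, hc⟩
  · cases c with
    | nil => simp at hc; exact .inr (.inl ⟨by simp, hc.1.symm, hc.2.symm⟩)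
    | cons z c =>
      simp only [List.cons_append, List.cons.injEq] at hc
      obtain ⟨rfl, hc⟩ := hc
      obtain ⟨E1, k, E2, rfl, rfl, rfl, rfl⟩ := un_eq_append_cons hc
      exact .inr (.inr ⟨E1, k, E2, rfl, rfl, rfl, rfl⟩)
  · cases c with
    | nil => simp at hc hJ; exact .inr (.inl ⟨hJ.symm, hc.1, hc.2⟩)
    | cons z c =>
      simp only [List.cons_append, List.cons.injEq] at hc
      obtain ⟨rfl, rfl⟩ := hc
      obtain ⟨J1, k, J2, rfl, rfl, rfl, rfl⟩ := un_eq_append_cons hJ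
      exact .inl ⟨J1, k, J2, rfl, rfl, rfl, rfl⟩

/-- Together with its companion this describes the neighbours of the letter on which an operator
acts: `i` does not follow it and `i + 1` does not precede it. -/
theorem phi_head_ne {i : ℕ+} {B : List PNum} (h : phi i B = 0) {x : PNum} {B' : List PNum}
    (e : B = x :: B') : x.num ≠ i := by
  rintro rfl
  subst e
  simp [phi_cons, phiL] at h

theorem eps_last_ne {i : ℕ+} {A : List PNum} (h : eps i A = 0) {x : PNum} {A' : List PNum}
    (e : A = A' ++ [x]) : x.num ≠ i + 1 := by
  intro hx
  subst e
  simp [eps_append, eps_cons, epsL, hx] at h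

/-- Raising a value by one could only create a forbidden equality with a preceding `i + 1` in the
decreasing part, or a descent to a following `i` in the increasing part. The bracketing rule
excludes both neighbours. -/
theorem ValidRow.wF {i : ℕ+} {r u : List PNum} (hr : ValidRow r) (h : wF i r.reverse = some u) :
    ValidRow u.reverse := by
  obtain ⟨J, m, q, E, e0, h1, h2, h3, h4⟩ := hr.word
  obtain ⟨A, B, p, e', rfl, hA, hB⟩ := (wF_eq_some _ _ _).1 h
  rw [e0] at e'
  have hi : i < i + 1 := PNat.lt_add_one_iff.2 le_rfl
  have hlt : ∀ {y : ℕ+}, i < y → y ≠ i + 1 → i + 1 < y := fun h h' =>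
    lt_of_le_of_ne (PNat.add_one_le_iff.2 h) h'.symm
  rw [validRow_reverse]
  rcases word_split e' with ⟨J1, k, J2, rfl, rfl, e1, rfl⟩ | ⟨rfl, e1, rfl⟩ |
    ⟨E1, k, E2, rfl, rfl, e1, rfl⟩
  · simp only [PNum.mk.injEq] at e1
    obtain ⟨rfl, rfl⟩ := e1
    refine ⟨J1 ++ (i + 1) :: J2, m, q, E, by simp, ⟨?_, ?_, h3, h4⟩⟩
    · simp only [List.pairwise_append, List.pairwise_cons, List.mem_cons] at h1 ⊢
      refine ⟨h1.1, ⟨fun y hy => (h1.2.1.1 y hy).trans hi, h1.2.1.2⟩, ?_⟩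
      rintro y hy z (rfl | hz)
      · rcases J1.eq_nil_or_concat with rfl | ⟨J1, j, rfl⟩
        · simp at hy
        · have hj := eps_last_ne hA (x := ⟨j, false⟩) (A' := un J1) (by simp)
          have hj' : i + 1 < j := hlt (h1.2.2 j (by simp) i (.inl rfl)) hj
          simp only [List.concat_eq_append, List.mem_append, List.mem_singleton] at hy
          rcases hy with hy | rfl
          · have := h1.1
            simp only [List.concat_eq_append, List.pairwise_append, List.mem_singleton] at this
            exact hj'.trans (this.2.2 y hy j rfl)
          · exact hj'
      · exact h1.2.2 y hy z (.inr hz)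
    · simp only [List.mem_append, List.mem_cons] at h2 ⊢
      rintro y (hy | rfl | hy)
      · exact h2 y (.inl hy)
      · exact (h2 i (by simp)).trans hi
      · exact h2 y (by simp [hy])
  · simp only [PNum.mk.injEq] at e1
    obtain ⟨rfl, rfl⟩ := e1
    refine ⟨J, i + 1, p, E, by simp, ⟨h1, ?_, ?_, h4⟩⟩
    · intro y hy
      rcases J.eq_nil_or_concat with rfl | ⟨J1, j, rfl⟩
      · simp at hy
      · have hj := eps_last_ne hA (x := ⟨j, false⟩) (A' := un J1) (by simp)
        have hj' : i + 1 < j := hlt (h2 j (by simp)) hj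
        simp only [List.concat_eq_append, List.mem_append, List.mem_singleton] at hy
        rcases hy with hy | rfl
        · simp only [List.concat_eq_append, List.pairwise_append, List.mem_singleton] at h1
          exact hj'.trans (h1.2.2 y hy j rfl)
        · exact hj'
    · intro y hy
      cases E with
      | nil => simp at hy
      | cons e E =>
        have he := phi_head_ne hB (x := ⟨e, false⟩) (B' := un E) rfl
        have he' : i + 1 ≤ e := PNat.add_one_le_iff.2 (lt_of_le_of_ne (h3 e (by simp)) (Ne.symm he))
        rcases List.mem_cons.1 hy with rfl | hy
        · exact he'
        · exact he'.trans ((List.pairwise_cons.1 h4).1 y hy)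
  · simp only [PNum.mk.injEq] at e1
    obtain ⟨rfl, rfl⟩ := e1
    refine ⟨J, m, q, E1 ++ (i + 1) :: E2, by simp, ⟨h1, h2, ?_, ?_⟩⟩
    · simp only [List.mem_append, List.mem_cons] at h3 ⊢
      rintro y (hy | rfl | hy)
      · exact h3 y (.inl hy)
      · exact (h3 i (by simp)).trans hi.le
      · exact h3 y (by simp [hy])
    · simp only [List.pairwise_append, List.pairwise_cons, List.mem_cons] at h4 ⊢
      refine ⟨h4.1, ⟨?_, h4.2.1.2⟩, ?_⟩
      · intro y hy
        cases E2 with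
        | nil => simp at hy
        | cons e E2 =>
          have he := phi_head_ne hB (x := ⟨e, false⟩) (B' := un E2) rfl
          have he' : i + 1 ≤ e :=
            PNat.add_one_le_iff.2 (lt_of_le_of_ne (h4.2.1.1 e (by simp)) (Ne.symm he))
          rcases List.mem_cons.1 hy with rfl | hy
          · exact he'
          · exact he'.trans ((List.pairwise_cons.1 h4.2.1.2).1 y hy)
      · rintro y hy z (rfl | hz)
        · exact (h4.2.2 y hy i (.inl rfl)).trans hi.le
        · exact h4.2.2 y hy z (.inr hz)

theorem ValidRow.wE {i : ℕ+} {r u : List PNum} (hr : ValidRow r) (h : wE i r.reverse = some u) :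
    ValidRow u.reverse := by
  obtain ⟨J, m, q, E, e0, h1, h2, h3, h4⟩ := hr.word
  obtain ⟨A, B, p, e', rfl, hA, hB⟩ := (wE_eq_some _ _ _).1 h
  rw [e0] at e'
  have hi : i < i + 1 := PNat.lt_add_one_iff.2 le_rfl
  have hlt : ∀ {y : ℕ+}, y < i + 1 → y ≠ i → y < i := fun h h' =>
    lt_of_le_of_ne (PNat.lt_add_one_iff.1 h) h'
  have hle : ∀ {y : ℕ+}, y ≤ i + 1 → y ≠ i + 1 → y ≤ i := fun h h' =>
    PNat.lt_add_one_iff.1 (lt_of_le_of_ne h h')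
  rw [validRow_reverse]
  rcases word_split e' with ⟨J1, k, J2, rfl, rfl, e1, rfl⟩ | ⟨rfl, e1, rfl⟩ |
    ⟨E1, k, E2, rfl, rfl, e1, rfl⟩
  · simp only [PNum.mk.injEq] at e1
    obtain ⟨rfl, rfl⟩ := e1
    simp only [List.pairwise_append, List.pairwise_cons, List.mem_cons, List.mem_append] at h1 h2
    have hJ2 : (∀ y ∈ J2, y < i) ∧ m < i := by
      cases J2 with
      | nil =>
        exact ⟨by simp, hlt (h2 _ (.inr (.inl rfl))) (phi_head_ne hB (x := ⟨m, q⟩) rfl)⟩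
      | cons j J2 =>
        have hj : j < i := hlt (h1.2.1.1 j (by simp)) (phi_head_ne hB (x := ⟨j, false⟩) rfl)
        refine ⟨?_, (h2 j (by simp)).trans hj⟩
        simp only [List.mem_cons]
        rintro y (rfl | hy)
        · exact hj
        · exact ((List.pairwise_cons.1 h1.2.1.2).1 y hy).trans hj
    refine ⟨J1 ++ i :: J2, m, q, E, by simp, ⟨?_, ?_, h3, h4⟩⟩
    · simp only [List.pairwise_append, List.pairwise_cons, List.mem_cons]
      refine ⟨h1.1, ⟨hJ2.1, h1.2.1.2⟩, ?_⟩
      rintro y hy z (rfl | hz)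
      · exact hi.trans (h1.2.2 y hy _ (.inl rfl))
      · exact h1.2.2 y hy z (.inr hz)
    · simp only [List.mem_append, List.mem_cons]
      rintro y (hy | rfl | hy)
      · exact h2 y (.inl hy)
      · exact hJ2.2
      · exact h2 y (by simp [hy])
  · simp only [PNum.mk.injEq] at e1
    obtain ⟨rfl, rfl⟩ := e1
    exact ⟨J, i, p, E, by simp, ⟨h1, fun y hy => hi.trans (h2 y hy), fun y hy =>
      hi.le.trans (h3 y hy), h4⟩⟩
  · simp only [PNum.mk.injEq] at e1
    obtain ⟨rfl, rfl⟩ := e1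
    simp only [List.pairwise_append, List.pairwise_cons, List.mem_cons, List.mem_append] at h4 h3
    have hE1 : (∀ y ∈ E1, y ≤ i) ∧ m ≤ i := by
      rcases E1.eq_nil_or_concat with rfl | ⟨E1, e, rfl⟩
      · exact ⟨by simp, hle (h3 _ (by simp)) (eps_last_ne hA (x := ⟨m, q⟩) (A' := un J) (by simp))⟩
      · have he : e ≤ i := hle (h4.2.2 e (by simp) _ (.inl rfl))
          (eps_last_ne hA (x := ⟨e, false⟩) (A' := un J ++ ⟨m, q⟩ :: un E1) (by simp))
        refine ⟨?_, (h3 e (by simp)).trans he⟩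
        have h5 := h4.1
        simp only [List.concat_eq_append, List.pairwise_append, List.mem_singleton] at h5
        simp only [List.concat_eq_append, List.mem_append, List.mem_singleton]
        rintro y (hy | rfl)
        · exact (h5.2.2 y hy e rfl).trans he
        · exact he
    refine ⟨J, m, q, E1 ++ i :: E2, by simp, ⟨h1, h2, ?_, ?_⟩⟩
    · simp only [List.mem_append, List.mem_cons]
      rintro y (hy | rfl | hy)
      · exact h3 y (.inl hy)
      · exact hE1.2
      · exact h3 y (by simp [hy])
    · simp only [List.pairwise_append, List.pairwise_cons, List.mem_cons]
      refine ⟨h4.1, ⟨fun y hy => hi.le.trans (h4.2.1.1 y hy), h4.2.1.2⟩, ?_⟩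
      rintro y hy z (rfl | hz)
      · exact hE1.1 y hy
      · exact h4.2.2 y hy z (.inr hz)

/-! ### Reading words of a fixed shape -/

/-- The shape of a tableau: its row lengths. -/
def shape (T : Tableau) : List ℕ := T.map List.length

/-- The word `w` is read from a decomposition tableau of the given shape. -/
def IsRead (s : List ℕ) (w : List PNum) : Prop := ∃ T, DT T ∧ read T = w ∧ shape T = s

theorem isRead_cons {k : ℕ} {s : List ℕ} {u v : List PNum} (hu : ValidRow u.reverse)
    (hk : u.length = k) (hb : HB (u ++ v) k) (hv : IsRead s v) : IsRead (k :: s) (u ++ v) := by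
  obtain ⟨T, hT, rfl, rfl⟩ := hv
  refine ⟨u.reverse :: T, .cons hu ?_ hT, ?_, ?_⟩
  · simpa [read_cons, hk] using hb
  · simp [read_cons]
  · simp [shape, hk]

theorem IsRead.cases {k : ℕ} {s : List ℕ} {w : List PNum} (h : IsRead (k :: s) w) :
    ∃ u v, w = u ++ v ∧ ValidRow u.reverse ∧ u.length = k ∧ HB (u ++ v) k ∧ IsRead s v := by
  obtain ⟨T, hT, rfl, e⟩ := h
  cases hT with
  | nil => simp [shape] at e
  | @cons r T hr hb hT =>
    simp only [shape, List.map_cons, List.cons.injEq] at e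
    obtain ⟨rfl, rfl⟩ := e
    exact ⟨r.reverse, read T, rfl, by simpa using hr, by simp, by simpa [read_cons] using hb,
      T, hT, rfl, rfl⟩

theorem IsRead.nil {w : List PNum} (h : IsRead [] w) : w = [] := by
  obtain ⟨T, hT, rfl, e⟩ := h
  simp [shape] at e
  simp [e]

theorem wF_length {i : ℕ+} {w w' : List PNum} (h : wF i w = some w') : w'.length = w.length := by
  obtain ⟨A, B, p, rfl, rfl, -⟩ := (wF_eq_some _ _ _).1 h
  simp

theorem wE_length {i : ℕ+} {w w' : List PNum} (h : wE i w = some w') : w'.length = w.length :=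
  (wF_length ((wE_iff_wF _ _ _).1 h)).symm

theorem wFb_length {w w' : List PNum} (h : wFb w = some w') : w'.length = w.length := by
  obtain ⟨A, B, p, -, rfl, rfl⟩ := (wFb_eq_some _ _).1 h
  simp

theorem wEb_length {w w' : List PNum} (h : wEb w = some w') : w'.length = w.length :=
  (wFb_length ((wEb_iff_wFb _ _).1 h)).symm

/-- By the tensor rule the operator acts inside the first row or inside the rest. The first row
keeps its length, and `HB.wF` keeps it maximal among hook subwords. -/
theorem IsRead.wF {i : ℕ+} {s : List ℕ} {w w' : List PNum} (h : IsRead s w)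
    (hw : wF i w = some w') : IsRead s w' := by
  induction s generalizing w w' with
  | nil => simp [h.nil] at hw
  | cons k s ih =>
    obtain ⟨u, v, rfl, hu, hk, hb, hv⟩ := h.cases
    have hb' := hb.wF hw
    rw [wF_append] at hw
    split_ifs at hw with hc
    · obtain ⟨v', hv', rfl⟩ := Option.map_eq_some_iff.1 hw
      exact isRead_cons hu hk hb' (ih hv hv')
    · obtain ⟨u', hu', rfl⟩ := Option.map_eq_some_iff.1 hw
      exact isRead_cons (hu.wF (by rwa [List.reverse_reverse])) ((wF_length hu').trans hk) hb' hv

theorem IsRead.wE {i : ℕ+} {s : List ℕ} {w w' : List PNum} (h : IsRead s w)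
    (hw : wE i w = some w') : IsRead s w' := by
  induction s generalizing w w' with
  | nil => simp [h.nil] at hw
  | cons k s ih =>
    obtain ⟨u, v, rfl, hu, hk, hb, hv⟩ := h.cases
    have hb' := hb.wE hw
    rw [wE_append] at hw
    split_ifs at hw with hc
    · obtain ⟨v', hv', rfl⟩ := Option.map_eq_some_iff.1 hw
      exact isRead_cons hu hk hb' (ih hv hv')
    · obtain ⟨u', hu', rfl⟩ := Option.map_eq_some_iff.1 hw
      exact isRead_cons (hu.wE (by rwa [List.reverse_reverse])) ((wE_length hu').trans hk) hb' hv

theorem setp_of_ne {w : List PNum} (b : Bool) (h : ∀ x ∈ w, x.num ≠ 1) :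
    setp b w = w ∧ p0 w = none := by
  induction w with
  | nil => exact ⟨rfl, rfl⟩
  | cons x w ih =>
    have := ih fun y hy => h y (by simp [hy])
    simp [setp, p0, h x (by simp), this]

theorem un_num_ne {l : List ℕ+} {k : ℕ+} (h : ∀ y ∈ l, y ≠ k) : ∀ x ∈ un l, x.num ≠ k := by
  intro x hx
  obtain ⟨y, hy, rfl⟩ := List.mem_map.1 hx
  exact h y hy

/-- The middle element is the leftmost minimum in reading order, so the leftmost 1 of a row, if any,
is the one entry that may carry a prime. -/
theorem setp_word {J E : List ℕ+} {m : ℕ+} {q : Bool} (b : Bool) (h : WordOK J m E) :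
    setp b (un J ++ ⟨m, q⟩ :: un E) = un J ++ ⟨m, if m = 1 then b else q⟩ :: un E := by
  have hJ := setp_of_ne b (un_num_ne (l := J) (k := 1) fun y hy e =>
    not_lt_one (e ▸ h.lt_dec y hy))
  rw [setp_append, if_pos hJ.2, setp]
  by_cases hm : m = 1
  · simp [hm]
  · have hE := setp_of_ne b (un_num_ne (l := E) (k := 1) fun y hy e =>
      hm (le_one_iff_eq_one.1 (e ▸ h.le_inc y hy)))
    simp [hm, hE.1]

theorem ValidRow.setp {u : List PNum} (b : Bool) (h : ValidRow u.reverse) :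
    ValidRow (setp b u).reverse := by
  obtain ⟨J, m, q, E, rfl, h'⟩ := validRow_reverse.1 h
  rw [setp_word b h']
  exact validRow_reverse.2 ⟨J, m, _, E, rfl, h'⟩

theorem IsRead.setp {s : List ℕ} {w : List PNum} (h : IsRead s w) (b : Bool) :
    IsRead s (setp b w) := by
  induction s generalizing w with
  | nil => rw [h.nil]; exact ⟨[], .nil, rfl, rfl⟩
  | cons k s ih =>
    obtain ⟨u, v, rfl, hu, hk, hb, hv⟩ := h.cases
    have hb' := hb.setp b
    rw [setp_append] at hb' ⊢
    split_ifs at hb' ⊢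
    · exact isRead_cons hu hk hb' (ih hv)
    · exact isRead_cons (hu.setp b) (by simpa using hk) hb' hv

theorem eq_one_or_eq_two {k : ℕ+} (h : k ≤ 2) : k = 1 ∨ k = 2 := by
  rcases h.eq_or_lt with h | h
  · exact .inr h
  · exact .inl (le_one_iff_eq_one.1 (PNat.lt_add_one_iff.1 h))

theorem ValidRow.wFb {u u' : List PNum} (hu : ValidRow u.reverse) (h : wFb u = some u') :
    ValidRow u'.reverse := by
  obtain ⟨J, m, q, E, rfl, hJ⟩ := validRow_reverse.1 hu
  obtain ⟨A, B, p, hA, e, rfl⟩ := (wFb_eq_some _ _).1 h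
  rw [validRow_reverse]
  rcases word_split e with ⟨J1, k, J2, rfl, rfl, e1, rfl⟩ | ⟨rfl, e1, rfl⟩ |
    ⟨E1, k, E2, rfl, rfl, e1, rfl⟩
  · simp only [PNum.mk.injEq] at e1
    exact absurd (hJ.lt_dec k (by simp)) (e1.1 ▸ not_lt_one)
  · simp only [PNum.mk.injEq] at e1
    obtain ⟨rfl, rfl⟩ := e1
    have hJ2 : ∀ y ∈ J, 2 < y := by
      intro y hy
      by_contra hy2
      have hy3 := hA ⟨y, false⟩ (List.mem_map.2 ⟨y, hy, rfl⟩)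
      rcases eq_one_or_eq_two (not_lt.1 hy2) with rfl | rfl <;> simp at hy3
    -- If another 1 follows, the new 2 joins the decreasing part and that 1 becomes the middle
    -- element. The exchange of primes moves the prime onto exactly that letter.
    by_cases hE : ∃ E', E = 1 :: E'
    · obtain ⟨E, rfl⟩ := hE
      refine ⟨J ++ [2], 1, p, E, by simp [p0, QueerPlus.setp], ⟨?_, ?_, ?_, ?_⟩⟩
      · simp only [List.pairwise_append, List.pairwise_singleton, List.mem_singleton]
        exact ⟨hJ.dec, trivial, fun y hy z hz => hz ▸ hJ2 y hy⟩
      · simp only [List.mem_append, List.mem_singleton]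
        rintro y (hy | rfl)
        · exact hJ.lt_dec y hy
        · decide
      · exact fun y _ => one_le
      · exact (List.pairwise_cons.1 hJ.inc).2
    · have hE2 : ∀ y ∈ E, y ≠ 1 := by
        rintro y hy rfl
        cases E with
        | nil => simp at hy
        | cons e E =>
          apply hE
          rcases List.mem_cons.1 hy with rfl | hy
          · exact ⟨E, rfl⟩
          · have := (List.pairwise_cons.1 hJ.inc).1 1 hy
            exact ⟨E, by rw [le_one_iff_eq_one.1 this]⟩
      have hs := setp_of_ne p (un_num_ne hE2)
      refine ⟨J, 2, _, E, by rw [hs.1], ⟨hJ.dec, hJ2, ?_, hJ.inc⟩⟩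
      exact fun y hy => PNat.add_one_le_iff.2 (lt_of_le_of_ne one_le (hE2 y hy).symm)
  · simp only [PNum.mk.injEq] at e1
    have := hJ.le_inc k (by simp)
    rw [← e1.1, le_one_iff_eq_one] at this
    exact absurd this (hA ⟨m, q⟩ (by simp)).1

theorem ValidRow.wEb {u u' : List PNum} (hu : ValidRow u.reverse) (h : wEb u = some u') :
    ValidRow u'.reverse := by
  obtain ⟨J, m, q, E, rfl, hJ⟩ := validRow_reverse.1 hu
  obtain ⟨A, B, p, hA, e, rfl⟩ := (wEb_eq_some _ _).1 h
  rw [validRow_reverse]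
  rcases word_split e with ⟨J1, k, J2, rfl, rfl, e1, rfl⟩ | ⟨rfl, e1, rfl⟩ |
    ⟨E1, k, E2, rfl, rfl, e1, rfl⟩
  · simp only [PNum.mk.injEq] at e1
    obtain ⟨rfl, rfl⟩ := e1
    -- A 2 in the decreasing part forces the middle element to be 1 and the 2 to stand directly
    -- before it. After raising, the two letters 1 are adjacent and the left one is the new middle
    -- element.
    have hm : m = 1 := le_one_iff_eq_one.1 (PNat.lt_add_one_iff.1 (hJ.lt_dec 2 (by simp)))
    subst hm
    obtain rfl : J2 = [] := by
      cases J2 with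
      | nil => rfl
      | cons j J2 =>
        have h1 : j < 2 := (List.pairwise_cons.1 (List.pairwise_append.1 hJ.dec).2.1).1 j (by simp)
        exact absurd (hJ.lt_dec j (by simp)) (PNat.lt_add_one_iff.1 h1).not_gt
    refine ⟨J1, 1, q, 1 :: E, by simp [p0, QueerPlus.setp], ⟨?_, ?_, ?_, ?_⟩⟩
    · exact (List.pairwise_append.1 hJ.dec).1
    · exact fun y hy => hJ.lt_dec y (by simp [hy])
    · exact fun y _ => one_le
    · exact List.pairwise_cons.2 ⟨fun y _ => one_le, hJ.inc⟩
  · simp only [PNum.mk.injEq] at e1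
    obtain ⟨rfl, rfl⟩ := e1
    have hs := setp_of_ne p (un_num_ne (l := E) (k := 1) fun y hy h => by
      have := hJ.le_inc y hy
      rw [h] at this
      exact absurd this (by decide))
    exact ⟨J, 1, _, E, by rw [hs.1], ⟨hJ.dec, fun y hy => lt_trans (by decide) (hJ.lt_dec y hy),
      fun y _ => one_le, hJ.inc⟩⟩
  · simp only [PNum.mk.injEq] at e1
    have := hJ.le_inc k (by simp)
    rw [← e1.1] at this
    have hm := hA ⟨m, q⟩ (by simp)
    rcases eq_one_or_eq_two this with rfl | rfl <;> simp at hm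

theorem IsRead.wFb {s : List ℕ} {w w' : List PNum} (h : IsRead s w) (hw : wFb w = some w') :
    IsRead s w' := by
  induction s generalizing w w' with
  | nil => simp [h.nil, QueerPlus.wFb] at hw
  | cons k s ih =>
    obtain ⟨u, v, rfl, hu, hk, hb, hv⟩ := h.cases
    have hb' := hb.wFb hw
    rw [wFb_append] at hw
    split_ifs at hw with h1 h2 <;> obtain ⟨x, hx, rfl⟩ := Option.map_eq_some_iff.1 hw
    · exact isRead_cons hu hk hb' (ih hv hx)
    · exact isRead_cons (hu.wFb hx) ((wFb_length hx).trans hk) hb' hv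
    -- The exchange of primes crosses from the first row into the rest; both parts are re-primed,
    -- which respects validity.
    · exact isRead_cons ((hu.setp _).wFb hx) ((wFb_length hx).trans (by simpa using hk)) hb'
        (hv.setp _)

theorem IsRead.wEb {s : List ℕ} {w w' : List PNum} (h : IsRead s w) (hw : wEb w = some w') :
    IsRead s w' := by
  induction s generalizing w w' with
  | nil => simp [h.nil, QueerPlus.wEb] at hw
  | cons k s ih =>
    obtain ⟨u, v, rfl, hu, hk, hb, hv⟩ := h.cases
    have hb' := hb.wEb hw
    rw [wEb_append] at hw
    split_ifs at hw with h1 h2 <;> obtain ⟨x, hx, rfl⟩ := Option.map_eq_some_iff.1 hw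
    · exact isRead_cons hu hk hb' (ih hv hx)
    · exact isRead_cons (hu.wEb hx) ((wEb_length hx).trans hk) hb' hv
    · exact isRead_cons ((hu.wEb hx).setp _) (by simpa using (wEb_length hx).trans hk) hb'
        (hv.setp _)

/-! ### Connected components -/

/-- One application of a crystal operator with index in `{1̄, 0, 1, …, m - 1}`. -/
inductive Step (m : ℕ) : List PNum → List PNum → Prop
  | f {i : ℕ+} {v w : List PNum} : (i : ℕ) < m → wF i v = some w → Step m v w
  | e {i : ℕ+} {v w : List PNum} : (i : ℕ) < m → wE i v = some w → Step m v w
  | zero (b : Bool) (v : List PNum) : 1 ≤ m → Step m v (setp b v)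
  | fb {v w : List PNum} : 2 ≤ m → wFb v = some w → Step m v w
  | eb {v w : List PNum} : 2 ≤ m → wEb v = some w → Step m v w

/-- Reachability by crystal operators. -/
abbrev Conn (m : ℕ) : List PNum → List PNum → Prop := Relation.ReflTransGen (Step m)

theorem Step.mono {m m' : ℕ} (h : m ≤ m') {v w : List PNum} (hs : Step m v w) : Step m' v w := by
  cases hs with
  | f hi hw => exact .f (hi.trans_le h) hw
  | e hi hw => exact .e (hi.trans_le h) hw
  | zero b v hm => exact .zero b v (hm.trans h)
  | fb hm hw => exact .fb (hm.trans h) hw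
  | eb hm hw => exact .eb (hm.trans h) hw

theorem Conn.mono {m m' : ℕ} (h : m ≤ m') {v w : List PNum} (hs : Conn m v w) : Conn m' v w :=
  Relation.ReflTransGen.mono (fun _ _ => Step.mono h) _ _ hs

/-- The subword of the letters with absolute value at most `m`. -/
def low (m : ℕ) (w : List PNum) : List PNum := w.filter fun x => (x.num : ℕ) ≤ m

theorem low_cons (m : ℕ) (x : PNum) (w : List PNum) :
    low m (x :: w) = if (x.num : ℕ) ≤ m then x :: low m w else low m w := by
  simp [low, List.filter_cons]

theorem low_append (m : ℕ) (u v : List PNum) : low m (u ++ v) = low m u ++ low m v := by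
  simp [low]

theorem low_eq_nil {m : ℕ} {w : List PNum} (h : ∀ x ∈ w, m < (x.num : ℕ)) : low m w = [] := by
  simpa [low] using h

theorem letter_skip {m : ℕ} {i : ℕ+} (hi : (i : ℕ) < m) {x : PNum} (hx : ¬ (x.num : ℕ) ≤ m) :
    phiL i x = 0 ∧ epsL i x = 0 ∧ x.num ≠ i ∧ x.num ≠ i + 1 := by
  have h1 : x.num ≠ i := fun h => hx (by rw [h]; exact hi.le)
  have h2 : x.num ≠ i + 1 := fun h => hx (by rw [h, PNat.add_coe]; exact hi)
  simp [phiL, epsL, h1, h2]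

/-- Letters above `m` are invisible to the operators of index below `m`, so these operators commute
with restriction to small letters. -/
theorem phi_low {m : ℕ} {i : ℕ+} (hi : (i : ℕ) < m) (w : List PNum) :
    phi i (low m w) = phi i w := by
  induction w with
  | nil => rfl
  | cons x w ih =>
    rw [low_cons]
    split_ifs with h
    · rw [phi_cons, phi_cons, ih]
    · have := letter_skip hi h
      rw [phi_cons, this.1, this.2.1, ih]; omega

theorem wF_low {m : ℕ} {i : ℕ+} (hi : (i : ℕ) < m) (w : List PNum) :
    wF i (low m w) = (wF i w).map (low m) := by
  induction w with
  | nil => rfl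
  | cons x w ih =>
    rw [low_cons]
    split_ifs with h
    · simp only [wF, phi_low hi, ih]
      split_ifs with h1 h2
      · simp [Function.comp_def, low_cons, h]
      · have : ((i : ℕ) + 1 ≤ m) := hi
        simp [low_cons, this]
      · rfl
    · obtain ⟨h1, h2, h3, h4⟩ := letter_skip hi h
      simp only [wF, h2, h3, if_false]
      split_ifs with h5
      · simp [ih, Function.comp_def, low_cons, h]
      · have : phi i w = 0 := by omega
        simp [ih, (wF_eq_none i w).2 this]

theorem wE_low {m : ℕ} {i : ℕ+} (hi : (i : ℕ) < m) (w : List PNum) :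
    wE i (low m w) = (wE i w).map (low m) := by
  induction w with
  | nil => rfl
  | cons x w ih =>
    rw [low_cons]
    split_ifs with h
    · simp only [wE, phi_low hi, ih]
      split_ifs with h1 h2
      · simp [Function.comp_def, low_cons, h]
      · simp [low_cons, hi.le]
      · rfl
    · obtain ⟨h1, h2, h3, h4⟩ := letter_skip hi h
      simp [wE, h2, ih, Function.comp_def, low_cons, h]

theorem p0_low {m : ℕ} (hm : 1 ≤ m) (w : List PNum) : p0 (low m w) = p0 w := by
  induction w with
  | nil => rfl
  | cons x w ih =>
    rw [low_cons]
    simp only [p0]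
    split_ifs with h h1 h1
    · simp [p0, h1]
    · simp [p0, h1, ih]
    · exact absurd (by simpa [h1] using hm) h
    · exact ih

theorem setp_low {m : ℕ} (hm : 1 ≤ m) (b : Bool) (w : List PNum) :
    setp b (low m w) = low m (setp b w) := by
  induction w with
  | nil => rfl
  | cons x w ih =>
    rw [low_cons]
    simp only [setp]
    split_ifs with h h1 h1
    · simp [setp, h1, low_cons, hm]
    · simp [setp, h1, ih, low_cons, h]
    · exact absurd (by simpa [h1] using hm) h
    · simp [ih, low_cons, h]

theorem wFb_low {m : ℕ} (hm : 2 ≤ m) (w : List PNum) : wFb (low m w) = (wFb w).map (low m) := by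
  have hm1 : 1 ≤ m := by omega
  induction w with
  | nil => rfl
  | cons x w ih =>
    rw [low_cons]
    simp only [wFb]
    split_ifs with h h1 h2 h1 h2
    · simp [wFb, h1, low_cons, hm, p0_low hm1, setp_low hm1]
    · simp [wFb, h2]
    · simp [wFb, h1, h2, ih, Function.comp_def, low_cons, h]
    · exact absurd (by simpa [h1] using hm1) h
    · exact absurd (by simpa [h2] using hm) h
    · simp [ih, Function.comp_def, low_cons, h]

theorem wEb_low {m : ℕ} (hm : 2 ≤ m) (w : List PNum) : wEb (low m w) = (wEb w).map (low m) := by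
  have hm1 : 1 ≤ m := by omega
  induction w with
  | nil => rfl
  | cons x w ih =>
    rw [low_cons]
    simp only [wEb]
    split_ifs with h h1 h2 h1 h2
    · simp [wEb, h1, low_cons, hm1, p0_low hm1, setp_low hm1]
    · simp [wEb, h2]
    · simp [wEb, h1, h2, ih, Function.comp_def, low_cons, h]
    · exact absurd (by simpa [h1] using hm) h
    · exact absurd (by simpa [h2] using hm1) h
    · simp [ih, Function.comp_def, low_cons, h]

theorem cn_low {m : ℕ} {k : ℕ+} (hk : (k : ℕ) ≤ m) (w : List PNum) : cn k (low m w) = cn k w := by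
  induction w with
  | nil => rfl
  | cons x w ih =>
    rw [low_cons]
    split_ifs with h
    · rw [cn_cons, cn_cons, ih]
    · have : x.num ≠ k := fun h' => h (h' ▸ hk)
      rw [cn_cons, ih, if_neg this]; rfl

theorem Step.cn_eq {m : ℕ} {v w : List PNum} (h : Step m v w) {k : ℕ+} (hk : m < (k : ℕ)) :
    cn k w = cn k v := by
  have key : ∀ i : ℕ+, (i : ℕ) ≤ m → i ≠ k := fun i hi e => by rw [e] at hi; omega
  have hF : ∀ {i : ℕ+} {v w : List PNum}, (i : ℕ) < m → wF i v = some w → cn k w = cn k v := by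
    intro i v w hi hw
    obtain ⟨A, B, p, rfl, rfl, -⟩ := (wF_eq_some _ _ _).1 hw
    have h1 := key i hi.le
    have h2 := key (i + 1) hi
    simp [cn_cons, h1, h2]
  have hFb : ∀ {v w : List PNum}, 2 ≤ m → wFb v = some w → cn k w = cn k v := by
    intro v w hm hw
    obtain ⟨A, B, p, -, rfl, rfl⟩ := (wFb_eq_some _ _).1 hw
    have h1 := key 1 (by simp; omega)
    have h2 := key 2 hm
    simp [cn_cons, h1, h2, cn_setp]
  cases h with
  | f hi hw => exact hF hi hw
  | e hi hw => exact (hF hi ((wE_iff_wF _ _ _).1 hw)).symm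
  | zero b v hm => exact cn_setp k b v
  | fb hm hw => exact hFb hm hw
  | eb hm hw => exact (hFb hm ((wEb_iff_wFb _ _).1 hw)).symm

theorem Step.lift_low {m : ℕ} {w x : List PNum} (h : Step m (low m w) x) :
    ∃ w', Step m w w' ∧ low m w' = x := by
  generalize hv : low m w = v at h
  cases h with
  | f hi hw =>
    rw [← hv, wF_low hi, Option.map_eq_some_iff] at hw
    obtain ⟨w', h1, h2⟩ := hw
    exact ⟨w', .f hi h1, h2⟩
  | e hi hw =>
    rw [← hv, wE_low hi, Option.map_eq_some_iff] at hw
    obtain ⟨w', h1, h2⟩ := hw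
    exact ⟨w', .e hi h1, h2⟩
  | zero b v hm => exact ⟨_, .zero b w hm, by rw [← hv, setp_low hm]⟩
  | fb hm hw =>
    rw [← hv, wFb_low hm, Option.map_eq_some_iff] at hw
    obtain ⟨w', h1, h2⟩ := hw
    exact ⟨w', .fb hm h1, h2⟩
  | eb hm hw =>
    rw [← hv, wEb_low hm, Option.map_eq_some_iff] at hw
    obtain ⟨w', h1, h2⟩ := hw
    exact ⟨w', .eb hm h1, h2⟩

/-- A path in the component of the restricted word lifts to the full word without touching the large
letters; this permits induction on `m`. -/
theorem Conn.lift_low {m : ℕ} {w x : List PNum} (h : Conn m (low m w) x) :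
    ∃ w', Conn m w w' ∧ low m w' = x ∧ ∀ k : ℕ+, m < (k : ℕ) → cn k w' = cn k w := by
  induction h with
  | refl => exact ⟨w, .refl, rfl, fun _ _ => rfl⟩
  | tail _ h ih =>
    obtain ⟨w', h1, rfl, h3⟩ := ih
    obtain ⟨w'', h4, h5⟩ := h.lift_low
    exact ⟨w'', h1.tail h4, h5, fun k hk => (h4.cn_eq hk).trans (h3 k hk)⟩

/-! ### Elements of lexicographically maximal weight -/

/-- The weight of `w` is maximal in its component, where the number of the largest letters is
compared first. -/
def LexMax (m : ℕ) (w : List PNum) : Prop :=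
  ∀ v, Conn m w v → ∀ k : ℕ+, (k : ℕ) ≤ m →
    (∀ l : ℕ+, k < l → (l : ℕ) ≤ m → cn l v = cn l w) → cn k v ≤ cn k w

theorem Step.length {m : ℕ} {v w : List PNum} (h : Step m v w) : w.length = v.length := by
  cases h with
  | f _ h => exact wF_length h
  | e _ h => exact wE_length h
  | zero => simp
  | fb _ h => exact wFb_length h
  | eb _ h => exact wEb_length h

theorem Conn.length {m : ℕ} {v w : List PNum} (h : Conn m v w) : w.length = v.length := by
  induction h with
  | refl => rfl
  | tail _ h ih => exact h.length.trans ih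

theorem exists_lexMax (m : ℕ) (w : List PNum) : ∃ v, Conn m w v ∧ LexMax m v := by
  -- The top `t` letters are treated one at a time. Each count is bounded by the length of the word,
  -- so a maximum subject to the counts already fixed exists.
  suffices h : ∀ t : ℕ, ∃ v, Conn m w v ∧ ∀ u, Conn m w u → ∀ k : ℕ+, (k : ℕ) ≤ m →
      m < k + t → (∀ l : ℕ+, k < l → (l : ℕ) ≤ m → cn l u = cn l v) → cn k u ≤ cn k v by
    obtain ⟨v, h1, h2⟩ := h (m + 1)
    exact ⟨v, h1, fun u hu k hk hl => h2 u (h1.trans hu) k hk (by omega) hl⟩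
  intro t
  induction t with
  | zero => exact ⟨w, .refl, fun u _ k hk hk' => by omega⟩
  | succ t ih =>
    obtain ⟨v, h1, h2⟩ := ih
    by_cases ht : t < m
    · obtain ⟨K, hK⟩ : ∃ K : ℕ+, (K : ℕ) = m - t := ⟨⟨m - t, by omega⟩, rfl⟩
      let S : Set ℕ := {c | ∃ u, Conn m w u ∧ (∀ l : ℕ+, K < l → (l : ℕ) ≤ m → cn l u = cn l v) ∧
        cn K u = c}
      have hb : BddAbove S := by
        refine ⟨w.length, ?_⟩
        rintro c ⟨u, hu, -, rfl⟩
        rw [← hu.length, cn]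
        exact List.count_le_length.trans (by simp)
      obtain ⟨u, hu1, hu2, hu3⟩ := Nat.sSup_mem (s := S) ⟨_, v, h1, fun _ _ _ => rfl, rfl⟩ hb
      refine ⟨u, hu1, fun x hx k hk hk' hl => ?_⟩
      rcases eq_or_ne k K with rfl | hkK
      · rw [hu3]
        exact le_csSup hb ⟨x, hx, fun l hl1 hl2 => (hl l hl1 hl2).trans (hu2 l hl1 hl2), rfl⟩
      · have hKk : K < k := by
          rw [← PNat.coe_lt_coe]
          have : (k : ℕ) ≠ K := fun h => hkK (PNat.coe_injective h)
          omega
        rw [hu2 k hKk hk]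
        exact h2 x hx k hk (by have := PNat.coe_lt_coe _ _ |>.2 hKk; omega) fun l hl1 hl2 =>
          (hl l hl1 hl2).trans (hu2 l (hKk.trans hl1) hl2)
    · exact ⟨v, h1, fun u hu k hk hk' => h2 u hu k hk (by have := k.pos; omega)⟩

theorem LexMax.low {m : ℕ} {w : List PNum} (h : LexMax (m + 1) w) : LexMax m (low m w) := by
  intro x hx k hk hl
  obtain ⟨v, h1, rfl, h3⟩ := hx.lift_low
  rw [cn_low hk, cn_low hk]
  refine h v (h1.mono (Nat.le_succ m)) k (by omega) fun l hl1 hl2 => ?_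
  by_cases hlm : (l : ℕ) ≤ m
  · have := hl l hl1 hlm
    rwa [cn_low hlm, cn_low hlm] at this
  · exact h3 l (by omega)

/-- Lowering with index `i` would increase the number of letters `i + 1` and keep all larger
letters. -/
theorem LexMax.phi_eq_zero {m : ℕ} {w : List PNum} (h : LexMax m w) {i : ℕ+} (hi : (i : ℕ) < m) :
    phi i w = 0 := by
  by_contra hne
  rw [← wF_eq_none] at hne
  obtain ⟨v, hv⟩ := Option.ne_none_iff_exists'.1 hne
  have := h v (.single (.f hi hv)) (i + 1) hi
  obtain ⟨A, B, p, rfl, rfl, -⟩ := (wF_eq_some _ _ _).1 hv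
  have hi1 : i ≠ i + 1 := (PNat.succ_ne i).symm
  refine absurd (this fun l hl _ => ?_) ?_
  · have h1 : i + 1 ≠ l := hl.ne
    have h2 : i ≠ l := ((PNat.lt_add_one_iff.2 le_rfl).trans hl).ne
    simp [cn_cons, h1, h2]
  · simp [cn_cons, hi1]

/-! ### Maximal powers of raising operators -/

/-- Apply `e_i` as often as possible. -/
def Emax (i : ℕ+) : List PNum → List PNum
  | [] => []
  | x :: w => (if x.num = i + 1 ∧ phi i w = 0 then ⟨i, x.primed⟩ else x) :: Emax i w

theorem emax_reach (i : ℕ+) (w : List PNum) :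
    Relation.ReflTransGen (fun v v' => wE i v = some v') w (Emax i w) := by
  -- Raising the tail only increases its `phi`, so a head that lets the operator through keeps doing
  -- so.
  have key : ∀ (x : PNum) (w v : List PNum), epsL i x ≤ phi i w →
      Relation.ReflTransGen (fun v v' => wE i v = some v') w v →
      epsL i x ≤ phi i v ∧
        Relation.ReflTransGen (fun v v' => wE i v = some v') (x :: w) (x :: v) := by
    intro x w v hx h
    induction h with
    | refl => exact ⟨hx, .refl⟩
    | tail _ h ih =>
      have := wF_phi ((wE_iff_wF _ _ _).1 h)
      exact ⟨by omega, ih.2.tail (by simp [wE, ih.1, h])⟩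
  induction w with
  | nil => exact .refl
  | cons x w ih =>
    simp only [Emax]
    split_ifs with h
    · obtain ⟨h1, h2⟩ := h
      refine .head (b := ⟨i, x.primed⟩ :: w) ?_ (key ⟨i, x.primed⟩ _ _ (by simp) ih).2
      simp [wE, epsL, h1, h2]
    · refine (key x _ _ ?_ ih).2
      simp only [epsL]
      split_ifs with h1
      · exact Nat.pos_of_ne_zero fun h2 => h ⟨h1, h2⟩
      · omega

theorem conn_emax {m : ℕ} {i : ℕ+} (hi : (i : ℕ) < m) (w : List PNum) : Conn m w (Emax i w) :=
  Relation.ReflTransGen.mono (fun _ _ h => Step.e hi h) _ _ (emax_reach i w)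

theorem cn_emax_self (i : ℕ+) (w : List PNum) : cn i (Emax i w) = cn i w + eps i w := by
  induction w with
  | nil => rfl
  | cons x w ih =>
    rw [Emax, cn_cons, cn_cons, eps_cons, ih]
    rcases letter_cases i x with ⟨p, rfl⟩ | ⟨p, rfl⟩ | ⟨h1, h2, h3, h4⟩
    · simp [(PNat.succ_ne i).symm]; omega
    · by_cases h : phi i w = 0
      · simp [h, PNat.succ_ne]; omega
      · simp [h, PNat.succ_ne]; omega
    · simp [h1, h2, h4]

theorem cn_emax_succ (i : ℕ+) (w : List PNum) :
    cn (i + 1) (Emax i w) + eps i w = cn (i + 1) w := by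
  induction w with
  | nil => rfl
  | cons x w ih =>
    rw [Emax, cn_cons, cn_cons, eps_cons, ← ih]
    rcases letter_cases i x with ⟨p, rfl⟩ | ⟨p, rfl⟩ | ⟨h1, h2, h3, h4⟩
    · simp [(PNat.succ_ne i).symm]
    · by_cases h : phi i w = 0
      · simp [h, (PNat.succ_ne i).symm]; omega
      · simp [h]; omega
    · simp [h2, h4]

theorem cn_emax_of_ne {i k : ℕ+} (h1 : k ≠ i) (h2 : k ≠ i + 1) (w : List PNum) :
    cn k (Emax i w) = cn k w := by
  induction w with
  | nil => rfl
  | cons x w ih =>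
    rw [Emax, cn_cons, cn_cons, ih]
    split_ifs with h h' <;> simp_all

theorem emax_append_of_ne {i : ℕ+} {Q : List PNum} (hQ : ∀ x ∈ Q, x.num ≠ i + 1) (w : List PNum) :
    Emax i (Q ++ w) = Q ++ Emax i w := by
  induction Q with
  | nil => rfl
  | cons x Q ih =>
    rw [List.cons_append, Emax, if_neg fun h => hQ x (by simp) h.1, ih fun y hy => hQ y (by simp [hy])]
    rfl

theorem phi_append_of_succ {i : ℕ+} {Q : List PNum} (hQ : ∀ x ∈ Q, x.num = i + 1)
    (w : List PNum) : phi i (Q ++ w) = phi i w - Q.length := by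
  induction Q with
  | nil => simp
  | cons x Q ih =>
    have h1 := hQ x (by simp)
    rw [List.cons_append, phi_cons, ih fun y hy => hQ y (by simp [hy])]
    simp [phiL, epsL, h1, PNat.succ_ne]
    omega

theorem phi_append_of_ne {i : ℕ+} {Q : List PNum} (hQ : ∀ x ∈ Q, x.num ≠ i ∧ x.num ≠ i + 1)
    (w : List PNum) : phi i (Q ++ w) = phi i w := by
  induction Q with
  | nil => rfl
  | cons x Q ih =>
    have h1 := hQ x (by simp)
    rw [List.cons_append, phi_cons, ih fun y hy => hQ y (by simp [hy])]
    simp [phiL, epsL, h1]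

theorem emax_append_of_le {i : ℕ+} {Q : List PNum} (hQ : ∀ x ∈ Q, x.num = i + 1) (w : List PNum)
    (h : Q.length ≤ phi i w) : Emax i (Q ++ w) = Q ++ Emax i w := by
  induction Q with
  | nil => rfl
  | cons x Q ih =>
    have hQ' : ∀ y ∈ Q, y.num = i + 1 := fun y hy => hQ y (by simp [hy])
    rw [List.length_cons] at h
    rw [List.cons_append, Emax, if_neg, ih hQ' (by omega)]
    · rfl
    · rw [phi_append_of_succ hQ']
      omega

theorem phi_emax_of_ne {i j : ℕ+} (h1 : j ≠ i) (h2 : j ≠ i + 1) (h3 : i ≠ j + 1) (w : List PNum) :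
    phi j (Emax i w) = phi j w := by
  have h4 : i + 1 ≠ j + 1 := fun h => h1 (add_right_cancel h).symm
  induction w with
  | nil => rfl
  | cons x w ih =>
    rw [Emax, phi_cons, phi_cons, ih]
    split_ifs with h
    · simp [phiL, epsL, h.1, h1.symm, h2.symm, h3, h4]
    · rfl

/-- An interaction estimate for neighbouring indices. It controls which lowering operators still
vanish after maximal raising powers have been applied in descending order. Only the letters `i`, `i
+ 1` and `i + 1 + 1` matter in the induction. -/
theorem phi_emax_emax (i : ℕ+) (w : List PNum) :
    phi (i + 1) (Emax i (Emax (i + 1) w)) + phi i (Emax (i + 1) w) ≤ phi i w + phi (i + 1) w ∧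
      phi i (Emax (i + 1) w) ≤ phi i w := by
  have h0 : i < i + 1 := PNat.lt_add_one_iff.2 le_rfl
  have h0' : i + 1 < i + 1 + 1 := PNat.lt_add_one_iff.2 le_rfl
  have h1 := h0.ne
  have h2 := h0'.ne
  have h3 := (h0.trans h0').ne
  induction w with
  | nil => simp [Emax]
  | cons x w ih =>
    obtain ⟨a, p⟩ := x
    by_cases ha : a = i
    · subst ha
      simp [Emax, phi_cons, phiL, epsL, h1, h3]
      omega
    · by_cases hb : a = i + 1
      · subst hb
        by_cases hc : phi i (Emax (i + 1) w) = 0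
        · simp [Emax, phi_cons, phiL, epsL, h1, h1.symm, h2, h2.symm, h3, h3.symm, hc]
          omega
        · simp [Emax, phi_cons, phiL, epsL, h1, h1.symm, h2, h2.symm, h3, h3.symm, hc]
          omega
      · by_cases hc : a = i + 1 + 1
        · subst hc
          by_cases hd : phi (i + 1) w = 0
          · by_cases he : phi i (Emax (i + 1) w) = 0
            · simp [Emax, phi_cons, phiL, epsL, h1, h1.symm, h2, h2.symm, h3, h3.symm, hd, he]
              omega
            · simp [Emax, phi_cons, phiL, epsL, h1, h1.symm, h2, h2.symm, h3, h3.symm, hd, he]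
              omega
          · simp [Emax, phi_cons, phiL, epsL, h1, h1.symm, h2, h2.symm, h3, h3.symm, hd]
            omega
        · simp [Emax, phi_cons, phiL, epsL, ha, hb, hc]
          omega

/-- Apply the maximal power of the lowering operator. The number of letters `i + 1` grows by `phi i
w`, which by `phi_add_cn` makes it at least the former number of letters `i`. -/
theorem exists_fmax {m : ℕ} {i : ℕ+} (hi : (i : ℕ) < m) (w : List PNum) : ∃ v, Conn m w v ∧
    cn i w ≤ cn (i + 1) v ∧ cn i v + cn (i + 1) v = cn i w + cn (i + 1) w ∧
    ∀ k, k ≠ i → k ≠ i + 1 → cn k v = cn k w := by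
  suffices h : ∀ t w, phi i w = t → ∃ v, Conn m w v ∧
      cn (i + 1) v = cn (i + 1) w + t ∧ cn i v + cn (i + 1) v = cn i w + cn (i + 1) w ∧
      ∀ k, k ≠ i → k ≠ i + 1 → cn k v = cn k w by
    obtain ⟨v, h1, h2, h3⟩ := h _ w rfl
    have := phi_add_cn i w
    exact ⟨v, h1, by omega, h3⟩
  intro t
  induction t with
  | zero => exact fun w _ => ⟨w, .refl, rfl, rfl, fun _ _ _ => rfl⟩
  | succ t ih =>
    intro w hw
    have hne : wF i w ≠ none := by rw [Ne, wF_eq_none]; omega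
    obtain ⟨u, hu⟩ := Option.ne_none_iff_exists'.1 hne
    obtain ⟨v, h1, h2, h3, h4⟩ := ih u (by have := wF_phi hu; omega)
    refine ⟨v, .head (.f hi hu) h1, ?_, ?_, ?_⟩
    all_goals obtain ⟨A, B, p, rfl, rfl, -⟩ := (wF_eq_some _ _ _).1 hu
    · simp [cn_cons, PNat.succ_ne, (PNat.succ_ne i).symm] at h2 ⊢; omega
    · simp [cn_cons, PNat.succ_ne, (PNat.succ_ne i).symm] at h3 ⊢; omega
    · intro k hk1 hk2
      rw [h4 k hk1 hk2]
      simp [cn_cons, hk1.symm, hk2.symm]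

/-! ### Descending chains of maximal raising powers -/

/-- Apply the maximal powers of `e_t, e_{t-1}, …, e_1`. -/
def chain : ℕ → List PNum → List PNum
  | 0, w => w
  | t + 1, w => chain t (Emax t.succPNat w)

theorem conn_chain {m t : ℕ} (ht : t < m) (w : List PNum) : Conn m w (chain t w) := by
  induction t generalizing w with
  | zero => exact .refl
  | succ t ih => exact (conn_emax (by simpa using ht) w).trans (ih (by omega) _)

theorem phi_chain {j : ℕ+} {t : ℕ} (h : t + 1 < (j : ℕ)) (w : List PNum) :
    phi j (chain t w) = phi j w := by
  induction t generalizing w with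
  | zero => rfl
  | succ t ih =>
    rw [chain, ih (by omega), phi_emax_of_ne]
    all_goals
      intro e
      have := congrArg PNat.val e
      simp at this
      omega

theorem chain_append {t : ℕ} {Q : List PNum} (hQ : ∀ x ∈ Q, t + 1 < (x.num : ℕ)) (w : List PNum) :
    chain t (Q ++ w) = Q ++ chain t w := by
  induction t generalizing w with
  | zero => rfl
  | succ t ih =>
    rw [chain, emax_append_of_ne, ih (fun x hx => by have := hQ x hx; omega)]
    · rfl
    · intro x hx e
      have := hQ x hx
      rw [e] at this
      simp at this

theorem succPNat_add_one (t : ℕ) : t.succPNat + 1 = (t + 1).succPNat := rfl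

/-- The head is unbracketed at every stage, hence descends to 1. Since `phi` vanishes before each
maximal power, that power carries the count of the upper letter over to the lower one; in the end
there are as many 1s as there were letters `t + 1`. -/
theorem chain_spec (t : ℕ) (q : Bool) (R : List PNum) (hR : ∀ i : ℕ+, (i : ℕ) ≤ t → phi i R = 0) :
    chain t (⟨t.succPNat, q⟩ :: R) = ⟨1, q⟩ :: chain t R ∧
    (∀ i : ℕ+, 2 ≤ (i : ℕ) → (i : ℕ) ≤ t → phi i (chain t R) = 0) ∧
    cn 1 (chain t (⟨t.succPNat, q⟩ :: R)) = cn t.succPNat (⟨t.succPNat, q⟩ :: R) := by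
  induction t generalizing R with
  | zero => exact ⟨rfl, fun i h1 h2 => by omega, rfl⟩
  | succ t ih =>
    have h1 := hR t.succPNat (by simp)
    have hE : Emax t.succPNat (⟨(t + 1).succPNat, q⟩ :: R) =
        ⟨t.succPNat, q⟩ :: Emax t.succPNat R := by
      rw [Emax, if_pos ⟨rfl, h1⟩]
    obtain ⟨h2, h3, h4⟩ := ih (Emax t.succPNat R) (by
      intro i hi
      rcases hi.eq_or_lt with hi | hi
      · have e : t.succPNat = i + 1 := PNat.coe_injective (by simp [hi])
        rw [e] at h1 ⊢
        have := (phi_emax_emax i R).2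
        rw [hR i (by omega)] at this
        omega
      · rw [phi_emax_of_ne, hR i (by omega)]
        all_goals
          intro e
          have := congrArg PNat.val e
          simp at this
          omega)
    refine ⟨by rw [chain, hE, h2]; rfl, fun i hi hi' => ?_, ?_⟩
    · rw [chain]
      rcases hi'.eq_or_lt with hi' | hi'
      · obtain ⟨s, rfl⟩ : ∃ s, t = s + 1 := ⟨t - 1, by omega⟩
        rw [chain, phi_chain (by omega)]
        have e : i = s.succPNat + 1 := PNat.coe_injective (by simp [hi'])
        have := (phi_emax_emax s.succPNat R).1
        rw [succPNat_add_one, h1, hR _ (by simp)] at this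
        rw [e, succPNat_add_one]
        omega
      · exact h3 i hi (by omega)
    · rw [chain, hE, h4, ← hE, cn_emax_self]
      have h5 := phi_add_cn t.succPNat (⟨(t + 1).succPNat, q⟩ :: R)
      rw [succPNat_add_one] at h5
      have h6 : phi t.succPNat (⟨(t + 1).succPNat, q⟩ :: R) = 0 := by
        rw [phi_cons, h1, ← succPNat_add_one, phiL_succ]; omega
      omega

/-- By `exists_fmax` any letter count occurring in the component can be pushed up step by step to
the largest letter, whose count is maximal at `w`. -/
theorem LexMax.cn_le {m : ℕ} {w v : List PNum} (h : LexMax m w) (hv : Conn m w v) {n k : ℕ+}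
    (hn : (n : ℕ) = m) (hk : (k : ℕ) ≤ m) : cn k v ≤ cn n w := by
  suffices hs : ∀ t : ℕ, ∀ v, Conn m w v → ∀ k : ℕ+, (k : ℕ) + t = m → cn k v ≤ cn n w from
    hs (m - k) v hv k (by omega)
  intro t
  induction t with
  | zero =>
    intro v hv k hk
    obtain rfl : k = n := PNat.coe_injective (by omega)
    refine h v hv k (by omega) fun l hl hl' => ?_
    have := PNat.coe_lt_coe _ _ |>.2 hl
    omega
  | succ t ih =>
    intro v hv k hk
    obtain ⟨u, h1, h2, -⟩ := exists_fmax (m := m) (i := k) (by omega) v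
    exact h2.trans (ih u (hv.trans h1) (k + 1) (by rw [PNat.add_coe, PNat.one_coe]; omega))

/-- The maximal raising power interchanges the counts of `m` and `m + 1`. A better restricted word
would lift, and lowering maximally at `m` would carry its advantage back to a weight above that of
`w`. -/
theorem LexMax.low_emax {m : ℕ} {w : List PNum} (h : LexMax (m + 1) w) {K : ℕ+}
    (hK : (K : ℕ) = m) : LexMax m (QueerPlus.low m (Emax K w)) := by
  have hphi := h.phi_eq_zero (i := K) (by omega)
  have hadd := phi_add_cn K w
  have h1 := cn_emax_self K w
  have h2 := cn_emax_succ K w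
  have hK1 : ((K + 1 : ℕ+) : ℕ) = m + 1 := by rw [PNat.add_coe, PNat.one_coe, hK]
  intro x hx k hk hl
  obtain ⟨v, hv, rfl, h3⟩ := hx.lift_low
  rw [cn_low hk, cn_low hk]
  have hv' : Conn (m + 1) w v := (conn_emax (by omega) w).trans (hv.mono (Nat.le_succ m))
  obtain ⟨u, hu, h4, h5, h6⟩ := exists_fmax (m := m + 1) (i := K) (by omega) v
  have hu' := hv'.trans hu
  have h7 : cn (K + 1) u ≤ cn (K + 1) w := h.cn_le hu' hK1 hK1.le
  have h8 := h3 (K + 1) (by omega)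
  rcases hk.eq_or_lt with hk' | hk'
  · obtain rfl : k = K := PNat.coe_injective (by omega)
    omega
  · have hkK : k ≠ K := fun e => by rw [e] at hk'; omega
    have hkK1 : k ≠ K + 1 := fun e => by rw [e] at hk'; omega
    have h9 : cn K v = cn K (Emax K w) := by
      have := hl K (by rw [← PNat.coe_lt_coe]; omega) hK.le
      rwa [cn_low hK.le, cn_low hK.le] at this
    rw [← h6 k hkK hkK1, cn_emax_of_ne hkK hkK1]
    refine h u hu' k (by omega) fun l hl1 hl2 => ?_
    by_cases e1 : l = K + 1
    · subst e1; omega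
    · by_cases e2 : l = K
      · subst e2; omega
      · have hlm : (l : ℕ) ≤ m := by
          have : (l : ℕ) ≠ m + 1 := fun e => e1 (PNat.coe_injective (by omega))
          omega
        have := hl l hl1 hlm
        rw [cn_low hlm, cn_low hlm, cn_emax_of_ne e2 e1] at this
        rw [h6 l e2 e1, this]

theorem conn_lower {m s : ℕ} (hs : s + 1 < m) (p : Bool) (X : List PNum)
    (hX : ∀ i : ℕ+, 2 ≤ (i : ℕ) → (i : ℕ) ≤ s + 1 → phi i X = 0) :
    Conn m (⟨(s + 1).succPNat, p⟩ :: X) (⟨2, p⟩ :: X) := by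
  induction s with
  | zero => exact .refl
  | succ s ih =>
    have h1 := hX (s + 1).succPNat (by simp) (by simp)
    refine .head (b := ⟨(s + 1).succPNat, p⟩ :: X) (.e (i := (s + 1).succPNat) (by simpa using hs) ?_)
      (ih (by omega) fun i hi hi' => hX i hi (by omega))
    simp [wE, h1, epsL, succPNat_add_one]

/-- The weight of `w` already forces the head to be `m` and `phi` of the whole word to vanish. The
point is that the head is not needed to cancel anything. If it were, one could reach a word
containing more letters 1 than `w` has letters `m`, against `LexMax.cn_le`; the barred raising
operator supplies the extra 1. -/
theorem LexMax.free {m : ℕ} {w : List PNum} (hw : ∀ x ∈ w, (x.num : ℕ) ≤ m) (h : LexMax m w)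
    (hne : w ≠ []) : ∃ x z, w = x :: z ∧ (x.num : ℕ) = m ∧ ∀ i : ℕ+, (i : ℕ) < m → phi i z = 0 := by
  induction m generalizing w with
  | zero =>
    cases w with
    | nil => exact absurd rfl hne
    | cons x z => have := hw x (by simp); have := x.num.pos; omega
  | succ m ih =>
    cases w with
    | nil => exact absurd rfl hne
    | cons x z =>
    have hx : (x.num : ℕ) = m + 1 := by
      by_contra hx
      have := hw x (by simp)
      have := h.phi_eq_zero (i := x.num) (by omega)
      simp [phi_cons, phiL] at this
    refine ⟨x, z, rfl, hx, fun i hi => ?_⟩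
    have hphi := h.phi_eq_zero hi
    have hxi : x.num ≠ i := fun e => by rw [e] at hx; omega
    rcases Nat.lt_or_ge i m with him | him
    · have hxi' : x.num ≠ i + 1 := fun e => by
        rw [e, PNat.add_coe, PNat.one_coe] at hx; omega
      simpa [phi_cons, phiL, epsL, hxi, hxi'] using hphi
    by_contra hz
    obtain ⟨t, rfl⟩ : ∃ t, m = t + 1 := ⟨m - 1, by have := i.pos; omega⟩
    obtain rfl : i = t.succPNat := PNat.coe_injective (by simp; omega)
    have hxK : x.num = t.succPNat + 1 := PNat.coe_injective (by simp [hx])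
    -- The head can cancel only one letter, so a failure means exactly one uncancelled letter in the
    -- tail.
    have hz1 : phi t.succPNat z = 1 := by
      have : phi t.succPNat (x :: z) = phi t.succPNat z - 1 := by
        simp [phi_cons, phiL, epsL, hxK, PNat.succ_ne]
      omega
    have hsucc : ∀ y ∈ x :: z, t + 1 < (y.num : ℕ) → y.num = t.succPNat + 1 := fun y hy hy' =>
      PNat.coe_injective (by have := hw y hy; simp; omega)
    have hlow : QueerPlus.low (t + 1) (x :: z) ≠ [] := by
      intro e
      have hall : ∀ y ∈ z, y.num = t.succPNat + 1 := fun y hy => by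
        refine hsucc y (by simp [hy]) ?_
        by_contra hy'
        have : y ∈ QueerPlus.low (t + 1) (x :: z) := by simp [QueerPlus.low, hy]; omega
        simp [e] at this
      have := phi_append_of_succ hall []
      simp at this
      omega
    -- By induction the restricted word starts with `t + 1`. Hence `w` is a block `x :: Q` of
    -- letters `t + 2`, then `t + 1`, then `R0`.
    obtain ⟨y, Y, hY, hy, hYphi⟩ := ih (w := QueerPlus.low (t + 1) (x :: z))
      (by simp [QueerPlus.low]) h.low hlow
    obtain ⟨Q, R0, hQR, hQ, -, hR0⟩ := List.filter_eq_cons_iff.1 hY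
    cases Q with
    | nil =>
      simp only [List.nil_append, List.cons.injEq] at hQR
      rw [hQR.1] at hx; omega
    | cons x' Q =>
    simp only [List.cons_append, List.cons.injEq] at hQR
    obtain ⟨rfl, rfl⟩ := hQR
    have hQ' : ∀ a ∈ x :: Q, a.num = t.succPNat + 1 := fun a ha => by
      have h1 := hQ a ha
      refine hsucc a (by simp at ha; rcases ha with rfl | ha <;> simp [*]) (by simpa using h1)
    have hQ'' : ∀ a ∈ Q, a.num = t.succPNat + 1 := fun a ha => hQ' a (by simp [ha])
    obtain ⟨k, q⟩ := y
    obtain rfl : k = t.succPNat := PNat.coe_injective (by simpa using hy)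
    have hR0len : phi t.succPNat R0 = Q.length := by
      rw [phi_append_of_succ hQ'', phi_cons, phiL_self, epsL_self] at hz1
      omega
    have hR0phi : ∀ i : ℕ+, (i : ℕ) < t + 1 → phi i R0 = 0 := fun i hi => by
      rw [← phi_low hi, QueerPlus.low, hR0]; exact hYphi i hi
    have hw' : Emax t.succPNat (x :: (Q ++ ⟨t.succPNat, q⟩ :: R0)) =
        (x :: Q) ++ ⟨t.succPNat, q⟩ :: Emax t.succPNat R0 := by
      have := emax_append_of_le hQ' (⟨t.succPNat, q⟩ :: R0)
        (by rw [phi_cons, phiL_self, epsL_self, List.length_cons]; omega)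
      rw [List.cons_append] at this
      rw [this, Emax, if_neg fun e => PNat.succ_ne _ e.1.symm]
    have hlowQ : QueerPlus.low (t + 1) (x :: Q) = [] := low_eq_nil fun a ha => by rw [hQ' a ha]; simp
    have hlm := h.low_emax (K := t.succPNat) (by simp)
    -- A second use of the induction hypothesis, after the maximal raising power. It gives the
    -- vanishing needed to run the chain down from `t + 1`.
    obtain ⟨y', Z, hZ, -, hZphi⟩ := ih (by simp [QueerPlus.low]) hlm (by
      rw [hw', low_append, hlowQ, low_cons, if_pos (by simp)]
      exact List.cons_ne_nil _ _)
    have hRphi : ∀ i : ℕ+, (i : ℕ) ≤ t → phi i (Emax t.succPNat R0) = 0 := fun i hi => by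
      rw [hw', low_append, hlowQ, low_cons, if_pos (by simp)] at hZ
      simp only [List.nil_append, List.cons.injEq] at hZ
      rw [← phi_low (m := t + 1) (by omega), hZ.2]
      exact hZphi i (by omega)
    obtain ⟨hc1, hc2, hc3⟩ := chain_spec t q (Emax t.succPNat R0) hRphi
    set R1 := chain t (Emax t.succPNat R0) with hR1
    have hu : chain t (Emax t.succPNat (x :: (Q ++ ⟨t.succPNat, q⟩ :: R0))) =
        x :: (Q ++ ⟨1, q⟩ :: R1) := by
      rw [hw', chain_append (fun a ha => by rw [hQ' a ha]; simp), hc1]; rfl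
    -- The number of 1s now equals the maximum allowed by `LexMax.cn_le`.
    have hcu : cn 1 (x :: (Q ++ ⟨1, q⟩ :: R1)) =
        cn (t.succPNat + 1) (x :: (Q ++ ⟨t.succPNat, q⟩ :: R0)) := by
      have h1 : ∀ k : ℕ+, k ≠ t.succPNat + 1 → cn k (x :: Q) = 0 := fun k hk => by
        rw [cn, List.count_eq_zero]
        intro hmem
        obtain ⟨a, ha, rfl⟩ := List.mem_map.1 hmem
        exact hk (hQ' a ha)
      have h2 : (1 : ℕ+) ≠ t.succPNat + 1 := fun e => by
        have := congrArg PNat.val e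
        simp at this
      have h3 := cn_emax_self t.succPNat (x :: (Q ++ ⟨t.succPNat, q⟩ :: R0))
      have h4 := phi_add_cn t.succPNat (x :: (Q ++ ⟨t.succPNat, q⟩ :: R0))
      rw [hw', cn_append, h1 _ (PNat.succ_ne _).symm, zero_add, ← hc3, hc1] at h3
      rw [← List.cons_append, cn_append, h1 _ h2, zero_add, h3]
      omega
    have hconn : Conn (t + 1 + 1) (x :: (Q ++ ⟨t.succPNat, q⟩ :: R0))
        (x :: (Q ++ ⟨1, q⟩ :: R1)) := by
      rw [← hu]
      exact (conn_emax (by simp) _).trans (conn_chain (by omega) _)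
    have hone : ∀ i : ℕ+, 2 ≤ (i : ℕ) → phi i (⟨1, q⟩ :: R1) = phi i R1 := fun i hi => by
      refine phi_append_of_ne (Q := [⟨1, q⟩]) ?_ R1
      simp only [List.mem_singleton, forall_eq]
      constructor <;> intro e <;> have := congrArg PNat.val e <;> simp at this <;> omega
    have hX : ∀ i : ℕ+, 2 ≤ (i : ℕ) → (i : ℕ) ≤ t + 1 → phi i (Q ++ ⟨1, q⟩ :: R1) = 0 := by
      intro i hi hi'
      rcases hi'.eq_or_lt with hi' | hi'
      · obtain rfl : i = t.succPNat := PNat.coe_injective (by simpa using hi')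
        obtain ⟨s, rfl⟩ : ∃ s, t = s + 1 := ⟨t - 1, by simp at hi; omega⟩
        rw [phi_append_of_succ hQ'', hone _ hi, hR1, chain, phi_chain (by simp)]
        have := (phi_emax_emax s.succPNat R0).1
        rw [succPNat_add_one, hR0len, hR0phi s.succPNat (by simp)] at this
        omega
      · rw [phi_append_of_ne, hone i hi]
        · exact hc2 i hi (by omega)
        · intro a ha
          rw [hQ'' a ha]
          constructor <;> intro e <;> have := congrArg PNat.val e <;> simp at this <;> omega
    have hx2 : x = ⟨(t + 1).succPNat, x.primed⟩ := by
      rw [← succPNat_add_one, ← hxK]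
    have hlower := conn_lower (m := t + 1 + 1) (s := t) (by omega) x.primed _ hX
    rw [← hx2] at hlower
    -- The head has been raised from `t + 2` to 2 without disturbing the tail; the barred operator
    -- turns it into a further 1, one too many.
    have hfin := (hconn.trans hlower).tail (Step.eb (by omega)
      (show wEb (⟨2, x.primed⟩ :: (Q ++ ⟨1, q⟩ :: R1)) = some _ by rw [wEb, if_pos rfl]))
    have hle := h.cn_le hfin (n := t.succPNat + 1) (k := 1) (by simp) (by simp)
    rw [← hcu, cn_cons, cn_cons, cn_setp, if_pos rfl, if_neg] at hle
    · omega
    · rw [hxK]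
      intro e
      have := congrArg PNat.val e
      simp at this

/-! ### Bisimilar tableau words are equal -/

/-- A relation compatible with weights, primes and the crystal operators with index in
`{1̄, 0, 1, …, m - 1}`. -/
structure IsBisim (m : ℕ) (R : List PNum → List PNum → Prop) : Prop where
  cn_eq : ∀ {v w}, R v w → ∀ k : ℕ+, (k : ℕ) ≤ m → cn k v = cn k w
  p0_eq : 1 ≤ m → ∀ {v w}, R v w → p0 v = p0 w
  setp : 1 ≤ m → ∀ {v w}, R v w → ∀ b, R (setp b v) (setp b w)
  f : ∀ {i : ℕ+}, (i : ℕ) < m → ∀ {v w}, R v w → Option.Rel R (wF i v) (wF i w)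
  e : ∀ {i : ℕ+}, (i : ℕ) < m → ∀ {v w}, R v w → Option.Rel R (wE i v) (wE i w)
  fb : 2 ≤ m → ∀ {v w}, R v w → Option.Rel R (wFb v) (wFb w)
  eb : 2 ≤ m → ∀ {v w}, R v w → Option.Rel R (wEb v) (wEb w)

theorem _root_.Option.Rel.flip {α : Type} {R : α → α → Prop} {x y : Option α}
    (h : Option.Rel R x y) : Option.Rel (fun a b => R b a) y x := by
  cases h with
  | none => exact .none
  | some h => exact .some h

theorem _root_.Option.Rel.some_left {α : Type} {R : α → α → Prop} {a : α} {x y : Option α}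
    (h : Option.Rel R x y) (hx : x = some a) : ∃ b, y = some b ∧ R a b := by
  cases h with
  | none => simp at hx
  | @some a' b h => simp at hx; subst hx; exact ⟨b, rfl, h⟩

theorem IsBisim.flip {m : ℕ} {R : List PNum → List PNum → Prop} (h : IsBisim m R) :
    IsBisim m (fun v w => R w v) where
  cn_eq hr k hk := (h.cn_eq hr k hk).symm
  p0_eq hm _ _ hr := (h.p0_eq hm hr).symm
  setp hm _ _ hr b := h.setp hm hr b
  f hi _ _ hr := (h.f hi hr).flip
  e hi _ _ hr := (h.e hi hr).flip
  fb hm _ _ hr := (h.fb hm hr).flip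
  eb hm _ _ hr := (h.eb hm hr).flip

/-- Bisimilar words move in parallel. Since the operators are injective, and a re-priming can be
undone from the common `p0`, equality of the images can be pulled back; the last conjunct records
this. -/
theorem IsBisim.step {m : ℕ} {R : List PNum → List PNum → Prop} (h : IsBisim m R)
    {v v' w : List PNum} (hr : R v w) (hs : Step m v v') :
    ∃ w', Step m w w' ∧ R v' w' ∧ (v' = w' → v = w) := by
  cases hs with
  | f hi hv =>
    obtain ⟨w', h1, h2⟩ := (h.f hi hr).some_left hv
    refine ⟨w', .f hi h1, h2, fun e => ?_⟩
    subst e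
    rw [← wE_iff_wF] at hv h1
    exact Option.some.inj (hv.symm.trans h1)
  | e hi hv =>
    obtain ⟨w', h1, h2⟩ := (h.e hi hr).some_left hv
    refine ⟨w', .e hi h1, h2, fun e => ?_⟩
    subst e
    rw [wE_iff_wF] at hv h1
    exact Option.some.inj (hv.symm.trans h1)
  | zero b v hm =>
    refine ⟨_, .zero b w hm, h.setp hm hr b, fun e => ?_⟩
    have h0 := h.p0_eq hm hr
    have key : ∀ u : List PNum, QueerPlus.setp ((p0 u).getD b) (QueerPlus.setp b u) = u := fun u => by
      rw [setp_setp]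
      exact setp_of_p0 fun c hc => by simp [hc]
    rw [← key v, ← key w, e, h0]
  | fb hm hv =>
    obtain ⟨w', h1, h2⟩ := (h.fb hm hr).some_left hv
    refine ⟨w', .fb hm h1, h2, fun e => ?_⟩
    subst e
    rw [← wEb_iff_wFb] at hv h1
    exact Option.some.inj (hv.symm.trans h1)
  | eb hm hv =>
    obtain ⟨w', h1, h2⟩ := (h.eb hm hr).some_left hv
    refine ⟨w', .eb hm h1, h2, fun e => ?_⟩
    subst e
    rw [wEb_iff_wFb] at hv h1
    exact Option.some.inj (hv.symm.trans h1)

theorem IsBisim.conn {m : ℕ} {R : List PNum → List PNum → Prop} (h : IsBisim m R)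
    {v v' w : List PNum} (hr : R v w) (hs : Conn m v v') :
    ∃ w', Conn m w w' ∧ R v' w' ∧ (v' = w' → v = w) := by
  induction hs with
  | refl => exact ⟨w, .refl, hr, id⟩
  | tail _ hs ih =>
    obtain ⟨w', h1, h2, h3⟩ := ih
    obtain ⟨w'', h4, h5, h6⟩ := h.step h2 hs
    exact ⟨w'', h1.tail h4, h5, fun e => h3 (h6 e)⟩

theorem IsBisim.lexMax {m : ℕ} {R : List PNum → List PNum → Prop} (h : IsBisim m R)
    {v w : List PNum} (hr : R v w) (hv : LexMax m v) : LexMax m w := by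
  intro u hu k hk hl
  obtain ⟨u', h1, h2, -⟩ := h.flip.conn hr hu
  rw [← h.cn_eq h2 k hk, ← h.cn_eq hr k hk]
  refine hv u' h1 k hk fun l hl1 hl2 => ?_
  rw [h.cn_eq h2 l hl2, h.cn_eq hr l hl2]
  exact hl l hl1 hl2

theorem Step.isRead {m : ℕ} {s : List ℕ} {v w : List PNum} (h : Step m v w) (hv : IsRead s v) :
    IsRead s w := by
  cases h with
  | f _ h => exact hv.wF h
  | e _ h => exact hv.wE h
  | zero b => exact hv.setp b
  | fb _ h => exact hv.wFb h
  | eb _ h => exact hv.wEb h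

theorem Conn.isRead {m : ℕ} {s : List ℕ} {v w : List PNum} (h : Conn m v w) (hv : IsRead s v) :
    IsRead s w := by
  induction h with
  | refl => exact hv
  | tail _ h ih => exact h.isRead ih

theorem le_iff_cn {m : ℕ} (w : List PNum) :
    (∀ x ∈ w, (x.num : ℕ) ≤ m) ↔ ∀ k : ℕ+, m < (k : ℕ) → cn k w = 0 := by
  constructor
  · intro h k hk
    rw [cn, List.count_eq_zero]
    intro hmem
    obtain ⟨x, hx, rfl⟩ := List.mem_map.1 hmem
    exact absurd (h x hx) (by omega)
  · intro h x hx
    by_contra hlt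
    have := h x.num (by omega)
    rw [cn, List.count_eq_zero] at this
    exact this (List.mem_map_of_mem hx)

theorem Step.le {m : ℕ} {v w : List PNum} (h : Step m v w) (hv : ∀ x ∈ v, (x.num : ℕ) ≤ m) :
    ∀ x ∈ w, (x.num : ℕ) ≤ m := by
  rw [le_iff_cn] at hv ⊢
  exact fun k hk => (h.cn_eq hk).trans (hv k hk)

theorem Conn.le {m : ℕ} {v w : List PNum} (h : Conn m v w) (hv : ∀ x ∈ v, (x.num : ℕ) ≤ m) :
    ∀ x ∈ w, (x.num : ℕ) ≤ m := by
  induction h with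
  | refl => exact hv
  | tail _ h ih => exact h.le ih

/-- By `LexMax.free` the letter after the head is not smaller than the head. A valid row starting
with the largest letter is therefore constant, and maximality of its length excludes that letter
from the later rows. -/
theorem LexMax.isRead {m : ℕ} {s : List ℕ} {v : List PNum} (h : LexMax (m + 1) v)
    (hv : ∀ x ∈ v, (x.num : ℕ) ≤ m + 1) (hr : IsRead s v) (hne : v ≠ []) :
    ∃ q a v' s', v = (⟨m.succPNat, q⟩ :: un (List.replicate a m.succPNat)) ++ v' ∧
      (∀ x ∈ v', (x.num : ℕ) ≤ m) ∧ IsRead s' v' ∧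
      ∀ i : ℕ+, (i : ℕ) < m + 1 → phi i (un (List.replicate a m.succPNat) ++ v') = 0 := by
  obtain ⟨x, z, hxz, hx, hphi⟩ := h.free hv hne
  cases s with
  | nil => exact absurd hr.nil hne
  | cons k s =>
  obtain ⟨u, v', rfl, hu, hk, hb, hv'⟩ := hr.cases
  obtain ⟨J, M, q, E, rfl, hJ⟩ := validRow_reverse.1 hu
  have hhead : ∀ y z', z = y :: z' → ¬ y.num < x.num := by
    rintro y z' rfl hy
    have := hphi y.num (by rw [← hx]; exact hy)
    simp [phi_cons, phiL] at this
  cases J with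
  | cons j J =>
    simp only [un_cons, List.cons_append, List.cons.injEq] at hxz
    obtain ⟨rfl, hz⟩ := hxz
    cases J with
    | nil => exact absurd (hJ.lt_dec j (by simp)) (hhead _ _ hz.symm)
    | cons j' J =>
      exact absurd ((List.pairwise_cons.1 hJ.dec).1 j' (by simp)) (hhead _ _ hz.symm)
  | nil =>
    simp only [un_nil, List.nil_append, List.cons_append, List.cons.injEq] at hxz
    obtain ⟨rfl, rfl⟩ := hxz
    obtain rfl : M = m.succPNat := PNat.coe_injective (by simpa using hx)
    have hE : E = List.replicate E.length m.succPNat := by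
      rw [List.eq_replicate_iff]
      refine ⟨rfl, fun e he => le_antisymm ?_ (hJ.le_inc e he)⟩
      have := hv ⟨e, false⟩ (by simp [un, he])
      rw [← PNat.coe_le_coe]
      simpa using this
    refine ⟨q, E.length, v', s, by rw [← hE]; rfl, ?_, hv', by rw [← hE]; exact hphi⟩
    intro y hy
    by_contra hlt
    have hy' := hv y (by simp [hy])
    have hyn : y.num = m.succPNat := PNat.coe_injective (by simp; omega)
    -- A further largest letter would extend the constant first row to a longer hook subword.
    have h1 : (List.replicate (E.length + 2) m.succPNat).Sublist
        ((un [] ++ ⟨m.succPNat, q⟩ :: un E ++ v').map PNum.num) := by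
      have h2 : [m.succPNat].Sublist (v'.map PNum.num) :=
        List.singleton_sublist.2 (hyn ▸ List.mem_map_of_mem hy)
      have h3 : List.replicate (E.length + 2) m.succPNat =
          (m.succPNat :: List.replicate E.length m.succPNat) ++ [m.succPNat] := by
        rw [← List.replicate_succ, ← List.replicate_succ']
      rw [h3, ← hE]
      simpa using h2
    have h4 := hb _ h1 ⟨[], _, rfl, .nil, by simp [List.pairwise_replicate]⟩
    simp at h4 hk
    omega

/-- The tails cancel nothing, so both heads can be raised down to 1 with their primes, where `p0`
compares them. -/
theorem IsBisim.prime_eq {m : ℕ} {R : List PNum → List PNum → Prop} (h : IsBisim m R) {t : ℕ}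
    (ht : t < m) {p p' : Bool} {z z' : List PNum}
    (hr : R (⟨t.succPNat, p⟩ :: z) (⟨t.succPNat, p'⟩ :: z'))
    (hz : ∀ i : ℕ+, (i : ℕ) < t + 1 → phi i z = 0) (hz' : ∀ i : ℕ+, (i : ℕ) < t + 1 → phi i z' = 0) :
    p = p' := by
  induction t with
  | zero =>
    have h01 : Nat.succPNat 0 = 1 := rfl
    simpa [p0, h01] using h.p0_eq (by omega) hr
  | succ t ih =>
    refine ih (by omega) ?_ (fun i hi => hz i (by omega)) fun i hi => hz' i (by omega)
    have hE : ∀ (q : Bool) (y : List PNum), phi t.succPNat y = 0 →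
        wE t.succPNat (⟨(t + 1).succPNat, q⟩ :: y) = some (⟨t.succPNat, q⟩ :: y) := fun q y hy => by
      simp [wE, hy, epsL, succPNat_add_one]
    have := h.e (i := t.succPNat) (by simpa using ht) hr
    rw [hE p z (hz _ (by simp)), hE p' z' (hz' _ (by simp))] at this
    cases this with
    | some h => exact h

/-- A common prefix of letters above `m` is inert for the operators of index below `m`, so it can be
stripped. -/
theorem IsBisim.prefix {m m' : ℕ} {R : List PNum → List PNum → Prop} (h : IsBisim m' R)
    (hm : m ≤ m') {u : List PNum} (hu : ∀ x ∈ u, m < (x.num : ℕ)) :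
    IsBisim m (fun v w => R (u ++ v) (u ++ w)) := by
  have hne : ∀ k : ℕ+, (k : ℕ) ≤ m → ∀ x ∈ u, x.num ≠ k := fun k hk x hx e => by
    have := hu x hx
    rw [e] at this
    omega
  have h1 : 1 ≤ m → ∀ v, p0 (u ++ v) = p0 v ∧ ∀ b, QueerPlus.setp b (u ++ v) =
      u ++ QueerPlus.setp b v := fun hm v => by
    have := setp_of_ne (w := u) false fun x hx => hne 1 (by simpa using hm) x hx
    exact ⟨by rw [p0_append, this.2]; rfl, fun b => by rw [setp_append, if_pos this.2]⟩
  have h2 : ∀ i : ℕ+, (i : ℕ) < m → phi i u = 0 ∧ eps i u = 0 := fun i hi => by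
    have h3 := phi_append_of_ne (i := i) (Q := u)
      (fun x hx => ⟨hne i hi.le x hx, hne (i + 1) hi x hx⟩) []
    rw [List.append_nil, phi_nil] at h3
    have h4 := phi_add_cn i u
    have h5 : cn (i + 1) u = 0 := by
      rw [cn, List.count_eq_zero]
      intro hmem
      obtain ⟨x, hx, e⟩ := List.mem_map.1 hmem
      exact hne (i + 1) hi x hx e
    omega
  have hF : ∀ i : ℕ+, (i : ℕ) < m → ∀ v, wF i (u ++ v) = (wF i v).map (u ++ ·) := fun i hi v => by
    obtain ⟨h3, h4⟩ := h2 i hi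
    rw [wF_append, h4]
    split_ifs with h5
    · rfl
    · rw [(wF_eq_none i u).2 h3, (wF_eq_none i v).2 (by omega)]; rfl
  have hE : ∀ i : ℕ+, (i : ℕ) < m → ∀ v, wE i (u ++ v) = (wE i v).map (u ++ ·) := fun i hi v => by
    rw [wE_append, (h2 i hi).2, if_pos (Nat.zero_le _)]
  have hb : 2 ≤ m → wFb u = none ∧ wEb u = none := fun hm => by
    constructor
    · by_contra hc
      obtain ⟨y, hy⟩ := Option.ne_none_iff_exists'.1 hc
      obtain ⟨A, B, p, -, rfl, -⟩ := (wFb_eq_some _ _).1 hy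
      exact hne 1 (by simp; omega) ⟨1, p⟩ (by simp) rfl
    · by_contra hc
      obtain ⟨y, hy⟩ := Option.ne_none_iff_exists'.1 hc
      obtain ⟨A, B, p, -, rfl, -⟩ := (wEb_eq_some _ _).1 hy
      exact hne 2 (by simpa using hm) ⟨2, p⟩ (by simp) rfl
  have hrel : ∀ {x y : Option (List PNum)}, Option.Rel R (x.map (u ++ ·)) (y.map (u ++ ·)) →
      Option.Rel (fun v w => R (u ++ v) (u ++ w)) x y := by
    intro x y hxy
    cases x <;> cases y
    · exact .none
    · cases hxy
    · cases hxy
    · cases hxy with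
      | some h => exact .some h
  exact
    { cn_eq := fun hr k hk => by simpa using h.cn_eq hr k (hk.trans hm)
      p0_eq := fun h1m v w hr => by
        have := h.p0_eq (h1m.trans hm) hr
        rwa [(h1 h1m v).1, (h1 h1m w).1] at this
      setp := fun h1m v w hr b => by
        have := h.setp (h1m.trans hm) hr b
        rwa [(h1 h1m v).2, (h1 h1m w).2] at this
      f := fun hi v w hr => hrel (by
        have := h.f (hi.trans_le hm) hr
        rwa [hF _ hi, hF _ hi] at this)
      e := fun hi v w hr => hrel (by
        have := h.e (hi.trans_le hm) hr
        rwa [hE _ hi, hE _ hi] at this)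
      fb := fun h2m v w hr => hrel (by
        have := h.fb (h2m.trans hm) hr
        rwa [wFb_append, wFb_append, if_pos (hb h2m), if_pos (hb h2m)] at this)
      eb := fun h2m v w hr => hrel (by
        have := h.eb (h2m.trans hm) hr
        rwa [wEb_append, wEb_append, if_pos (hb h2m), if_pos (hb h2m)] at this) }

theorem IsBisim.eq {m : ℕ} {R : List PNum → List PNum → Prop} (h : IsBisim m R) {s s' : List ℕ}
    {v w : List PNum} (hv : ∀ x ∈ v, (x.num : ℕ) ≤ m) (hw : ∀ x ∈ w, (x.num : ℕ) ≤ m)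
    (hsv : IsRead s v) (hsw : IsRead s' w) (hr : R v w) : v = w := by
  induction m generalizing R s s' v w with
  | zero =>
    have : ∀ u : List PNum, (∀ x ∈ u, (x.num : ℕ) ≤ 0) → u = [] := fun u hu => by
      cases u with
      | nil => rfl
      | cons x u => have := hu x (by simp); have := x.num.pos; omega
    rw [this v hv, this w hw]
  | succ m ih =>
    obtain ⟨v1, hc, hmax⟩ := exists_lexMax (m + 1) v
    obtain ⟨w1, hc', hr1, heq⟩ := h.conn hr hc
    -- It suffices to prove equality at the lexicographically maximal elements, where the first rows
    -- agree and can be removed.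
    apply heq
    have hmax' := h.lexMax hr1 hmax
    have hv1 := hc.le hv
    have hw1 := hc'.le hw
    have hcn := h.cn_eq hr1 m.succPNat (by simp)
    by_cases hvne : v1 = [] <;> by_cases hwne : w1 = []
    · rw [hvne, hwne]
    · obtain ⟨q, a, w2, -, rfl, -⟩ := hmax'.isRead hw1 (hc'.isRead hsw) hwne
      simp [hvne, cn_cons] at hcn
    · obtain ⟨q, a, w2, -, rfl, -⟩ := hmax.isRead hv1 (hc.isRead hsv) hvne
      simp [hwne, cn_cons] at hcn
    · obtain ⟨q, a, v2, s2, rfl, h1, h2, h3⟩ := hmax.isRead hv1 (hc.isRead hsv) hvne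
      obtain ⟨q', a', w2, s2', rfl, h1', h2', h3'⟩ := hmax'.isRead hw1 (hc'.isRead hsw) hwne
      obtain rfl := h.prime_eq (by omega) hr1 h3 h3'
      have hz : ∀ u : List PNum, (∀ x ∈ u, (x.num : ℕ) ≤ m) → cn m.succPNat u = 0 := fun u hu =>
        (le_iff_cn u).1 hu _ (by simp)
      obtain rfl : a = a' := by
        rw [cn_append, cn_append, hz v2 h1, hz w2 h1'] at hcn
        simpa [cn_cons, cn] using hcn
      rw [ih (h.prefix (Nat.le_succ m) fun x hx => ?_) h1 h1' h2 h2' hr1]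
      simp only [List.mem_cons, un, List.map_replicate, List.mem_replicate] at hx
      rcases hx with rfl | ⟨-, rfl⟩ <;> simp

/-- The length of the first row is the maximal length of a hook subword, so the word itself
determines where the row ends. -/
theorem DT.read_injective {T T' : Tableau} (hT : DT T) (hT' : DT T') (h : read T = read T') :
    T = T' := by
  have hookRow : ∀ {r : List PNum}, ValidRow r → HookList (r.reverse.map PNum.num) := by
    intro r hr
    obtain ⟨J, m, q, E, e, hJ⟩ := hr.word
    rw [e]
    refine ⟨J, m :: E, by simp, hJ.dec, List.pairwise_cons.2 ⟨hJ.le_inc, hJ.inc⟩⟩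
  have hne : ∀ {r : List PNum}, ValidRow r → r ≠ [] := by
    rintro r ⟨D, m, q, I, rfl, -⟩ e
    simp [row] at e
  induction hT generalizing T' with
  | nil =>
    cases hT' with
    | nil => rfl
    | cons hr _ _ => simp [read_cons, hne hr] at h
  | @cons r T hr hb hT ih =>
    cases hT' with
    | nil => simp [read_cons, hne hr] at h
    | @cons r' T' hr' hb' hT' =>
      have h1 : r'.length ≤ r.length := by
        have := hb (r'.reverse.map PNum.num) (by
          rw [h, read_cons, List.map_append]; exact List.sublist_append_left _ _) (hookRow hr')
        simpa using this
      have h2 : r.length ≤ r'.length := by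
        have := hb' (r.reverse.map PNum.num) (by
          rw [← h, read_cons, List.map_append]; exact List.sublist_append_left _ _) (hookRow hr)
        simpa using this
      obtain ⟨h3, h4⟩ := List.append_inj h (by simp; omega)
      rw [List.reverse_inj.1 h3, ih hT' h4]

/-! ### Invariants of connected components -/

theorem isBisim_dec (m : ℕ) : IsBisim m Dec where
  cn_eq h k _ := h.cn k
  p0_eq _ _ _ h := h.p0
  setp _ _ _ h b := h.setp b
  f _ _ _ h := (h.posCompat _).2.2.1
  e _ _ _ h := (h.posCompat _).2.2.2
  fb _ _ _ h := h.barCompat.1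
  eb _ _ _ h := h.barCompat.2

theorem exists_le (w : List PNum) : ∃ m : ℕ, ∀ x ∈ w, (x.num : ℕ) ≤ m := by
  induction w with
  | nil => exact ⟨0, by simp⟩
  | cons x w ih =>
    obtain ⟨m, hm⟩ := ih
    refine ⟨max m x.num, fun y hy => ?_⟩
    rcases List.mem_cons.1 hy with rfl | hy
    · exact le_max_right _ _
    · exact (hm y hy).trans (le_max_left _ _)

theorem Dec.eq_of_isRead {v w : List PNum} (h : Dec v w) {s s' : List ℕ} (hv : IsRead s v)
    (hw : IsRead s' w) : v = w := by
  obtain ⟨m, hm⟩ := exists_le (v ++ w)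
  exact (isBisim_dec m).eq (fun x hx => hm x (by simp [hx])) (fun x hx => hm x (by simp [hx]))
    hv hw h

theorem Dec.Pdec_eq {v w : List PNum} (h : Dec v w) : Pdec v = Pdec w := by
  have hv := Pdec_spec v
  have hw := Pdec_spec w
  exact hv.1.read_injective hw.1
    (((hv.2.symm.trans h).trans hw.2).eq_of_isRead ⟨_, hv.1, rfl, rfl⟩ ⟨_, hw.1, rfl, rfl⟩)

/-! ### Shape and parity as invariants of a component -/

/-- The parity of the number of primes. -/
def par : List PNum → Bool
  | [] => false
  | x :: w => xor x.primed (par w)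

@[simp] theorem par_nil : par [] = false := rfl
@[simp] theorem par_cons (x : PNum) (w : List PNum) : par (x :: w) = xor x.primed (par w) := rfl
@[simp] theorem par_append (v w : List PNum) : par (v ++ w) = xor (par v) (par w) := by
  induction v with
  | nil => simp
  | cons x v ih => simp [ih]
@[simp] theorem par_reverse (v : List PNum) : par v.reverse = par v := by
  induction v with
  | nil => simp
  | cons x v ih => simp [ih, Bool.xor_comm]
@[simp] theorem par_un (l : List ℕ+) : par (un l) = false := by
  induction l with
  | nil => simp
  | cons x l ih => simp [ih]

theorem par_setp (b : Bool) (w : List PNum) : par (setp b w) = xor (par w) (xor b ((p0 w).getD b)) := by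
  induction w with
  | nil => simp [setp, p0]
  | cons x w ih =>
    simp only [setp, p0]
    split_ifs
    · obtain ⟨k, q⟩ := x
      cases b <;> cases q <;> simp
    · simp [ih]

theorem par_wF {i : ℕ+} {v w : List PNum} (h : wF i v = some w) : par w = par v := by
  obtain ⟨A, B, p, rfl, rfl, -⟩ := (wF_eq_some _ _ _).1 h
  simp

theorem par_wFb {v w : List PNum} (h : wFb v = some w) : par w = par v := by
  obtain ⟨A, B, p, -, rfl, rfl⟩ := (wFb_eq_some _ _).1 h
  simp only [par_append, par_cons, par_setp]
  cases p0 B with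
  | none => cases p <;> simp
  | some c => cases p <;> cases c <;> simp

theorem Dec.step {m : ℕ} {v v' w : List PNum} (h : Dec v w) (hs : Step m v v') :
    ∃ w', Step m w w' ∧ Dec v' w' ∧ xor (par v') (par w') = xor (par v) (par w) := by
  have hb := isBisim_dec m
  cases hs with
  | f hi hv =>
    obtain ⟨w', h1, h2⟩ := (hb.f hi h).some_left hv
    exact ⟨w', .f hi h1, h2, by rw [par_wF hv, par_wF h1]⟩
  | e hi hv =>
    obtain ⟨w', h1, h2⟩ := (hb.e hi h).some_left hv
    exact ⟨w', .e hi h1, h2, by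
      rw [par_wF ((wE_iff_wF _ _ _).1 hv), par_wF ((wE_iff_wF _ _ _).1 h1)]⟩
  | zero b v hm =>
    refine ⟨_, .zero b w hm, hb.setp hm h b, ?_⟩
    rw [par_setp, par_setp, h.p0]
    cases par v <;> cases par w <;> simp
  | fb hm hv =>
    obtain ⟨w', h1, h2⟩ := (hb.fb hm h).some_left hv
    exact ⟨w', .fb hm h1, h2, by rw [par_wFb hv, par_wFb h1]⟩
  | eb hm hv =>
    obtain ⟨w', h1, h2⟩ := (hb.eb hm h).some_left hv
    exact ⟨w', .eb hm h1, h2, by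
      rw [par_wFb ((wEb_iff_wFb _ _).1 hv), par_wFb ((wEb_iff_wFb _ _).1 h1)]⟩

/-- The congruence itself does not preserve parity, but a step changes the parities of congruent
words by the same amount. By rigidity, applying the step to the reading word of one tableau gives
the reading word of the other. -/
theorem Step.Pdec_invariants {m : ℕ} {v w : List PNum} (h : Step m v w) :
    shape (Pdec w) = shape (Pdec v) ∧
      xor (par w) (par (read (Pdec w))) = xor (par v) (par (read (Pdec v))) := by
  have hv := Pdec_spec v
  have hw := Pdec_spec w
  obtain ⟨x, hx, hd, hp⟩ := hv.2.step h
  have hr := hx.isRead (s := shape (Pdec v)) ⟨_, hv.1, rfl, rfl⟩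
  obtain ⟨T, hT, rfl, hs⟩ := hr
  have := (hw.2.symm.trans hd).eq_of_isRead ⟨_, hw.1, rfl, rfl⟩ ⟨_, hT, rfl, rfl⟩
  rw [← hw.1.read_injective hT this] at hp hs
  exact ⟨hs, hp⟩

theorem Conn.Pdec_invariants {m : ℕ} {v w : List PNum} (h : Conn m v w) :
    shape (Pdec w) = shape (Pdec v) ∧
      xor (par w) (par (read (Pdec w))) = xor (par v) (par (read (Pdec v))) := by
  induction h with
  | refl => exact ⟨rfl, rfl⟩
  | tail _ h ih =>
    have := h.Pdec_invariants
    exact ⟨this.1.trans ih.1, this.2.trans ih.2⟩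

/-- An operator acts on the tail, or on the head only, or on the head while re-priming the tail. In
each case the tails stay connected, which makes induction on the length possible. -/
theorem Step.tail {m : ℕ} {x y : PNum} {v w : List PNum} (h : Step m (x :: v) (y :: w)) :
    Conn m v w := by
  have hF : ∀ {i : ℕ+} {x y : PNum} {v w : List PNum}, wF i (x :: v) = some (y :: w) →
      wF i v = some w ∨ v = w := by
    intro i x y v w h
    rw [wF] at h
    split_ifs at h
    · rw [Option.map_eq_some_iff] at h
      obtain ⟨u, h1, h2⟩ := h
      simp only [List.cons.injEq] at h2
      exact .inl (h2.2 ▸ h1)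
    · simp only [Option.some.injEq, List.cons.injEq] at h
      exact .inr h.2
  have hFb : ∀ {x y : PNum} {v w : List PNum}, wFb (x :: v) = some (y :: w) →
      wFb v = some w ∨ ∃ b, setp b v = w := by
    intro x y v w h
    rw [wFb] at h
    split_ifs at h
    · simp only [Option.some.injEq, List.cons.injEq] at h
      exact .inr ⟨_, h.2⟩
    · rw [Option.map_eq_some_iff] at h
      obtain ⟨u, h1, h2⟩ := h
      simp only [List.cons.injEq] at h2
      exact .inl (h2.2 ▸ h1)
  have hEb : ∀ {x y : PNum} {v w : List PNum}, wEb (x :: v) = some (y :: w) →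
      wEb v = some w ∨ ∃ b, setp b v = w := by
    intro x y v w h
    rw [wEb] at h
    split_ifs at h
    · simp only [Option.some.injEq, List.cons.injEq] at h
      exact .inr ⟨_, h.2⟩
    · rw [Option.map_eq_some_iff] at h
      obtain ⟨u, h1, h2⟩ := h
      simp only [List.cons.injEq] at h2
      exact .inl (h2.2 ▸ h1)
  generalize e : x :: v = v', e' : y :: w = w' at h
  cases h with
  | f hi h =>
    subst e e'
    rcases hF h with h | rfl
    exacts [.single (.f hi h), .refl]
  | e hi h =>
    subst e e'
    rcases hF ((wE_iff_wF _ _ _).1 h) with h | rfl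
    exacts [.single (.e hi ((wE_iff_wF _ _ _).2 h)), .refl]
  | zero b _ hm =>
    subst e
    rw [setp] at e'
    split_ifs at e'
    · simp only [List.cons.injEq] at e'
      exact e'.2 ▸ .refl
    · simp only [List.cons.injEq] at e'
      exact e'.2 ▸ .single (.zero b v hm)
  | fb hm h =>
    subst e e'
    rcases hFb h with h | ⟨b, rfl⟩
    exacts [.single (.fb hm h), .single (.zero b v (by omega))]
  | eb hm h =>
    subst e e'
    rcases hEb h with h | ⟨b, rfl⟩
    exacts [.single (.eb hm h), .single (.zero b v (by omega))]

theorem Conn.tail_cons {m : ℕ} {x y : PNum} {v w : List PNum} (h : Conn m (x :: v) (y :: w)) :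
    Conn m v w := by
  generalize e : y :: w = w' at h
  induction h generalizing y w with
  | refl => simp only [List.cons.injEq] at e; exact e.2 ▸ .refl
  | @tail u u' _ h ih =>
    subst e
    cases u with
    | nil => have := h.length; simp at this
    | cons z u => exact (ih rfl).trans h.tail

/-! ### Insertion is injective on connected components -/

theorem split_unique {α : Type} {P : α → Prop} {A A' B B' : List α} {a a' : α}
    (h : A ++ a :: B = A' ++ a' :: B') (ha : P a) (ha' : P a') (hB : ∀ y ∈ B, ¬ P y)
    (hB' : ∀ y ∈ B', ¬ P y) : A = A' ∧ a = a' ∧ B = B' := by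
  rcases List.append_eq_append_iff.1 h with ⟨c, rfl, hc⟩ | ⟨c, rfl, hc⟩
  · cases c with
    | nil => simp at hc; exact ⟨by simp, hc.1, hc.2⟩
    | cons y c =>
      simp only [List.cons_append, List.cons.injEq] at hc
      exact absurd ha' (hB a' (by simp [hc.2]))
  · cases c with
    | nil => simp at hc; exact ⟨by simp, hc.1.symm, hc.2.symm⟩
    | cons y c =>
      simp only [List.cons_append, List.cons.injEq] at hc
      exact absurd ha (hB' a (by simp [hc.2]))

theorem row_injective {D D' I I' : List ℕ+} {m m' : ℕ+} {q q' : Bool} (h : RowOK D m I)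
    (h' : RowOK D' m' I') (e : row D m q I = row D' m' q' I') :
    D = D' ∧ m = m' ∧ q = q' ∧ I = I' := by
  have h1 : D ++ m :: I = D' ++ m' :: I' := by simpa using congrArg (List.map PNum.num) e
  have h2 : q = q' := by rw [← midPrimed_row q h, e, midPrimed_row q' h']
  have h3 : D.length = D'.length := by rw [← midIdx_row h, h1, midIdx_row h']
  obtain ⟨h4, h5⟩ := List.append_inj h1 h3
  simp only [List.cons.injEq] at h5
  exact ⟨h4, h5.1, h2, h5.2⟩

/-! ### Reversing an insertion -/

/-- The bumping cases of row insertion, described from the point of view of the new row. -/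
inductive Unbump (D1 : List ℕ+) (b : ℕ+) (R : List ℕ+) (m' : ℕ+) (q' : Bool) (I' : List ℕ+)
    (c : ℕ+) (pc : Bool) : List ℕ+ → ℕ+ → Bool → List ℕ+ → ℕ+ → Bool → Prop
  | mid : (∀ y ∈ I', b < y) → R = [] →
      Unbump D1 b R m' q' I' c pc D1 c pc (b :: I') m' q'
  | mid' (t I2 : List ℕ+) (x : ℕ+) : I' = t ++ x :: I2 → x ≤ b → (∀ y ∈ I2, b < y) → c < m' →
      R = [] → Unbump D1 b R m' q' I' c pc D1 c pc (m' :: t ++ b :: I2) x q'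
  | move (D2 : List ℕ+) (m : ℕ+) : (∀ y ∈ I', b < y) → R = D2 ++ [m] →
      Unbump D1 b R m' q' I' c pc (D1 ++ c :: D2) m pc (b :: I') m' q'
  | stay (I1 I2 : List ℕ+) (x : ℕ+) : I' = I1 ++ x :: I2 → x ≤ b → (∀ y ∈ I2, b < y) → m' ≤ c →
      Unbump D1 b R m' q' I' c pc (D1 ++ c :: R) m' q' (I1 ++ b :: I2) x pc

/-- Given the bumped value `c`, the entry `b` is recognised as the last entry of `D'` exceeding `c`,
since everything after it there is at most `c`. -/
theorem RowIns.unbump {D D' I I' : List ℕ+} {m m' x c : ℕ+} {q q' p pc : Bool}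
    (h : RowIns D m q I x p D' m' q' I' (some ⟨c, pc⟩)) (hr : RowOK D m I) :
    ∃ D1 b R, D' = D1 ++ b :: R ∧ c < b ∧ (∀ y ∈ R, y ≤ c) ∧
      Unbump D1 b R m' q' I' c pc D m q I x p := by
  obtain ⟨h1, h2, h3, h4⟩ := hr
  have hI2 : ∀ {I1 I2 : List ℕ+} {b : ℕ+}, I = I1 ++ b :: I2 → ∀ y ∈ I2, b < y := by
    rintro I1 I2 b rfl
    exact (List.pairwise_cons.1 (List.pairwise_append.1 h4).2.1).1
  cases h with
  | bump_mid I1 I2 t b _ hI hI1 hxb hD ht =>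
    refine ⟨D, b, [], rfl, h3 b (by simp [hI]), by simp, ?_⟩
    cases I1 with
    | nil =>
      simp only [List.nil_append, List.cons.injEq] at ht
      obtain ⟨rfl, rfl⟩ := ht
      rw [hI]
      exact .mid (hI2 hI) rfl
    | cons y I1 =>
      simp only [List.cons_append, List.cons.injEq] at ht
      obtain ⟨rfl, rfl⟩ := ht
      rw [hI]
      exact .mid' I1 I2 x (by simp) hxb (hI2 hI) (h3 _ (by simp [hI])) rfl
  | bump_move _ D1 D2 b _ hI hxm hD hD1 hc =>
    subst hD
    refine ⟨D1, b, D2 ++ [m], rfl, hc, ?_, ?_⟩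
    · have := (List.pairwise_cons.1 (List.pairwise_append.1 h1).2.1).1
      simp only [List.mem_append, List.mem_singleton]
      rintro y (hy | rfl)
      exacts [this y hy, h2 c (by simp)]
    · rw [hI]
      exact .move D2 m (hI2 (I1 := []) hI) rfl
  | bump_stay I1 I2 D1 D2 b _ hI hI1 hxb hmx hD hD1 hc =>
    subst hD
    refine ⟨D1, b, D2, rfl, hc, (List.pairwise_cons.1 (List.pairwise_append.1 h1).2.1).1, ?_⟩
    rw [hI]
    exact .stay I1 I2 x rfl hxb (hI2 hI) (h2 c (by simp))

/-- If `I'` has an entry at most `b`, the last such entry is `x`, and comparing `c` with `m'` tells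
whether the middle moved. If it has none, `x` is the middle element, and whether `R` is empty
decides between the two remaining cases. -/
theorem Unbump.unique {D1 R I' D I E J : List ℕ+} {b m' c m x k y : ℕ+} {q' pc q p s r : Bool}
    (h : Unbump D1 b R m' q' I' c pc D m q I x p) (h' : Unbump D1 b R m' q' I' c pc E k s J y r) :
    D = E ∧ m = k ∧ q = s ∧ I = J ∧ x = y ∧ p = r := by
  have key : ∀ {I1 I2 J1 J2 : List ℕ+} {x y : ℕ+}, I1 ++ x :: I2 = J1 ++ y :: J2 → x ≤ b → y ≤ b →
      (∀ z ∈ I2, b < z) → (∀ z ∈ J2, b < z) → I1 = J1 ∧ x = y ∧ I2 = J2 :=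
    fun e hx hy h1 h2 => split_unique (P := (· ≤ b)) e hx hy (fun z hz => (h1 z hz).not_ge)
      fun z hz => (h2 z hz).not_ge
  have no : ∀ {I1 I2 : List ℕ+} {x : ℕ+}, (∀ z ∈ I', b < z) → I' = I1 ++ x :: I2 → ¬ x ≤ b := by
    rintro I1 I2 x h rfl
    exact (h x (by simp)).not_ge
  cases h with
  | mid hI hR =>
    cases h' with
    | mid => simp
    | mid' t I2 x e hx => exact absurd hx (no hI e)
    | move D2 m _ e => simp [hR] at e
    | stay I1 I2 x e hx => exact absurd hx (no hI e)
  | mid' t I2 x e hx hI2 hc hR =>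
    cases h' with
    | mid hI => exact absurd hx (no hI e)
    | mid' t' I2' x' e' hx' hI2' =>
      obtain ⟨rfl, rfl, rfl⟩ := key (e.symm.trans e') hx hx' hI2 hI2'
      simp
    | move D2 m hI => exact absurd hx (no hI e)
    | stay I1 I2' x' e' hx' hI2' hc' => exact absurd hc hc'.not_gt
  | move D2 m hI hR =>
    cases h' with
    | mid _ e => simp [e] at hR
    | mid' t I2 x e hx => exact absurd hx (no hI e)
    | move D2' k' _ e =>
      obtain ⟨rfl, e'⟩ := List.append_inj' (hR.symm.trans e) rfl
      simp [List.head_eq_of_cons_eq e']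
    | stay I1 I2 x e hx => exact absurd hx (no hI e)
  | stay I1 I2 x e hx hI2 hc =>
    cases h' with
    | mid hI => exact absurd hx (no hI e)
    | mid' t' I2' x' e' hx' hI2' hc' => exact absurd hc' hc.not_gt
    | move D2 m hI => exact absurd hx (no hI e)
    | stay I1' I2' x' e' hx' hI2' hc' =>
      obtain ⟨rfl, rfl, rfl⟩ := key (e.symm.trans e') hx hx' hI2 hI2'
      simp

theorem RowIns.injective_some {D E D' I J I' : List ℕ+} {m k m' x y c : ℕ+} {q s q' p r pc : Bool}
    (h : RowIns D m q I x p D' m' q' I' (some ⟨c, pc⟩)) (hr : RowOK D m I)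
    (h' : RowIns E k s J y r D' m' q' I' (some ⟨c, pc⟩)) (hr' : RowOK E k J) :
    row D m q I = row E k s J ∧ x = y ∧ p = r := by
  obtain ⟨D1, b, R, rfl, hb, hR, hu⟩ := h.unbump hr
  obtain ⟨D1', b', R', e, hb', hR', hu'⟩ := h'.unbump hr'
  obtain ⟨rfl, rfl, rfl⟩ := split_unique (P := (c < ·)) e hb hb' (fun z hz => (hR z hz).not_gt)
    fun z hz => (hR' z hz).not_gt
  obtain ⟨rfl, rfl, rfl, rfl, rfl, rfl⟩ := hu.unique hu'
  simp

theorem par_row (D I : List ℕ+) (m : ℕ+) (q : Bool) : par (row D m q I) = q := by simp [row]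

/-- Adding a box keeps only one of the primes of `x` and `m`: at the increasing end that of `x` is
dropped, at the decreasing end that of `m`. Their parity restores the missing one. -/
theorem RowIns.injective_none {D E D' I J I' : List ℕ+} {m k m' x y : ℕ+} {q s q' p r : Bool}
    (h : RowIns D m q I x p D' m' q' I' none) (h' : RowIns E k s J y r D' m' q' I' none)
    (hp : xor p q = xor r s) : row D m q I = row E k s J ∧ x = y ∧ p = r := by
  cases h with
  | add_inc =>
    generalize eI : I ++ [x] = I' at h'
    cases h' with
    | add_inc =>
      obtain ⟨rfl, e⟩ := List.append_inj' eI rfl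
      simp only [List.cons.injEq, and_true] at e
      simp_all
    | add_dec => simp at eI
  | add_dec hI =>
    generalize eI : ([] : List ℕ+) = I', eD : D ++ [m] = D' at h'
    cases h' with
    | add_inc => simp at eI
    | add_dec hJ =>
      obtain ⟨rfl, e⟩ := List.append_inj' eD rfl
      simp only [List.cons.injEq, and_true] at e
      simp_all

theorem RowIns.par_some {D D' I I' : List ℕ+} {m m' x c : ℕ+} {q q' p pc : Bool}
    (h : RowIns D m q I x p D' m' q' I' (some ⟨c, pc⟩)) : xor p q = xor q' pc := by
  cases h <;> simp [Bool.xor_comm]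

theorem RowIns.length {D D' I I' : List ℕ+} {m m' x : ℕ+} {q q' p : Bool} {o : Option PNum}
    (h : RowIns D m q I x p D' m' q' I' o) : (row D' m' q' I').length =
      (row D m q I).length + if o = none then 1 else 0 := by
  cases h with
  | bump_mid I1 I2 t b _ hI hI1 hxb hD ht =>
    have := congrArg List.length ht
    subst hI
    simp at this ⊢
    omega
  | add_inc => simp; omega
  | add_dec h => subst h; simp
  | bump_move => subst_vars; simp; omega
  | bump_stay => subst_vars; simp

/-- Equal shapes force both insertions to halt in the same row. Each bump is reversible and
preserves parity, so the parity hypothesis arrives intact at the halting row, where it is used. -/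
theorem decInsert_injective {x y : PNum} {T U : Tableau} (hT : DT T) (hU : DT U)
    (hs : shape T = shape U) (h : decInsert x T = decInsert y U)
    (hp : xor x.primed (par (read T)) = xor y.primed (par (read U))) : x = y ∧ T = U := by
  induction T generalizing x y U with
  | nil =>
    obtain rfl : U = [] := by simpa [shape] using hs.symm
    have : ∀ z : PNum, row [] z.num z.primed [] = [z] := fun z => by simp [row]
    simpa [decInsert, rowInsert_nil, this] using h
  | cons r T ih =>
    cases U with
    | nil => simp [shape] at hs
    | cons r' U =>
    simp only [shape, List.map_cons, List.cons.injEq] at hs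
    cases hT with | cons hr _ hT =>
    cases hU with | cons hr' _ hU =>
    obtain ⟨D, m, q, I, rfl, hr⟩ := hr
    obtain ⟨E, k, s, J, rfl, hr'⟩ := hr'
    obtain ⟨x, p⟩ := x
    obtain ⟨y, t⟩ := y
    obtain ⟨D1, m1, q1, I1, o, hi, e⟩ := rowInsert_spec q x p hr
    obtain ⟨E1, k1, s1, J1, o', hi', e'⟩ := rowInsert_spec s y t hr'
    rw [decInsert, decInsert, e, e'] at h
    have hl := hi.length
    have hl' := hi'.length
    simp only [read_cons, par_append, par_reverse, par_row] at hp
    have hrow : row D1 m1 q1 I1 = row E1 k1 s1 J1 := by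
      cases o <;> cases o' <;> simp only [List.cons.injEq] at h <;> exact h.1
    obtain ⟨rfl, rfl, rfl, rfl⟩ := row_injective (hi.rowOK hr) (hi'.rowOK hr') hrow
    rw [hl, hs.1] at hl'
    cases o with
    | none =>
      cases o' with
      | some c => simp at hl'
      | none =>
        simp only [List.cons.injEq, true_and] at h
        subst h
        obtain ⟨h1, rfl, rfl⟩ := hi.injective_none hi' (by
          cases p <;> cases t <;> cases q <;> cases s <;> cases par (read T) <;> simp_all)
        exact ⟨rfl, by rw [h1]⟩
    | some c =>
      cases o' with
      | none => simp at hl'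
      | some c' =>
        simp only [List.cons.injEq, true_and] at h
        obtain ⟨rfl, rfl⟩ := ih hT hU hs.2 h (by
          have h1 := hi.par_some
          have h2 := hi'.par_some
          rw [← Bool.xor_assoc, ← Bool.xor_assoc, h1, h2] at hp
          simpa [Bool.xor_assoc] using hp)
        obtain ⟨h1, rfl, rfl⟩ := hi.injective_some hr hi' hr'
        exact ⟨rfl, by rw [h1]⟩

/-- Connected words have connected tails, hence tail tableaux of equal shape and equal parity
defect. The last insertion can thus be undone, and the induction continues with the tails. -/
theorem Conn.eq_of_Pdec_eq {m : ℕ} {v w : List PNum} (h : Conn m v w) (e : Pdec v = Pdec w) :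
    v = w := by
  induction v generalizing w with
  | nil => exact (List.length_eq_zero_iff.1 h.length).symm
  | cons x v ih =>
    cases w with
    | nil => have := h.length; simp at this
    | cons y w =>
      have ht := h.tail_cons
      have h1 := ht.Pdec_invariants
      have h2 := h.Pdec_invariants.2
      rw [e] at h2
      obtain ⟨rfl, h3⟩ := decInsert_injective (Pdec_spec v).1 (Pdec_spec w).1 h1.1.symm e (by
        have h3 := h1.2
        simp only [par_cons] at h2
        revert h2 h3
        generalize par v = a1
        generalize par w = a2
        generalize par (read (Pdec v)) = a3
        generalize par (read (Pdec w)) = a4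
        generalize par (read (Pdec (y :: w))) = a5
        generalize x.primed = a6
        generalize y.primed = a7
        revert a1 a2 a3 a4 a5 a6 a7
        decide)
      rw [ih ht h3]

/-! ### Crystals of words -/

theorem Step.symm {m : ℕ} {v w : List PNum} (h : Step m v w) : Step m w v := by
  cases h with
  | f hi h => exact .e hi ((wE_iff_wF _ _ _).2 h)
  | e hi h => exact .f hi ((wE_iff_wF _ _ _).1 h)
  | zero b v hm =>
    have : setp ((p0 v).getD b) (setp b v) = v := by
      rw [setp_setp]
      exact setp_of_p0 fun c hc => by simp [hc]
    have h := Step.zero ((p0 v).getD b) (setp b v) hm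
    rwa [this] at h
  | fb hm h => exact .eb hm ((wEb_iff_wFb _ _).2 h)
  | eb hm h => exact .fb hm ((wEb_iff_wFb _ _).1 h)

theorem Conn.symm {m : ℕ} {v w : List PNum} (h : Conn m v w) : Conn m w v := by
  induction h with
  | refl => exact .refl
  | tail _ h ih => exact .head h.symm ih

/-- The lowering operators on words. -/
def opF {n : ℕ} : Idx n → List PNum → Option (List PNum)
  | .bar, w => wFb w
  | .zero, w => if p0 w = some false then some (setp true w) else none
  | .pos i, w => wF i.1.succPNat w

/-- The raising operators on words. -/
def opE {n : ℕ} : Idx n → List PNum → Option (List PNum)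
  | .bar, w => wEb w
  | .zero, w => if p0 w = some true then some (setp false w) else none
  | .pos i, w => wE i.1.succPNat w

theorem opE_iff_opF {n : ℕ} (i : Idx n) (v w : List PNum) :
    opE i v = some w ↔ opF i w = some v := by
  cases i with
  | bar => exact wEb_iff_wFb v w
  | pos i => exact wE_iff_wF _ v w
  | zero =>
    have key : ∀ (b : Bool) (v w : List PNum), p0 v = some b → setp (!b) v = w →
        p0 w = some (!b) ∧ setp b w = v := by
      rintro b v w h rfl
      rw [p0_setp, setp_setp, h]
      exact ⟨rfl, setp_of_p0 fun c hc => by simpa [h] using hc⟩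
    simp only [opE, opF, Option.ite_none_right_eq_some, Option.some.injEq]
    exact ⟨fun h => key true v w h.1 h.2, fun h => key false w v h.1 h.2⟩

theorem opF_step {n : ℕ} (hn : 2 ≤ n) {i : Idx n} {v w : List PNum} (h : opF i v = some w) :
    Step n v w := by
  cases i with
  | bar => exact .fb hn h
  | zero =>
    simp only [opF, Option.ite_none_right_eq_some, Option.some.injEq] at h
    exact h.2 ▸ .zero true v (by omega)
  | pos i =>
    have := i.2
    exact .f (by simp; omega) h

/-- Re-priming the leftmost 1 either does nothing or is an honest operator of index zero. -/
theorem Step.opF_or {n : ℕ} {v w : List PNum} (h : Step n v w) :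
    v = w ∨ ∃ i : Idx n, opF i v = some w ∨ opF i w = some v := by
  have hidx : ∀ i : ℕ+, (i : ℕ) < n → ∃ j : Fin (n - 1), j.1.succPNat = i := fun i hi =>
    ⟨⟨i - 1, by have := i.pos; omega⟩, PNat.coe_injective (by have := i.pos; simp; omega)⟩
  cases h with
  | f hi h =>
    obtain ⟨j, rfl⟩ := hidx _ hi
    exact .inr ⟨.pos j, .inl h⟩
  | e hi h =>
    obtain ⟨j, rfl⟩ := hidx _ hi
    exact .inr ⟨.pos j, .inr ((wE_iff_wF _ _ _).1 h)⟩
  | fb _ h => exact .inr ⟨.bar, .inl h⟩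
  | eb _ h => exact .inr ⟨.bar, .inr ((wEb_iff_wFb _ _).1 h)⟩
  | zero b _ hm =>
    by_cases h : p0 v = some (!b)
    · refine .inr ⟨.zero, ?_⟩
      cases b with
      | true => exact .inl (by simpa [opF] using h)
      | false => exact .inr ((opE_iff_opF _ _ _).1 (by simpa [opE] using h))
    · refine .inl (setp_of_p0 fun c hc => ?_).symm
      rw [hc] at h
      cases b <;> cases c <;> simp_all

theorem IsBisim.opF {n : ℕ} (hn : 2 ≤ n) {R : List PNum → List PNum → Prop} (h : IsBisim n R)
    {v w : List PNum} (hr : R v w) (i : Idx n) : Option.Rel R (opF i v) (opF i w) := by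
  cases i with
  | bar => exact h.fb hn hr
  | pos i =>
    have := i.2
    exact h.f (by simp; omega) hr
  | zero =>
    simp only [QueerPlus.opF, h.p0_eq (by omega) hr]
    split_ifs
    · exact .some (h.setp (by omega) hr _)
    · exact .none

theorem IsBisim.opE {n : ℕ} (hn : 2 ≤ n) {R : List PNum → List PNum → Prop} (h : IsBisim n R)
    {v w : List PNum} (hr : R v w) (i : Idx n) : Option.Rel R (opE i v) (opE i w) := by
  cases i with
  | bar => exact h.eb hn hr
  | pos i =>
    have := i.2
    exact h.e (by simp; omega) hr
  | zero =>
    simp only [QueerPlus.opE, h.p0_eq (by omega) hr]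
    split_ifs
    · exact .some (h.setp (by omega) hr _)
    · exact .none

theorem isBisim_of_op {n : ℕ} {R : List PNum → List PNum → Prop}
    (hcn : ∀ {v w}, R v w → ∀ k : ℕ+, (k : ℕ) ≤ n → cn k v = cn k w)
    (hF : ∀ {v w}, R v w → ∀ i : Idx n, Option.Rel R (opF i v) (opF i w))
    (hE : ∀ {v w}, R v w → ∀ i : Idx n, Option.Rel R (opE i v) (opE i w)) : IsBisim n R := by
  have hidx : ∀ i : ℕ+, (i : ℕ) < n → ∃ j : Fin (n - 1), j.1.succPNat = i := fun i hi =>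
    ⟨⟨i - 1, by have := i.pos; omega⟩, PNat.coe_injective (by have := i.pos; simp; omega)⟩
  -- Which of the two operators of index zero vanish tells whether there is a leftmost 1 and whether
  -- it is primed.
  have hp : ∀ {v w}, R v w → p0 v = p0 w := by
    intro v w hr
    have h1 := (hF hr .zero).none_iff
    have h2 := (hE hr .zero).none_iff
    simp only [opF, opE] at h1 h2
    rcases hv : p0 v with _ | _ | _ <;> rcases hw : p0 w with _ | _ | _ <;> simp_all
  refine ⟨hcn, fun _ _ _ => hp, fun _ v w hr b => ?_, ?_, ?_, fun _ _ _ hr => hF hr .bar,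
    fun _ _ _ hr => hE hr .bar⟩
  · by_cases h : p0 v = some (!b)
    · have h' := hp hr ▸ h
      cases b with
      | true =>
        have := hF hr .zero
        simp only [opF, h, h', Bool.not_true, if_true] at this
        cases this with | some h => exact h
      | false =>
        have := hE hr .zero
        simp only [opE, h, h', Bool.not_false, if_true] at this
        cases this with | some h => exact h
    · have key : ∀ c, p0 v = some c → b = c := fun c hc => by
        rw [hc] at h
        cases b <;> cases c <;> simp_all
      rw [setp_of_p0 key, setp_of_p0 (hp hr ▸ key)]
      exact hr
  · intro i hi v w hr
    obtain ⟨j, rfl⟩ := hidx i hi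
    exact hF hr (.pos j)
  · intro i hi v w hr
    obtain ⟨j, rfl⟩ := hidx i hi
    exact hE hr (.pos j)

theorem _root_.Option.Rel.comp {α : Type} {R S : α → α → Prop} {x y z : Option α}
    (h : Option.Rel R x y) (h' : Option.Rel S y z) :
    Option.Rel (fun a c => ∃ b, R a b ∧ S b c) x z := by
  cases h with
  | none => cases h' with | none => exact .none
  | some h => cases h' with | some h' => exact .some ⟨_, h, h'⟩

theorem IsBisim.comp {m : ℕ} {R S : List PNum → List PNum → Prop} (h : IsBisim m R)
    (h' : IsBisim m S) : IsBisim m (fun u w => ∃ v, R u v ∧ S v w) where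
  cn_eq := fun ⟨_, h1, h2⟩ k hk => (h.cn_eq h1 k hk).trans (h'.cn_eq h2 k hk)
  p0_eq hm _ _ := fun ⟨_, h1, h2⟩ => (h.p0_eq hm h1).trans (h'.p0_eq hm h2)
  setp hm _ _ := fun ⟨_, h1, h2⟩ b => ⟨_, h.setp hm h1 b, h'.setp hm h2 b⟩
  f hi _ _ := fun ⟨_, h1, h2⟩ => (h.f hi h1).comp (h'.f hi h2)
  e hi _ _ := fun ⟨_, h1, h2⟩ => (h.e hi h1).comp (h'.e hi h2)
  fb hm _ _ := fun ⟨_, h1, h2⟩ => (h.fb hm h1).comp (h'.fb hm h2)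
  eb hm _ _ := fun ⟨_, h1, h2⟩ => (h.eb hm h1).comp (h'.eb hm h2)

/-- The map `g` identifies the crystal `X` with the connected component of the word `v`. -/
structure IsWordModel (n : ℕ) (v : List PNum) (X : Crystal n) (g : X.Carrier → List PNum) :
    Prop where
  injective : Function.Injective g
  conn : ∀ x, Conn n v (g x)
  surj : ∀ u, Conn n v u → ∃ x, g x = u
  map_f : ∀ i x, (X.f i x).map g = opF i (g x)
  map_e : ∀ i x, (X.e i x).map g = opE i (g x)
  wt_eq : ∀ x k, X.wt x k = cn k.1.succPNat (g x)

/-- Each element is sent to the congruent element of the other component. It exists by bisimilarity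
and is unique because a component contains no two distinct congruent words; compatibility with the
operators then follows from uniqueness. -/
theorem IsWordModel.exists_iso {n : ℕ} (hn : 2 ≤ n) {v w : List PNum} {X Y : Crystal n}
    {g : X.Carrier → List PNum} {g' : Y.Carrier → List PNum} (hX : IsWordModel n v X g)
    (hY : IsWordModel n w Y g') {x : X.Carrier} {y : Y.Carrier} (hx : g x = v) (hy : g' y = w)
    (h : Dec v w) : ∃ φ : X.Carrier → Y.Carrier, IsCrystalIso X Y φ ∧ φ x = y := by
  have hb := isBisim_dec n
  have uniq : ∀ {u v v' : List PNum}, Conn n u v → Conn n u v' → Dec v v' → v = v' :=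
    fun h1 h2 hd => Conn.eq_of_Pdec_eq (h1.symm.trans h2) hd.Pdec_eq
  have uX : ∀ {a b}, Dec (g a) (g b) → a = b := fun hd =>
    hX.injective (uniq (hX.conn _) (hX.conn _) hd)
  have uY : ∀ {a b}, Dec (g' a) (g' b) → a = b := fun hd =>
    hY.injective (uniq (hY.conn _) (hY.conn _) hd)
  have h1 : ∀ a, ∃ b, Dec (g a) (g' b) := fun a => by
    obtain ⟨u, hu, hd, -⟩ := hb.conn h (hX.conn a)
    obtain ⟨b, rfl⟩ := hY.surj u hu
    exact ⟨b, hd⟩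
  have h2 : ∀ b, ∃ a, Dec (g a) (g' b) := fun b => by
    obtain ⟨u, hu, hd, -⟩ := hb.conn h.symm (hY.conn b)
    obtain ⟨a, rfl⟩ := hX.surj u hu
    exact ⟨a, hd.symm⟩
  choose φ hφ using h1
  have hop : ∀ {a : Option X.Carrier} {b : Option Y.Carrier},
      Option.Rel Dec (a.map g) (b.map g') → b = a.map φ := by
    intro a b hab
    cases a <;> cases b
    · rfl
    · cases hab
    · cases hab
    · cases hab with
      | some hd => exact congrArg some (uY (hd.symm.trans (hφ _)))
  refine ⟨φ, ⟨⟨fun a b hab => uX ?_, fun b => ?_⟩, fun a => ?_, fun i a => ?_, fun i a => ?_⟩, ?_⟩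
  · exact (hφ a).trans (hab ▸ (hφ b).symm)
  · obtain ⟨a, ha⟩ := h2 b
    exact ⟨a, uY ((hφ a).symm.trans ha)⟩
  · funext k
    rw [hX.wt_eq, hY.wt_eq, (hφ a).cn]
  · apply hop
    rw [hX.map_e, hY.map_e]
    exact hb.opE hn (hφ a) i
  · apply hop
    rw [hX.map_f, hY.map_f]
    exact hb.opF hn (hφ a) i
  · exact uY ((hφ x).symm.trans (by rw [hx, hy]; exact h))

theorem IsWordModel.Pdec_eq {n : ℕ} {v w : List PNum} {X Y : Crystal n}
    {g : X.Carrier → List PNum} {g' : Y.Carrier → List PNum} (hX : IsWordModel n v X g)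
    (hY : IsWordModel n w Y g') {x : X.Carrier} (hx : g x = v)
    (hv : ∀ a ∈ v, (a.num : ℕ) ≤ n) (hw : ∀ a ∈ w, (a.num : ℕ) ≤ n)
    {φ : X.Carrier → Y.Carrier} (hφ : IsCrystalIso X Y φ) (hy : g' (φ x) = w) :
    Pdec v = Pdec w := by
  have hop : ∀ {a : Option X.Carrier} {b : Option Y.Carrier}, b = a.map φ →
      Option.Rel (fun u u' => ∃ a, g a = u ∧ g' (φ a) = u') (a.map g) (b.map g') := by
    rintro (_ | a) _ rfl
    · exact .none
    · exact .some ⟨a, rfl, rfl⟩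
  -- The graph of the isomorphism, transported to words, is a bisimulation.
  have hR : IsBisim n (fun u u' => ∃ a, g a = u ∧ g' (φ a) = u') := by
    refine isBisim_of_op ?_ ?_ ?_
    · rintro _ _ ⟨a, rfl, rfl⟩ k hk
      obtain ⟨j, rfl⟩ : ∃ j : Fin n, j.1.succPNat = k :=
        ⟨⟨k - 1, by have := k.pos; omega⟩, PNat.coe_injective (by have := k.pos; simp; omega)⟩
      have := congrFun (hφ.wt_eq a) j
      rw [hX.wt_eq, hY.wt_eq] at this
      exact_mod_cast this.symm
    · rintro _ _ ⟨a, rfl, rfl⟩ i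
      rw [← hX.map_f, ← hY.map_f]
      exact hop (hφ.map_f i a)
    · rintro _ _ ⟨a, rfl, rfl⟩ i
      rw [← hX.map_e, ← hY.map_e]
      exact hop (hφ.map_e i a)
  have hd := isBisim_dec n
  have key : ∀ {u : List PNum}, (∀ a ∈ u, (a.num : ℕ) ≤ n) →
      ∀ a ∈ read (Pdec u), (a.num : ℕ) ≤ n := fun {u} hu => by
    rw [le_iff_cn] at hu ⊢
    exact fun k hk => ((Pdec_spec u).2.cn k).symm.trans (hu k hk)
  refine (Pdec_spec v).1.read_injective (Pdec_spec w).1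
    (((hd.comp hR).comp hd).eq (key hv) (key hw) ⟨_, (Pdec_spec v).1, rfl, rfl⟩
      ⟨_, (Pdec_spec w).1, rfl, rfl⟩ ?_)
  exact ⟨w, ⟨v, (Pdec_spec v).2.symm, x, hx, hy⟩, (Pdec_spec w).2⟩

/-! ### Tensor powers of the standard crystal -/

/-- A counter that drops by one at each application and vanishes exactly where the operator does
must be the string length. -/
theorem stringLength_eq {B : Type} (g : B → Option B) (l : B → ℕ) (h0 : ∀ b, g b = none ↔ l b = 0)
    (h1 : ∀ b c, g b = some c → l b = l c + 1) (b : B) : stringLength g b = l b := by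
  have hit : ∀ k c, iter g k b = some c → l b = l c + k := by
    intro k
    induction k with
    | zero => simp [iter]
    | succ k ih =>
      intro c hc
      rw [iter, Option.bind_eq_some_iff] at hc
      obtain ⟨d, hd, hc⟩ := hc
      rw [ih d hd, h1 d c hc]; omega
  have hne : ∀ k, k ≤ l b → iter g k b ≠ none := by
    intro k
    induction k with
    | zero => simp [iter]
    | succ k ih =>
      intro hk
      obtain ⟨d, hd⟩ := Option.ne_none_iff_exists'.1 (ih (by omega))
      have := hit k d hd
      rw [iter, hd, Option.bind_some, Ne, h0]
      omega
  apply le_antisymm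
  · refine iSup₂_le fun k hk => ?_
    obtain ⟨d, hd⟩ := Option.ne_none_iff_exists'.1 hk
    have := hit k d hd
    exact_mod_cast (by omega : k ≤ l b)
  · exact le_iSup₂ (f := fun (k : ℕ) (_ : iter g k b ≠ none) => (k : ℕ∞)) (l b) (hne _ le_rfl)

/-- The lowering operators on letters. -/
def letF {n : ℕ} : Idx n → PNum → Option PNum
  | .bar, x => if x.num = 1 then some ⟨2, x.primed⟩ else none
  | .zero, x => if x = ⟨1, false⟩ then some ⟨1, true⟩ else none
  | .pos i, x => if x.num = i.1.succPNat then some ⟨i.1.succPNat + 1, x.primed⟩ else none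

/-- The raising operators on letters. -/
def letE {n : ℕ} : Idx n → PNum → Option PNum
  | .bar, x => if x.num = 2 then some ⟨1, x.primed⟩ else none
  | .zero, x => if x = ⟨1, true⟩ then some ⟨1, false⟩ else none
  | .pos i, x => if x.num = i.1.succPNat + 1 then some ⟨i.1.succPNat, x.primed⟩ else none

/-- The map `l` turns the operators of the crystal `B` into those on letters. -/
structure IsLetterModel {n : ℕ} (B : Crystal n) (l : B.Carrier → PNum) : Prop where
  map_f : ∀ i b, (B.f i b).map l = letF i (l b)
  map_e : ∀ i b, (B.e i b).map l = letE i (l b)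

/-- The map `g` turns the operators of the crystal `C` into those on words. -/
structure IsOpModel {n : ℕ} (C : Crystal n) (g : C.Carrier → List PNum) : Prop where
  map_f : ∀ i c, (C.f i c).map g = opF i (g c)
  map_e : ∀ i c, (C.e i c).map g = opE i (g c)

theorem toLetter_map {n : ℕ} (x : PNum) (h : (x.num : ℕ) ≤ n) :
    (toLetter n x).map Subtype.val = some x := by simp [toLetter, h]

theorem isLetterModel_std {n : ℕ} (hn : 2 ≤ n) :
    IsLetterModel (stdCrystal n) (Subtype.val : {x : PNum // (x.num : ℕ) ≤ n} → PNum) := by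
  have key : ∀ (P Q : Prop) [Decidable P] [Decidable Q] (x : PNum), (x.num : ℕ) ≤ n → (P ↔ Q) →
      (if P then toLetter n x else none).map Subtype.val = if Q then some x else none := by
    intro P Q _ _ x hx hPQ
    by_cases h : P
    · rw [if_pos h, if_pos (hPQ.1 h), toLetter_map x hx]
    · rw [if_neg h, if_neg (mt hPQ.2 h)]; rfl
  have h1 : 1 ≤ n := by omega
  constructor
  · rintro (_ | _ | i) x
    · exact key _ _ _ hn Iff.rfl
    · exact key _ _ _ h1 Iff.rfl
    · have hi := i.2
      have h2 : ((x.1.num : ℕ) = i + 1) ↔ x.1.num = i.1.succPNat := by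
        rw [← PNat.coe_inj]; simp
      change (if (x.1.num : ℕ) = i + 1 then toLetter n ⟨x.1.num + 1, x.1.primed⟩ else none).map
        Subtype.val = _
      by_cases h : x.1.num = i.1.succPNat
      · have h3 := key ((x.1.num : ℕ) = i + 1) _ ⟨x.1.num + 1, x.1.primed⟩
          (by rw [h]; simp; omega) h2
        rw [h3, h]
        simp [letF, h]
      · rw [if_neg (mt h2.1 h)]
        simp [letF, h]
  · rintro (_ | _ | i) x
    · exact key _ _ _ h1 Iff.rfl
    · exact key _ _ _ h1 Iff.rfl
    · have hi := i.2
      exact key _ _ _ (by simp; omega) (by rw [← PNat.coe_inj]; simp)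

section

variable {n : ℕ} {B C : Crystal n} {l : B.Carrier → PNum} {g : C.Carrier → List PNum}

theorem IsLetterModel.eps (hB : IsLetterModel B l) (i : Fin (n - 1)) (b : B.Carrier) :
    stringLength (B.e (.pos i)) b = epsL i.1.succPNat (l b) := by
  refine stringLength_eq _ (fun b => epsL i.1.succPNat (l b)) (fun b => ?_) (fun b c h => ?_) b
  · rw [← Option.map_eq_none_iff (f := l), hB.map_e]
    simp [epsL, letE]
  · have := hB.map_e (.pos i) b
    rw [h] at this
    simp only [Option.map_some, letE] at this
    split_ifs at this with hb
    simp only [Option.some.injEq] at this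
    simp [epsL, this, hb, (PNat.succ_ne _).symm]

theorem IsOpModel.phi (hC : IsOpModel C g) (i : Fin (n - 1)) (c : C.Carrier) :
    stringLength (C.f (.pos i)) c = QueerPlus.phi i.1.succPNat (g c) := by
  refine stringLength_eq _ (fun c => QueerPlus.phi i.1.succPNat (g c)) (fun c => ?_)
    (fun c d h => ?_) c
  · rw [← Option.map_eq_none_iff (f := g), hC.map_f]
    exact wF_eq_none _ _
  · have := hC.map_f (.pos i) c
    rw [h] at this
    exact (wF_phi this.symm).1

theorem tens_map (x : Option B.Carrier) (y : Option C.Carrier) :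
    (tens x y).map (fun z => l z.1 :: g z.2) = (x.map l).bind fun a => (y.map g).map (a :: ·) := by
  cases x <;> cases y <;> rfl

theorem IsOpModel.tensor (hB : IsLetterModel B l) (hC : IsOpModel C g) :
    IsOpModel (QueerPlus.tensor B C) (fun z : B.Carrier × C.Carrier => l z.1 :: g z.2) := by
  have hl : ∀ o : Option B.Carrier, o = none ↔ o.map l = none := fun o => by simp
  have hg : ∀ o : Option C.Carrier, o = none ↔ o.map g = none := fun o => by simp
  have hbind : ∀ (a : Option B.Carrier) (op : B.Carrier → Option B.Carrier)
      (op' : PNum → Option PNum), (∀ b, (op b).map l = op' (l b)) →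
      (a.bind op).map l = (a.map l).bind op' := by
    rintro (_ | a) op op' h
    exacts [rfl, h _]
  have hF0 : ∀ a : Option B.Carrier, (a.bind (B.f .zero)).map l = (a.map l).bind (letF (n := n) .zero) :=
    fun a => hbind _ _ _ (hB.map_f .zero)
  have hE0 : ∀ a : Option B.Carrier, (a.bind (B.e .zero)).map l = (a.map l).bind (letE (n := n) .zero) :=
    fun a => hbind _ _ _ (hB.map_e .zero)
  have hFb : ∀ a : Option B.Carrier, (a.bind (B.f .bar)).map l = (a.map l).bind (letF (n := n) .bar) :=
    fun a => hbind _ _ _ (hB.map_f .bar)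
  constructor
  · rintro (_ | _ | i) ⟨b, c⟩
    · simp only [QueerPlus.tensor, Ne, hl, hg, apply_ite (Option.map _), tens_map, hF0, hE0, hFb,
        hB.map_f, hB.map_e, hC.map_f, hC.map_e, Option.map_some]
      generalize l b = x
      generalize g c = w
      obtain ⟨a, p⟩ := x
      by_cases h1 : a = 1
      · subst h1
        -- The two middle clauses of the tensor rule apply exactly when the next 1 exists and its
        -- prime differs from that of the head. They then exchange the primes; equal primes need no
        -- exchange.
        rcases hw : p0 w with _ | _ | _ <;> cases p <;>
          simp [letF, letE, opF, opE, wFb, hw, setp_of_p0]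
      · by_cases h2 : a = 2
        · subst h2
          simp [letF, letE, opF, wFb]
        · simp [letF, letE, opF, wFb, h1, h2]
    · simp only [QueerPlus.tensor, hl, apply_ite (Option.map _), tens_map,
        hB.map_f, hB.map_e, hC.map_f, Option.map_some]
      generalize l b = x
      generalize g c = w
      obtain ⟨a, p⟩ := x
      by_cases h1 : a = 1
      · subst h1
        cases p <;> simp [letF, letE, opF, p0, setp]
      · simp [letF, letE, opF, p0, setp, h1, apply_ite (Option.map _)]
    · simp only [QueerPlus.tensor, hB.eps, hC.phi, apply_ite (Option.map _), tens_map,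
        hB.map_f, hC.map_f, Option.map_some, Nat.cast_lt]
      simp only [opF, wF, letF]
      split_ifs <;> simp
  · rintro (_ | _ | i) ⟨b, c⟩
    · simp only [QueerPlus.tensor, Ne, hl, hg, apply_ite (Option.map _), tens_map, hF0, hE0, hFb,
        hB.map_f, hB.map_e, hC.map_f, hC.map_e, Option.map_some]
      generalize l b = x
      generalize g c = w
      obtain ⟨a, p⟩ := x
      by_cases h1 : a = 2
      · subst h1
        rcases hw : p0 w with _ | _ | _ <;> cases p <;>
          simp [letF, letE, opF, opE, wEb, hw, setp_of_p0]
      · by_cases h2 : a = 1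
        · subst h2
          cases p <;> simp [letF, letE, opE, wEb]
        · simp [letF, letE, opE, wEb, h1, h2]
    · simp only [QueerPlus.tensor, hl, apply_ite (Option.map _), tens_map,
        hB.map_f, hB.map_e, hC.map_e, Option.map_some]
      generalize l b = x
      generalize g c = w
      obtain ⟨a, p⟩ := x
      by_cases h1 : a = 1
      · subst h1
        cases p <;> simp [letF, letE, opE, p0, setp]
      · simp [letF, letE, opE, p0, setp, h1, apply_ite (Option.map _)]
    · simp only [QueerPlus.tensor, hB.eps, hC.phi, apply_ite (Option.map _), tens_map,
        hB.map_e, hC.map_e, Option.map_some, Nat.cast_le]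
      simp only [opE, wE, letE]
      split_ifs <;> simp

end

/-- The word underlying an element of a tensor power. -/
def toWord (n : ℕ) : (k : ℕ) → (tensorPow (stdCrystal n) k).Carrier → List PNum
  | 0, _ => []
  | k + 1, b => b.1.1 :: toWord n k b.2

theorem toWord_injective (n k : ℕ) : Function.Injective (toWord n k) := by
  induction k with
  | zero => exact fun _ _ _ => rfl
  | succ k ih =>
    rintro ⟨x, b⟩ ⟨y, c⟩ h
    simp only [toWord, List.cons.injEq] at h
    exact Prod.ext (Subtype.ext h.1) (ih h.2)

theorem toWord_wordTensor {n : ℕ} (w : List PNum) (h : ∀ x ∈ w, (x.num : ℕ) ≤ n) :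
    toWord n w.length (wordTensor n w h) = w := by
  induction w with
  | nil => rfl
  | cons x w ih => exact congrArg (x :: ·) (ih fun y hy => h y (List.mem_cons_of_mem x hy))

theorem toWord_wt {n k : ℕ} (b : (tensorPow (stdCrystal n) k).Carrier) (j : Fin n) :
    (tensorPow (stdCrystal n) k).wt b j = cn j.1.succPNat (toWord n k b) := by
  induction k with
  | zero => rfl
  | succ k ih =>
    obtain ⟨x, b⟩ := b
    have : ((x.1.num : ℕ) = j + 1) ↔ x.1.num = j.1.succPNat := by
      rw [← PNat.coe_inj]; simp
    have h1 : (stdCrystal n).wt x j = if x.1.num = j.1.succPNat then 1 else 0 := by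
      simp only [← this]; rfl
    change (stdCrystal n).wt x j + (tensorPow (stdCrystal n) k).wt b j =
      cn j.1.succPNat (x.1 :: toWord n k b)
    rw [ih, h1, cn_cons]
    push_cast
    ring

theorem isOpModel_toWord {n : ℕ} (hn : 2 ≤ n) (k : ℕ) :
    IsOpModel (tensorPow (stdCrystal n) k) (toWord n k) := by
  induction k with
  | zero => constructor <;> rintro (_ | _ | i) _ <;> rfl
  | succ k ih => exact .tensor (isLetterModel_std hn) ih

/-- The word underlying an element of a full subcrystal of a tensor power. -/
def subWord (n : ℕ) (k : ℕ) (b : (tensorPow (stdCrystal n) k).Carrier)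
    (x : (fullSubcrystal (tensorPow (stdCrystal n) k) b).Carrier) : List PNum := toWord n k x.1

open Classical in
theorem restrict_map {α β : Type} {S : Set α} {o : Option α} (g : α → β)
    (h : ∀ y, o = some y → y ∈ S) :
    (o.bind fun y => if h : y ∈ S then some (⟨y, h⟩ : S) else none).map (fun x => g x.1) =
      o.map g := by
  cases o with
  | none => rfl
  | some y => simp [h y rfl]

theorem isWordModel_subWord {n : ℕ} (hn : 2 ≤ n) {k : ℕ}
    (b : (tensorPow (stdCrystal n) k).Carrier) :
    IsWordModel n (toWord n k b) (fullSubcrystal (tensorPow (stdCrystal n) k) b)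
      (subWord n k b) := by
  have hop := isOpModel_toWord hn k
  have hinj := toWord_injective n k
  have hsome : ∀ {o : Option (tensorPow (stdCrystal n) k).Carrier} {y},
      o.map (toWord n k) = some (toWord n k y) → o = some y := fun h => by
    rw [Option.map_eq_some_iff] at h
    obtain ⟨z, h1, h2⟩ := h
    rw [h1, hinj h2]
  have hef : ∀ {i x y}, (tensorPow (stdCrystal n) k).e i x = some y →
      (tensorPow (stdCrystal n) k).f i y = some x := by
    intro i x y h
    have := hop.map_e i x
    rw [h] at this
    exact hsome ((hop.map_f i y).trans ((opE_iff_opF _ _ _).1 this.symm))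
  have hconn : ∀ {x}, x ∈ component (tensorPow (stdCrystal n) k) b →
      Conn n (toWord n k b) (toWord n k x) := by
    intro x hx
    have : ∀ {a c}, Relation.EqvGen
        (fun x y => ∃ i, (tensorPow (stdCrystal n) k).f i x = some y) a c →
        Conn n (toWord n k a) (toWord n k c) := by
      intro a c h
      induction h with
      | rel x y h =>
        obtain ⟨i, h⟩ := h
        have := hop.map_f i x
        rw [h] at this
        exact .single (opF_step hn this.symm)
      | refl => exact .refl
      | symm _ _ _ ih => exact Conn.symm ih
      | trans _ _ _ _ _ ih ih' => exact Relation.ReflTransGen.trans ih ih'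
    exact this hx
  have hF : ∀ {i x y}, x ∈ component (tensorPow (stdCrystal n) k) b →
      (tensorPow (stdCrystal n) k).f i x = some y →
      y ∈ component (tensorPow (stdCrystal n) k) b := fun hx h =>
    Relation.EqvGen.trans _ _ _ hx (.rel _ _ ⟨_, h⟩)
  have hE : ∀ {i x y}, x ∈ component (tensorPow (stdCrystal n) k) b →
      (tensorPow (stdCrystal n) k).f i y = some x →
      y ∈ component (tensorPow (stdCrystal n) k) b := fun hx h =>
    Relation.EqvGen.trans _ _ _ hx (.symm _ _ (.rel _ _ ⟨_, h⟩))
  refine ⟨fun x y h => Subtype.ext (hinj h), fun x => hconn x.2, fun u hu => ?_, fun i x => ?_,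
    fun i x => ?_, fun x j => toWord_wt x.1 j⟩
  -- Surjectivity: follow a path of word operators inside the crystal, one edge at a time, forwards
  -- or backwards.
  · induction hu with
    | refl => exact ⟨base _ b, rfl⟩
    | tail _ h ih =>
      obtain ⟨x, rfl⟩ := ih
      rcases h.opF_or with rfl | ⟨i, h | h⟩
      · exact ⟨x, rfl⟩
      · have h1 := (hop.map_f i x.1).trans h
        rw [Option.map_eq_some_iff] at h1
        obtain ⟨y, h1, rfl⟩ := h1
        exact ⟨⟨y, hF x.2 h1⟩, rfl⟩
      · have h1 := (hop.map_e i x.1).trans ((opE_iff_opF _ _ _).2 h)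
        rw [Option.map_eq_some_iff] at h1
        obtain ⟨y, h1, rfl⟩ := h1
        exact ⟨⟨y, hE x.2 (hef h1)⟩, rfl⟩
  · exact (restrict_map (toWord n k) fun y h => hF x.2 h).trans (hop.map_f i x.1)
  · exact (restrict_map (toWord n k) fun y h => hE x.2 (hef h)).trans (hop.map_e i x.1)

end QueerPlus

theorem mainTheorem5 (n : ℕ) (hn : 2 ≤ n) (v w : List QueerPlus.PNum)
    (hv : ∀ x ∈ v, (x.num : ℕ) ≤ n) (hw : ∀ x ∈ w, (x.num : ℕ) ≤ n) :
    [ QueerPlus.Pdec v = QueerPlus.Pdec w,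
      QueerPlus.decCon (FreeMonoid.ofList v) (FreeMonoid.ofList w),
      ∃ φ : (QueerPlus.fullSubcrystal
              (QueerPlus.tensorPow (QueerPlus.stdCrystal n) v.length)
              (QueerPlus.wordTensor n v hv)).Carrier →
            (QueerPlus.fullSubcrystal
              (QueerPlus.tensorPow (QueerPlus.stdCrystal n) w.length)
              (QueerPlus.wordTensor n w hw)).Carrier,
        QueerPlus.IsCrystalIso _ _ φ ∧
          φ (QueerPlus.base _ (QueerPlus.wordTensor n v hv)) =
            QueerPlus.base _ (QueerPlus.wordTensor n w hw) ].TFAE := by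
  have hV := QueerPlus.isWordModel_subWord hn (QueerPlus.wordTensor n v hv)
  have hW := QueerPlus.isWordModel_subWord hn (QueerPlus.wordTensor n w hw)
  rw [QueerPlus.toWord_wordTensor] at hV hW
  have hv' : QueerPlus.subWord n _ _ (QueerPlus.base _ (QueerPlus.wordTensor n v hv)) = v :=
    QueerPlus.toWord_wordTensor v hv
  have hw' : QueerPlus.subWord n _ _ (QueerPlus.base _ (QueerPlus.wordTensor n w hw)) = w :=
    QueerPlus.toWord_wordTensor w hw
  tfae_have 1 → 2 := QueerPlus.dec_of_Pdec_eq
  tfae_have 2 → 3 := hV.exists_iso hn hW hv' hw'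
  tfae_have 3 → 1 := by
    rintro ⟨φ, hφ, h⟩
    exact hV.Pdec_eq hW hv' hv hw hφ (by rw [h]; exact hw')
  tfae_finish
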